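/- Work over $\mathbb{C}$. Let $\mathfrak{q}(n)$ be the Lie superalgebra of block matrices $X_{A,B}=\begin{pmatrix}A&B\\B&A\end{pmatrix}$ with $A,B\in\mathrm{Mat}_n(\mathbb{C})$ (even part: $B=0$, odd part: $A=0$) and the supercommutator as bracket; let $\mathfrak{sq}(n)=\{X_{A,B}:\operatorname{tr}B=0\}$, $\mathfrak{pq}(n)=\mathfrak{q}(n)/\mathbb{C}\,\mathrm{Id}$ and $\mathfrak{psq}(n)=\mathfrak{sq}(n)/\mathbb{C}\,\mathrm{Id}$. Let $\mathfrak{g}$ be $\mathfrak{q}(n)$ or $\mathfrak{sq}(n)$ with $n\ge 2$, or $\mathfrak{pq}(n)$ or $\mathfrak{psq}(n)$ with $n\ge 3$. Let $\mathfrak{g}=\mathfrak{n}^-\oplus\mathfrak{h}\oplus\mathfrak{n}^+$ be the triangular decomposition induced by strictly lower triangular, diagonal and strictly upper triangular $A,B$, and put $\mathfrak{b}^-=\mathfrak{n}^-\oplus\mathfrak{h}$. Let $\alpha_k=\varepsilon_k-\varepsilon_{k+1}$ $(1\le k\le n-1)$ be the simple roots, $Q=\bigoplus_k\mathbb{Z}\alpha_k$,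 $Q^+=\bigoplus_k\mathbb{Z}_{\ge0}\alpha_k$ and $\operatorname{ht}(\sum_k m_k\alpha_k)=\sum_k m_k$. For $\nu\in Q$ let $\mathcal{U}(\mathfrak{n}^+)_\nu$ be the component of weight $\nu$ of the enveloping algebra $\mathcal{U}(\mathfrak{n}^+)$, and for $\nu\in Q^+$ put $J'(\nu)=\mathcal{U}(\mathfrak{b}^-)\,\mathcal{U}(\mathfrak{n}^+)_\nu\subset\mathcal{U}(\mathfrak{g})$. Let $\preceq$ be one of the following two relations on $Q$: either $\nu\preceq\mu$ iff $\mu-\nu\in Q^+$, or $\nu\preceq\mu$ iff $\operatorname{ht}\nu\le\operatorname{ht}\mu$. Let $\hat U$ be the completion of $\mathcal{U}(\mathfrak{g})$ for the topology in which the left ideals $J(\nu)=\mathcal{U}(\mathfrak{g})\sum_{\mu\succeq\nu}\mathcal{U}(\mathfrak{n}^+)_\mu$, $\nu\in Q$, form a basis of neighbourhoods of zero; it is a topological ring. Its even and odd parts are the closures of those of $\mathcal{U}(\mathfrak{g})$, and its centre $\mathcal{Z}(\hat U)$ is taken in the super sense: it consists of the sums of an even and an odd element each of which supercommutes with all homogeneous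 elements of $\hat U$. The canonical filtration $\mathcal{F}^r(\mathcal{U}(\mathfrak{g}))$ (spanned by products of at most $r$ elements of $\mathfrak{g}$) is extended to $\hat U$ by taking closures; $\deg u$ is the least $r$ with $u\in\mathcal{F}^r$, with $\deg u=\infty$ if there is no such $r$, and $\deg 0=-\infty$. Then every $u\in\hat U$ can be written uniquely as a convergent sum $u=\sum_{\nu\in Q^+}u(\nu)$ with $u(\nu)\in J'(\nu)$, and $\hat U=\mathcal{U}(\mathfrak{h})\oplus\bigl(\mathfrak{n}^-\mathcal{U}(\mathfrak{b}^-)+\hat U\mathfrak{n}^+\bigr)$. Let $\mathrm{HC}:\hat U\to\mathcal{U}(\mathfrak{h})$ be the projection along the latter decomposition. For every $z\in\mathcal{Z}(\hat U)$ one has $$\deg z=\deg\mathrm{HC}(z),$$ and $\deg z(\nu)\le\deg z(0)$ for every $\nu\in Q^+$. -/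

import Mathlib

noncomputable section

namespace QType

/-! ### Lie superalgebras and their universal enveloping algebras -/

/-- The sign `(-1) ^ (i j)` for parities `i, j ∈ ℤ/2`. -/
def sgn (i j : ZMod 2) : ℂ := if i = 1 ∧ j = 1 then -1 else 1

/-- A complex Lie superalgebra: a `ℤ/2`-graded vector space with an even bilinear bracket which
is super skew-symmetric and satisfies the super Jacobi identity. -/
class LieSuperalgebra (L : Type*) [AddCommGroup L] [Module ℂ L] where
  part : ZMod 2 → Submodule ℂ L
  isCompl_part : IsCompl (part 0) (part 1)
  br : L →ₗ[ℂ] L →ₗ[ℂ] L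
  br_mem : ∀ {i j : ZMod 2} {x y : L}, x ∈ part i → y ∈ part j → br x y ∈ part (i + j)
  br_skew : ∀ {i j : ZMod 2} {x y : L}, x ∈ part i → y ∈ part j →
    br x y = -(sgn i j • br y x)
  br_jacobi : ∀ {i j : ZMod 2} {x y : L}, x ∈ part i → y ∈ part j → ∀ z : L,
    br x (br y z) = br (br x y) z + sgn i j • br y (br x z)

section Env

variable (L : Type*) [AddCommGroup L] [Module ℂ L] [LieSuperalgebra L]

/-- The relations `x y - (-1) ^ (p(x) p(y)) y x = [x, y]` on the tensor algebra. -/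
inductive EnvRel : TensorAlgebra ℂ L → TensorAlgebra ℂ L → Prop
  | br {i j : ZMod 2} {x y : L} (hx : x ∈ LieSuperalgebra.part i)
      (hy : y ∈ LieSuperalgebra.part j) :
      EnvRel (TensorAlgebra.ι ℂ x * TensorAlgebra.ι ℂ y
          - sgn i j • (TensorAlgebra.ι ℂ y * TensorAlgebra.ι ℂ x))
        (TensorAlgebra.ι ℂ (LieSuperalgebra.br x y))

/-- The universal enveloping algebra of a Lie superalgebra. -/
def Env : Type _ := RingQuot (EnvRel L)

instance : Ring (Env L) := inferInstanceAs (Ring (RingQuot (EnvRel L)))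

instance : Algebra ℂ (Env L) := inferInstanceAs (Algebra ℂ (RingQuot (EnvRel L)))

variable {L}

/-- The quotient map from the tensor algebra. -/
def Env.quot : TensorAlgebra ℂ L →ₐ[ℂ] Env L := RingQuot.mkAlgHom ℂ (EnvRel L)

/-- The canonical map `L → U(L)`. -/
def Env.ι : L →ₗ[ℂ] Env L := Env.quot.toLinearMap ∘ₗ TensorAlgebra.ι ℂ

theorem Env.ι_mul_ι {i j : ZMod 2} {x y : L} (hx : x ∈ LieSuperalgebra.part i)
    (hy : y ∈ LieSuperalgebra.part j) :
    Env.ι x * Env.ι y = sgn i j • (Env.ι y * Env.ι x) + Env.ι (LieSuperalgebra.br x y) := by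
  have h : Env.quot (TensorAlgebra.ι ℂ x * TensorAlgebra.ι ℂ y
      - sgn i j • (TensorAlgebra.ι ℂ y * TensorAlgebra.ι ℂ x))
      = Env.quot (TensorAlgebra.ι ℂ (LieSuperalgebra.br x y)) :=
    RingQuot.mkAlgHom_rel ℂ (EnvRel.br hx hy)
  rw [map_sub, map_smul, map_mul, map_mul, sub_eq_iff_eq_add'] at h
  exact h

/-- Induction principle: a subset of `U(L)` containing the scalars and `L` and closed under
sums and products is everything. -/
theorem Env.induct {C : Env L → Prop} (hs : ∀ r : ℂ, C (algebraMap ℂ (Env L) r))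
    (hι : ∀ x : L, C (Env.ι x)) (hm : ∀ a b, C a → C b → C (a * b))
    (ha : ∀ a b, C a → C b → C (a + b)) (u : Env L) : C u := by
  obtain ⟨t, rfl⟩ := RingQuot.mkAlgHom_surjective ℂ (EnvRel L) u
  change C (Env.quot t)
  induction t using TensorAlgebra.induction with
  | algebraMap r => rw [AlgHom.commutes]; exact hs r
  | ι x => exact hι x
  | mul a b h1 h2 => rw [map_mul]; exact hm _ _ h1 h2
  | add a b h1 h2 => rw [map_add]; exact ha _ _ h1 h2

/-- For a family `P g` of subspaces of `L` indexed by degrees `g`: the span of all products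
`x₁ ⋯ xₖ` in `U(L)` (`k ≥ 0`) with `xᵢ ∈ P gᵢ` and `g₁ + ⋯ + gₖ = g`. -/
def gradedSpan {G : Type*} [AddMonoid G] (P : G → Submodule ℂ L) (g : G) :
    Submodule ℂ (Env L) :=
  Submodule.span ℂ {u | ∃ l : List (G × L), (∀ a ∈ l, a.2 ∈ P a.1) ∧
    (l.map Prod.fst).sum = g ∧ u = (l.map fun a => Env.ι a.2).prod}

/-- The elements of parity `i` in `U(L)`. -/
def Env.part (i : ZMod 2) : Submodule ℂ (Env L) := gradedSpan LieSuperalgebra.part i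

/-- The canonical filtration: `Env.filt k` is spanned by products of at most `k` elements
of `L`. -/
def Env.filt (k : ℕ) : Submodule ℂ (Env L) := (1 ⊔ LinearMap.range (Env.ι (L := L))) ^ k

end Env

/-- The degree of `x` with respect to a filtration `F`: it is `⊥` (that is, `-∞`) for `x = 0`,
and `⊤` (that is, `∞`) if `x` lies in no `F k`. -/
def filtDeg {A : Type*} [Zero A] (F : ℕ → Set A) (x : A) : WithBot ℕ∞ :=
  open Classical in
  if x = 0 then ⊥ else ((⨅ (k : ℕ) (_ : x ∈ F k), (k : ℕ∞) : ℕ∞) : WithBot ℕ∞)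

/-! ### The Lie superalgebras `q(n)`, `sq(n)`, `pq(n)`, `psq(n)` -/

/-- The underlying space of `q(n)`; the pair `(A, B)` stands for the block matrix
`X_{A,B}` with rows `(A | B)` and `(B | A)`. -/
abbrev Q (n : ℕ) : Type := Matrix (Fin n) (Fin n) ℂ × Matrix (Fin n) (Fin n) ℂ

/-- The parity components `{X_{A,0}}` and `{X_{0,B}}` of `q(n)`. -/
def qPart (n : ℕ) (i : ZMod 2) : Submodule ℂ (Q n) :=
  if i = 0 then LinearMap.ker (LinearMap.snd ℂ _ _) else LinearMap.ker (LinearMap.fst ℂ _ _)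

/-- The super bracket of `q(n)`, the supercommutator of block matrices:
`[X_{A,B}, X_{A',B'}] = X_{C,D}` with `C = [A, A'] + B B' + B' B` and
`D = [A, B'] + [B, A']`. -/
def qBr (n : ℕ) : Q n →ₗ[ℂ] Q n →ₗ[ℂ] Q n :=
  LinearMap.mk₂ ℂ
    (fun x y => (x.1 * y.1 - y.1 * x.1 + (x.2 * y.2 + y.2 * x.2),
      (x.1 * y.2 - y.2 * x.1) + (x.2 * y.1 - y.1 * x.2)))
    (by intros; ext1 <;> simp only [Prod.fst_add, Prod.snd_add] <;> noncomm_ring)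
    (by intros; ext1 <;> simp [smul_sub, smul_add])
    (by intros; ext1 <;> simp only [Prod.fst_add, Prod.snd_add] <;> noncomm_ring)
    (by intros; ext1 <;> simp [smul_sub, smul_add])

theorem qBr_apply {n : ℕ} (x y : Q n) :
    qBr n x y = (x.1 * y.1 - y.1 * x.1 + (x.2 * y.2 + y.2 * x.2),
      (x.1 * y.2 - y.2 * x.1) + (x.2 * y.1 - y.1 * x.2)) := rfl

theorem mem_qPart_zero {n : ℕ} {x : Q n} : x ∈ qPart n 0 ↔ x.2 = 0 := by
  simp [qPart]

theorem mem_qPart_one {n : ℕ} {x : Q n} : x ∈ qPart n 1 ↔ x.1 = 0 := by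
  simp [qPart]

theorem zmod2_cases (i : ZMod 2) : i = 0 ∨ i = 1 := by
  revert i; decide

theorem qBr_mem {n : ℕ} {i j : ZMod 2} {x y : Q n} (hx : x ∈ qPart n i) (hy : y ∈ qPart n j) :
    qBr n x y ∈ qPart n (i + j) := by
  have h2 : (1 : ZMod 2) + 1 = 0 := by decide
  obtain rfl | rfl := zmod2_cases i <;> obtain rfl | rfl := zmod2_cases j <;>
    simp only [add_zero, zero_add, h2, mem_qPart_zero, mem_qPart_one] at hx hy ⊢ <;>
    simp [qBr_apply, hx, hy]

theorem sgn_00 : sgn 0 0 = 1 := by simp [sgn]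
theorem sgn_01 : sgn 0 1 = 1 := by simp [sgn]
theorem sgn_10 : sgn 1 0 = 1 := by simp [sgn]
theorem sgn_11 : sgn 1 1 = -1 := by simp [sgn]

theorem qBr_skew {n : ℕ} {i j : ZMod 2} {x y : Q n} (hx : x ∈ qPart n i)
    (hy : y ∈ qPart n j) : qBr n x y = -(sgn i j • qBr n y x) := by
  obtain ⟨x1, x2⟩ := x
  obtain ⟨y1, y2⟩ := y
  obtain rfl | rfl := zmod2_cases i <;> obtain rfl | rfl := zmod2_cases j <;>
    simp only [mem_qPart_zero, mem_qPart_one] at hx hy <;> subst hx <;> subst hy <;>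
    simp only [sgn_00, sgn_01, sgn_10, sgn_11, one_smul, neg_smul, neg_neg, qBr_apply] <;>
    ext1 <;> simp only [Prod.fst_neg, Prod.snd_neg] <;> noncomm_ring

theorem qBr_jacobi {n : ℕ} {i j : ZMod 2} {x y : Q n} (hx : x ∈ qPart n i)
    (hy : y ∈ qPart n j) (z : Q n) :
    qBr n x (qBr n y z) = qBr n (qBr n x y) z + sgn i j • qBr n y (qBr n x z) := by
  obtain ⟨x1, x2⟩ := x
  obtain ⟨y1, y2⟩ := y
  obtain ⟨z1, z2⟩ := z
  obtain rfl | rfl := zmod2_cases i <;> obtain rfl | rfl := zmod2_cases j <;>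
    simp only [mem_qPart_zero, mem_qPart_one] at hx hy <;> subst hx <;> subst hy <;>
    simp only [sgn_00, sgn_01, sgn_10, sgn_11, one_smul, neg_smul, qBr_apply] <;>
    ext1 <;> simp only [Prod.fst_neg, Prod.snd_neg, Prod.fst_add, Prod.snd_add] <;>
    noncomm_ring

/-- The four families of `Q`-type Lie superalgebras. -/
inductive Kind
  | q
  | sq
  | pq
  | psq

/-- The smallest `n` that is allowed: `2` for `q(n), sq(n)` and `3` for `pq(n), psq(n)`. -/
def Kind.minRank : Kind → ℕ
  | .q => 2
  | .sq => 2
  | .pq => 3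
  | .psq => 3

/-- The subalgebra `{x ∈ q(n) | tr' x = 0}`, where `tr' X_{A,B} = tr B`. -/
def traceless (n : ℕ) : Submodule ℂ (Q n) :=
  LinearMap.ker (Matrix.traceLinearMap (Fin n) ℂ ℂ ∘ₗ LinearMap.snd ℂ _ _)

/-- The subalgebra of `q(n)`, either `q(n)` or `sq(n)`, of which the algebra is a quotient. -/
def Kind.sub (n : ℕ) : Kind → Submodule ℂ (Q n)
  | .q => ⊤
  | .sq => traceless n
  | .pq => ⊤
  | .psq => traceless n

/-- The central ideal, either `0` or `ℂ Id`, by which we divide. -/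
def Kind.ideal (n : ℕ) : Kind → Submodule ℂ (Q n)
  | .q => ⊥
  | .sq => ⊥
  | .pq => Submodule.span ℂ {(1, 0)}
  | .psq => Submodule.span ℂ {(1, 0)}

/-- The underlying space of `q(n)`, `sq(n)`, `pq(n) = q(n)/(Id)` or `psq(n) = sq(n)/(Id)`. -/
abbrev Alg (t : Kind) (n : ℕ) : Type := t.sub n ⧸ (t.ideal n).submoduleOf (t.sub n)

/-- The projection from `q(n)` or `sq(n)` to the algebra. -/
abbrev Alg.mk (t : Kind) (n : ℕ) : t.sub n →ₗ[ℂ] Alg t n :=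
  ((t.ideal n).submoduleOf (t.sub n)).mkQ

/-- The subspace of the algebra induced by a subspace `V` of `q(n)`. -/
def induced (t : Kind) {n : ℕ} (V : Submodule ℂ (Q n)) : Submodule ℂ (Alg t n) :=
  (V.submoduleOf (t.sub n)).map (Alg.mk t n)

theorem mem_sub_of_trace {t : Kind} {n : ℕ} {x : Q n} (hx : x.2.trace = 0) : x ∈ t.sub n := by
  cases t
  · trivial
  · simpa [Kind.sub, traceless] using hx
  · trivial
  · simpa [Kind.sub, traceless] using hx

theorem mem_sub_of_snd_eq {t : Kind} {n : ℕ} {x y : Q n} (hx : x ∈ t.sub n)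
    (h : y.2.trace = x.2.trace) : y ∈ t.sub n := by
  cases t
  · trivial
  · simpa [Kind.sub, traceless, h] using hx
  · trivial
  · simpa [Kind.sub, traceless, h] using hx

theorem trace_qBr {n : ℕ} (x y : Q n) : (qBr n x y).2.trace = 0 := by
  simp [qBr_apply, Matrix.trace_mul_comm x.1 y.2, Matrix.trace_mul_comm x.2 y.1]

theorem ideal_cases {t : Kind} {n : ℕ} {x : Q n} (hx : x ∈ t.ideal n) :
    ∃ c : ℂ, x = (c • 1, 0) := by
  cases t
  · exact ⟨0, by rw [(Submodule.mem_bot ℂ).1 hx, zero_smul]; rfl⟩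
  · exact ⟨0, by rw [(Submodule.mem_bot ℂ).1 hx, zero_smul]; rfl⟩
  · obtain ⟨c, rfl⟩ := Submodule.mem_span_singleton.1 hx
    exact ⟨c, by simp⟩
  · obtain ⟨c, rfl⟩ := Submodule.mem_span_singleton.1 hx
    exact ⟨c, by simp⟩

theorem qBr_ideal_left {t : Kind} {n : ℕ} {x : Q n} (hx : x ∈ t.ideal n) (y : Q n) :
    qBr n x y = 0 := by
  obtain ⟨c, rfl⟩ := ideal_cases hx
  ext1 <;> simp [qBr_apply]

theorem qBr_ideal_right {t : Kind} {n : ℕ} {x : Q n} (hx : x ∈ t.ideal n) (y : Q n) :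
    qBr n y x = 0 := by
  obtain ⟨c, rfl⟩ := ideal_cases hx
  ext1 <;> simp [qBr_apply]

/-- The bracket of `q(n)` on the subalgebra, as an element of the quotient. -/
def subBr (t : Kind) (n : ℕ) : t.sub n →ₗ[ℂ] t.sub n →ₗ[ℂ] Alg t n :=
  LinearMap.mk₂ ℂ
    (fun x y => Alg.mk t n ⟨qBr n x y, mem_sub_of_trace (trace_qBr _ _)⟩)
    (by intro x x' y; rw [← map_add]; congr 1; ext1; simp)
    (by intro c x y; rw [← map_smul]; congr 1; ext1; simp)
    (by intro x x' y; rw [← map_add]; congr 1; ext1; simp)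
    (by intro c x y; rw [← map_smul]; congr 1; ext1; simp)

/-- The bracket of the algebra, induced by that of `q(n)`. -/
def algBr (t : Kind) (n : ℕ) : Alg t n →ₗ[ℂ] Alg t n →ₗ[ℂ] Alg t n :=
  Submodule.liftQ _
    ((Submodule.liftQ _ (subBr t n).flip (by
      intro x hx
      rw [LinearMap.mem_ker]
      ext1 y
      have h : qBr n y x = 0 := qBr_ideal_right (t := t) hx y
      change Alg.mk t n ⟨qBr n y x, _⟩ = 0
      simp only [h]
      exact map_zero _)).flip) (by
    intro x hx
    rw [LinearMap.mem_ker]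
    ext y
    have h : qBr n x y = 0 := qBr_ideal_left (t := t) hx y
    change Alg.mk t n ⟨qBr n x y, _⟩ = 0
    simp only [h]
    exact map_zero _)

theorem algBr_mk {t : Kind} {n : ℕ} (x y : t.sub n) :
    algBr t n (Alg.mk t n x) (Alg.mk t n y)
      = Alg.mk t n ⟨qBr n x y, mem_sub_of_trace (trace_qBr _ _)⟩ := rfl

theorem mem_induced {t : Kind} {n : ℕ} {V : Submodule ℂ (Q n)} {x : Alg t n} :
    x ∈ induced t V ↔ ∃ v : t.sub n, (v : Q n) ∈ V ∧ Alg.mk t n v = x := Iff.rfl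

theorem isCompl_induced_qPart (t : Kind) (n : ℕ) :
    IsCompl (induced t (qPart n 0)) (induced t (qPart n 1)) := by
  constructor
  · rw [Submodule.disjoint_def]
    rintro x ⟨v, hv, rfl⟩ ⟨w, hw, hvw⟩
    have h1 : (v : Q n).2 = 0 := mem_qPart_zero.1 hv
    have h2 : (w : Q n).1 = 0 := mem_qPart_one.1 hw
    have h3 : (w - v : t.sub n) ∈ (t.ideal n).submoduleOf (t.sub n) :=
      (Submodule.Quotient.eq _).1 hvw
    obtain ⟨c, hc⟩ := ideal_cases (t := t) (n := n) h3
    have h4 : (w : Q n).2 = 0 := by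
      have := congrArg Prod.snd hc
      simpa [h1] using this
    have h5 : w = 0 := by
      ext1
      exact Prod.ext h2 h4
    rw [← hvw, h5, map_zero]
  · rw [codisjoint_iff, eq_top_iff]
    rintro x -
    obtain ⟨v, rfl⟩ := Submodule.mkQ_surjective _ x
    have hv0 : ((v : Q n).1, (0 : Matrix (Fin n) (Fin n) ℂ)) ∈ t.sub n :=
      mem_sub_of_trace (by simp)
    have hv1 : ((0 : Matrix (Fin n) (Fin n) ℂ), (v : Q n).2) ∈ t.sub n :=
      mem_sub_of_snd_eq v.2 rfl
    refine Submodule.mem_sup.2 ⟨Alg.mk t n ⟨_, hv0⟩, ⟨_, mem_qPart_zero.2 rfl, rfl⟩,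
      Alg.mk t n ⟨_, hv1⟩, ⟨_, mem_qPart_one.2 rfl, rfl⟩, ?_⟩
    rw [← map_add]
    congr 1
    ext1
    simp

instance (t : Kind) (n : ℕ) : LieSuperalgebra (Alg t n) where
  part i := induced t (qPart n i)
  isCompl_part := isCompl_induced_qPart t n
  br := algBr t n
  br_mem := by
    rintro i j x y ⟨v, hv, rfl⟩ ⟨w, hw, rfl⟩
    exact ⟨_, qBr_mem hv hw, (algBr_mk v w).symm⟩
  br_skew := by
    rintro i j x y ⟨v, hv, rfl⟩ ⟨w, hw, rfl⟩
    rw [algBr_mk, algBr_mk, ← map_smul, ← map_neg]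
    congr 1
    ext1
    exact qBr_skew hv hw
  br_jacobi := by
    rintro i j x y ⟨v, hv, rfl⟩ ⟨w, hw, rfl⟩ z
    obtain ⟨u, rfl⟩ := Submodule.mkQ_surjective _ z
    rw [algBr_mk, algBr_mk, algBr_mk, algBr_mk, algBr_mk, algBr_mk, ← map_smul, ← map_add]
    congr 1
    ext1
    exact qBr_jacobi hv hw u

/-! ### Roots and the triangular decomposition -/

/-- The root lattice `Q(π)`, in coordinates with respect to the simple roots
`α_k = ε_k - ε_{k+1}`. Its pointwise order is the order
`ν ≥ μ ↔ ν - μ ∈ Q⁺ = ∑ ℤ_{≥0} α`. -/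
abbrev RootLattice (n : ℕ) : Type := Fin (n - 1) → ℤ

/-- The weight `ε_i - ε_j` in the root lattice. -/
def root {n : ℕ} (i j : Fin n) : RootLattice n := fun k =>
  (if i.val ≤ k.val then 1 else 0) - (if j.val ≤ k.val then 1 else 0)

/-- The height `∑ kᵢ` of `∑ kᵢ αᵢ`. -/
def height {n : ℕ} (ν : RootLattice n) : ℤ := ∑ k, ν k

/-- The elements `X_{A,B}` of `q(n)` such that all non-zero entries of `A` and `B` are at
positions `(i, j)` with `P i j`. -/
def supported {n : ℕ} (P : Fin n → Fin n → Prop) : Submodule ℂ (Q n) where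
  carrier := {x | ∀ i j, ¬ P i j → x.1 i j = 0 ∧ x.2 i j = 0}
  add_mem' := by
    intro x y hx hy i j h
    simp [hx i j h, hy i j h]
  zero_mem' := by simp
  smul_mem' := by
    intro c x hx i j h
    simp [hx i j h]

section Triangular

variable (t : Kind) (n : ℕ)

/-- The Cartan subalgebra `h` (both parities): diagonal `A` and `B`. -/
def cartan : Submodule ℂ (Alg t n) := induced t (supported fun i j => i = j)

/-- `n⁺`: strictly upper triangular `A` and `B`. -/
def nPlus : Submodule ℂ (Alg t n) := induced t (supported fun i j => i < j)

/-- `n⁻`: strictly lower triangular `A` and `B`. -/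
def nMinus : Submodule ℂ (Alg t n) := induced t (supported fun i j => j < i)

/-- `b⁻ = n⁻ + h`. -/
def bMinus : Submodule ℂ (Alg t n) := nMinus t n ⊔ cartan t n

/-- The weight space of weight `α` in `n⁺`. -/
def nPlusRoot (α : RootLattice n) : Submodule ℂ (Alg t n) :=
  induced t (supported fun i j => i < j ∧ root i j = α)

/-- The enveloping algebra `U(g)`. -/
abbrev U : Type := Env (Alg t n)

/-- `U(h)`, as a subalgebra of `U(g)`. -/
def UCartan : Subalgebra ℂ (U t n) := Algebra.adjoin ℂ (Env.ι '' (cartan t n : Set (Alg t n)))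

/-- `U(b⁻)`, as a subalgebra of `U(g)`. -/
def UBMinus : Subalgebra ℂ (U t n) := Algebra.adjoin ℂ (Env.ι '' (bMinus t n : Set (Alg t n)))

/-- The weight component `U(n⁺)_ν`: the span of the products of root vectors in `n⁺` whose
weights add up to `ν`. -/
def UNPlus (ν : RootLattice n) : Submodule ℂ (U t n) := gradedSpan (nPlusRoot t n) ν

/-- `J'(ν) = U(b⁻) U(n⁺)_ν`. -/
def JPrime (ν : RootLattice n) : Submodule ℂ (U t n) :=
  Subalgebra.toSubmodule (UBMinus t n) * UNPlus t n ν

end Triangular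

/-- Two ways of comparing weights, giving rise to two completions. -/
inductive Comparison
  | order
  | height

/-- `κ.le ν μ` is `ν ≤ μ` in the partial order of the root lattice for `κ = order`, and
`height ν ≤ height μ` for `κ = height`. -/
def Comparison.le {n : ℕ} (κ : Comparison) (ν μ : RootLattice n) : Prop :=
  match κ with
  | .order => ν ≤ μ
  | .height => QType.height ν ≤ QType.height μ

section Completion

variable (κ : Comparison) (t : Kind) (n : ℕ)

/-- The left ideal `J(ν) = U(g) U(n⁺)_{≥ ν}`. -/
def J (ν : RootLattice n) : Ideal (U t n) :=
  Ideal.span {u | ∃ μ, κ.le ν μ ∧ u ∈ UNPlus t n μ}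

variable {κ t n}

theorem Comparison.le_refl (ν : RootLattice n) : κ.le ν ν := by
  cases κ
  · exact _root_.le_refl ν
  · exact _root_.le_refl (QType.height ν)

theorem Comparison.le_trans {ν μ ξ : RootLattice n} (h : κ.le ν μ) (h' : κ.le μ ξ) :
    κ.le ν ξ := by
  cases κ
  · exact _root_.le_trans (α := RootLattice n) h h'
  · exact _root_.le_trans (α := ℤ) h h'

theorem height_add (ν μ : RootLattice n) : height (ν + μ) = height ν + height μ := by
  simp [height, Finset.sum_add_distrib]

theorem Comparison.add_right {ν μ : RootLattice n} (h : κ.le ν μ) (ξ : RootLattice n) :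
    κ.le (ν + ξ) (μ + ξ) := by
  cases κ
  · exact add_le_add_left (α := RootLattice n) h ξ
  · change QType.height (ν + ξ) ≤ QType.height (μ + ξ)
    rw [height_add, height_add]
    exact add_le_add_left (α := ℤ) h _

theorem Comparison.exists_ge (ν μ : RootLattice n) : ∃ ξ, κ.le ν ξ ∧ κ.le μ ξ := by
  cases κ
  · exact ⟨ν ⊔ μ, le_sup_left (α := RootLattice n), le_sup_right (α := RootLattice n)⟩
  · rcases le_total (QType.height ν) (QType.height μ) with h | h
    · exact ⟨μ, h, _root_.le_refl _⟩
    · exact ⟨ν, _root_.le_refl _, h⟩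

theorem Comparison.le_of_le {ν μ : RootLattice n} (h : ν ≤ μ) : κ.le ν μ := by
  cases κ
  · exact h
  · exact Finset.sum_le_sum fun k _ => h k

theorem J_anti {ν μ : RootLattice n} (h : κ.le ν μ) : J κ t n μ ≤ J κ t n ν :=
  Ideal.span_mono fun _ ⟨ξ, hξ, hu⟩ => ⟨ξ, Comparison.le_trans h hξ, hu⟩

theorem smul_mem_J {ν : RootLattice n} {u : U t n} (c : ℂ) (hu : u ∈ J κ t n ν) :
    c • u ∈ J κ t n ν := by
  rw [Algebra.smul_def]
  exact Ideal.mul_mem_left _ _ hu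

theorem mem_UNPlus_mul {γ β : RootLattice n} {u : U t n} {y : Alg t n}
    (hu : u ∈ UNPlus t n γ) (hy : y ∈ nPlusRoot t n β) :
    u * Env.ι y ∈ UNPlus t n (γ + β) := by
  unfold UNPlus gradedSpan at hu
  induction hu using Submodule.span_induction with
  | mem u hu =>
    obtain ⟨l, hl, rfl, rfl⟩ := hu
    refine Submodule.subset_span ⟨l ++ [(β, y)], ?_, by simp, by simp⟩
    intro a ha
    rcases List.mem_append.1 ha with h | h
    · exact hl a h
    · rw [List.mem_singleton.1 h]; exact hy
  | zero => rw [zero_mul]; exact Submodule.zero_mem _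
  | add a b _ _ ha hb => rw [add_mul]; exact Submodule.add_mem _ ha hb
  | smul c a _ ha => rw [smul_mul_assoc]; exact Submodule.smul_mem _ _ ha

theorem mem_J_mul {ν β : RootLattice n} {u : U t n} {x : U t n}
    (h : ∀ μ, ∀ v ∈ UNPlus t n μ, v * x ∈ J κ t n (μ + β)) (hu : u ∈ J κ t n ν) :
    u * x ∈ J κ t n (ν + β) := by
  unfold J Ideal.span at hu
  induction hu using Submodule.span_induction with
  | mem u hu =>
    obtain ⟨μ, hμ, hu⟩ := hu
    exact J_anti (Comparison.add_right hμ β) (h μ u hu)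
  | zero => rw [zero_mul]; exact Submodule.zero_mem _
  | add a b _ _ ha hb => rw [add_mul]; exact Submodule.add_mem _ ha hb
  | smul c a _ ha =>
    rw [smul_eq_mul, mul_assoc]; exact Ideal.mul_mem_left _ _ ha

theorem root_add (i k j : Fin n) : root i k + root k j = root i j := by
  funext m
  simp [root]

theorem root_nonpos {i j : Fin n} (h : j ≤ i) : root i j ≤ 0 := by
  intro k
  have h' : j.val ≤ i.val := h
  simp only [root, Pi.zero_apply]
  split_ifs <;> omega

theorem qBr_supported {α β : RootLattice n} {x y : Q n}
    (hx : x ∈ supported fun i j => root i j = α) (hy : y ∈ supported fun i j => root i j = β) :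
    qBr n x y ∈ supported fun i j => root i j = α + β := by
  have key : ∀ (A B : Matrix (Fin n) (Fin n) ℂ) (α β : RootLattice n),
      (∀ i j, root i j ≠ α → A i j = 0) → (∀ i j, root i j ≠ β → B i j = 0) →
      ∀ i j, root i j ≠ α + β → (A * B) i j = 0 := by
    intro A B α β hA hB i j hij
    rw [Matrix.mul_apply]
    refine Finset.sum_eq_zero fun k _ => ?_
    by_cases h1 : root i k = α
    · by_cases h2 : root k j = β
      · exact absurd (by rw [← h1, ← h2, root_add]) hij
      · rw [hB _ _ h2, mul_zero]
    · rw [hA _ _ h1, zero_mul]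
  intro i j hij
  have hij' : root i j ≠ β + α := by rwa [add_comm]
  have x1 := fun i j h => (hx i j h).1
  have x2 := fun i j h => (hx i j h).2
  have y1 := fun i j h => (hy i j h).1
  have y2 := fun i j h => (hy i j h).2
  constructor <;>
    simp [qBr_apply, key _ _ α β x1 y1 i j hij, key _ _ α β x1 y2 i j hij,
      key _ _ α β x2 y1 i j hij, key _ _ α β x2 y2 i j hij, key _ _ β α y1 x1 i j hij',
      key _ _ β α y1 x2 i j hij', key _ _ β α y2 x1 i j hij', key _ _ β α y2 x2 i j hij']

/-- The strictly upper triangular part of a matrix. -/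
def upperPart (A : Matrix (Fin n) (Fin n) ℂ) : Matrix (Fin n) (Fin n) ℂ :=
  Matrix.of fun i j => if i < j then A i j else 0

theorem trace_upperPart (A : Matrix (Fin n) (Fin n) ℂ) : (upperPart A).trace = 0 := by
  simp [upperPart, Matrix.trace]

theorem induced_split {α : RootLattice n} {x : Alg t n}
    (hx : x ∈ induced t (supported fun i j => root i j = α)) :
    ∃ y ∈ nPlusRoot t n α, ∃ z ∈ induced t (supported fun i j => j ≤ i ∧ root i j = α),
      x = y + z := by
  obtain ⟨v, hv, rfl⟩ := hx
  have hu : ((upperPart v.1.1, upperPart v.1.2) : Q n) ∈ t.sub n :=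
    mem_sub_of_trace (trace_upperPart _)
  have hv' : ∀ i j, ¬ root i j = α → v.1.1 i j = 0 ∧ v.1.2 i j = 0 := hv
  refine ⟨Alg.mk t n ⟨_, hu⟩, ⟨_, ?_, rfl⟩, Alg.mk t n (v - ⟨_, hu⟩), ⟨_, ?_, rfl⟩, ?_⟩
  · intro i j hij
    by_cases h : i < j
    · have := hv' i j fun h' => hij ⟨h, h'⟩
      simp [upperPart, this]
    · simp [upperPart, h]
  · intro i j hij
    by_cases h : i < j
    · simp [upperPart, h]
    · have := hv' i j fun h' => hij ⟨not_lt.1 h, h'⟩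
      simp [upperPart, h, this]
  · rw [← map_add]
    congr 1
    abel

theorem supported_mono {P R : Fin n → Fin n → Prop} (h : ∀ i j, P i j → R i j) :
    supported P ≤ supported R := fun _ hx i j hij => hx i j fun hP => hij (h i j hP)

theorem induced_mono {V W : Submodule ℂ (Q n)} (h : V ≤ W) : induced t V ≤ induced t W :=
  Submodule.map_mono fun _ hx => h hx

/-- Splitting an element of a space cut out by positions into its even and odd parts. -/
theorem induced_parity {P : Fin n → Fin n → Prop} {x : Alg t n}
    (hx : x ∈ induced t (supported P)) :
    ∃ x0 ∈ induced t (supported P), ∃ x1 ∈ induced t (supported P),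
      x0 ∈ LieSuperalgebra.part (L := Alg t n) 0 ∧ x1 ∈ LieSuperalgebra.part (L := Alg t n) 1 ∧
      x = x0 + x1 := by
  obtain ⟨v, hv, rfl⟩ := hx
  have hv' : ∀ i j, ¬ P i j → v.1.1 i j = 0 ∧ v.1.2 i j = 0 := hv
  have hv0 : ((v : Q n).1, (0 : Matrix (Fin n) (Fin n) ℂ)) ∈ t.sub n :=
    mem_sub_of_trace (by simp)
  have hv1 : ((0 : Matrix (Fin n) (Fin n) ℂ), (v : Q n).2) ∈ t.sub n :=
    mem_sub_of_snd_eq v.2 rfl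
  refine ⟨Alg.mk t n ⟨_, hv0⟩, ⟨⟨_, hv0⟩, fun i j h => ⟨(hv' i j h).1, rfl⟩, rfl⟩,
    Alg.mk t n ⟨_, hv1⟩, ⟨⟨_, hv1⟩, fun i j h => ⟨rfl, (hv' i j h).2⟩, rfl⟩,
    ⟨_, mem_qPart_zero.2 rfl, rfl⟩, ⟨_, mem_qPart_one.2 rfl, rfl⟩, ?_⟩
  rw [← map_add]
  congr 1
  ext1
  simp

theorem ι_mul_ι_induced {α β : RootLattice n} {x y : Alg t n}
    (hx : x ∈ induced t (supported fun i j => root i j = α)) (hy : y ∈ nPlusRoot t n β) :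
    ∃ l : List (Alg t n × Alg t n), (∀ a ∈ l, a.1 ∈ induced t (supported fun i j => root i j = α)
        ∧ a.2 ∈ nPlusRoot t n β) ∧
      ∃ z ∈ induced t (supported fun i j => root i j = α + β),
        Env.ι y * Env.ι x = (l.map fun a => Env.ι a.1 * Env.ι a.2).sum + Env.ι z := by
  have hom : ∀ {i j : ZMod 2} {x y : Alg t n}, x ∈ LieSuperalgebra.part (L := Alg t n) i →
      y ∈ LieSuperalgebra.part (L := Alg t n) j → x ∈ induced t (supported fun i j => root i j = α) →
      y ∈ nPlusRoot t n β →
      ∃ x' ∈ induced t (supported fun i j => root i j = α),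
      ∃ z ∈ induced t (supported fun i j => root i j = α + β),
        Env.ι y * Env.ι x = Env.ι x' * Env.ι y + Env.ι z := by
    intro i j x y hxi hyj hx hy
    refine ⟨sgn j i • x, Submodule.smul_mem _ _ hx, LieSuperalgebra.br y x, ?_, ?_⟩
    rotate_left
    · rw [map_smul, smul_mul_assoc]
      exact Env.ι_mul_ι hyj hxi
    · obtain ⟨v, hv, rfl⟩ := hx
      obtain ⟨w, hw, rfl⟩ := hy
      refine ⟨_, ?_, (algBr_mk w v).symm⟩
      rw [add_comm]
      exact qBr_supported (supported_mono (fun _ _ h => h.2) hw) hv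
  obtain ⟨x0, hx0, x1, hx1, px0, px1, rfl⟩ := induced_parity hx
  obtain ⟨y0, hy0, y1, hy1, py0, py1, rfl⟩ := induced_parity hy
  obtain ⟨a, ha, z, hz, e⟩ := hom px0 py0 hx0 hy0
  obtain ⟨a', ha', z', hz', e'⟩ := hom px1 py0 hx1 hy0
  obtain ⟨b, hb, w, hw, f⟩ := hom px0 py1 hx0 hy1
  obtain ⟨b', hb', w', hw', f'⟩ := hom px1 py1 hx1 hy1
  refine ⟨[(a, y0), (a', y0), (b, y1), (b', y1)], ?_, z + z' + (w + w'),
    Submodule.add_mem _ (Submodule.add_mem _ hz hz') (Submodule.add_mem _ hw hw'), ?_⟩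
  · intro c hc
    simp only [List.mem_cons, List.not_mem_nil, or_false] at hc
    rcases hc with rfl | rfl | rfl | rfl
    exacts [⟨ha, hy0⟩, ⟨ha', hy0⟩, ⟨hb, hy1⟩, ⟨hb', hy1⟩]
  · simp only [map_add, mul_add, add_mul, e, e', f, f', List.map_cons, List.map_nil,
      List.sum_cons, List.sum_nil]
    abel

theorem UNPlus_mul_ι (l : List (RootLattice n × Alg t n)) :
    (∀ a ∈ l, a.2 ∈ nPlusRoot t n a.1) → ∀ {α : RootLattice n} {x : Alg t n},
      x ∈ induced t (supported fun i j => root i j = α) →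
      (l.map fun a => Env.ι a.2).prod * Env.ι x ∈ J κ t n ((l.map Prod.fst).sum + α) := by
  induction l using List.reverseRecOn with
  | nil =>
    intro _ α x hx
    obtain ⟨y, hy, z, hz, rfl⟩ := induced_split hx
    simp only [List.map_nil, List.prod_nil, List.sum_nil, one_mul, zero_add, map_add]
    refine Submodule.add_mem _ (Ideal.subset_span ⟨α, Comparison.le_refl _, ?_⟩) ?_
    · exact Submodule.subset_span ⟨[(α, y)], by simpa using hy, by simp, by simp⟩
    · by_cases h : ∃ i j : Fin n, j ≤ i ∧ root i j = α
      · obtain ⟨i, j, hij, rfl⟩ := h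
        have h1 : (1 : U t n) ∈ J κ t n (root i j) :=
          Ideal.subset_span ⟨0, Comparison.le_of_le (root_nonpos hij),
            Submodule.subset_span ⟨[], by simp, by simp, by simp⟩⟩
        rw [← mul_one (Env.ι z)]
        exact Ideal.mul_mem_left _ _ h1
      · obtain ⟨v, hv, rfl⟩ := hz
        have hv' : ∀ i j, ¬ (j ≤ i ∧ root i j = α) → v.1.1 i j = 0 ∧ v.1.2 i j = 0 := hv
        have h0 : v = 0 := by
          ext1
          refine Prod.ext ?_ ?_
          · ext i j
            exact (hv' i j fun h' => h ⟨i, j, h'⟩).1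
          · ext i j
            exact (hv' i j fun h' => h ⟨i, j, h'⟩).2
        rw [h0, map_zero, map_zero]
        exact Submodule.zero_mem _
  | append_singleton l a ih =>
    intro hl α x hx
    have hl' : ∀ a ∈ l, a.2 ∈ nPlusRoot t n a.1 := fun b hb =>
      hl b (List.mem_append_left _ hb)
    have ha : a.2 ∈ nPlusRoot t n a.1 := hl a (by simp)
    obtain ⟨m, hm, z, hz, e⟩ := ι_mul_ι_induced hx ha
    simp only [List.map_append, List.map_cons, List.map_nil, List.prod_append, List.prod_cons,
      List.prod_nil, mul_one, List.sum_append, List.sum_cons, List.sum_nil, add_zero]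
    rw [mul_assoc, e, mul_add]
    refine Submodule.add_mem _ ?_ ?_
    · rw [← List.sum_map_mul_left]
      refine list_sum_mem fun u hu => ?_
      obtain ⟨b, hb, rfl⟩ := List.mem_map.1 hu
      rw [← mul_assoc, add_assoc, add_comm a.1 α, ← add_assoc]
      refine mem_J_mul ?_ (ih hl' (hm b hb).1)
      intro μ v hv
      exact Ideal.subset_span ⟨_, Comparison.le_refl _, mem_UNPlus_mul hv (hm b hb).2⟩
    · rw [add_assoc, add_comm a.1 α]
      exact ih hl' hz

theorem J_mul_ι {α ν : RootLattice n} {x : Alg t n} {u : U t n}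
    (hx : x ∈ induced t (supported fun i j => root i j = α)) (hu : u ∈ J κ t n ν) :
    u * Env.ι x ∈ J κ t n (ν + α) := by
  refine mem_J_mul ?_ hu
  intro μ v hv
  unfold UNPlus gradedSpan at hv
  induction hv using Submodule.span_induction with
  | mem u hu =>
    obtain ⟨l, hl, rfl, rfl⟩ := hu
    exact UNPlus_mul_ι l hl hx
  | zero => rw [zero_mul]; exact Submodule.zero_mem _
  | add a b _ _ ha hb => rw [add_mul]; exact Submodule.add_mem _ ha hb
  | smul c a _ ha => rw [smul_mul_assoc]; exact smul_mem_J _ ha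

/-- Every element of the algebra is a finite sum of weight vectors. -/
theorem exists_weight_sum (x : Alg t n) : ∃ l : List (RootLattice n × Alg t n),
    (∀ a ∈ l, a.2 ∈ induced t (supported fun i j => root i j = a.1)) ∧
      x = (l.map Prod.snd).sum := by
  classical
  obtain ⟨v, rfl⟩ := Submodule.mkQ_surjective _ x
  let s : Finset (RootLattice n) := insert 0 (Finset.univ.image fun p : Fin n × Fin n => root p.1 p.2)
  let c : RootLattice n → Matrix (Fin n) (Fin n) ℂ → Matrix (Fin n) (Fin n) ℂ :=
    fun α A => Matrix.of fun i j => if root i j = α then A i j else 0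
  have hroot : ∀ i : Fin n, root i i = 0 := fun i => by funext k; simp [root]
  have hc : ∀ α, ((c α v.1.1, c α v.1.2) : Q n) ∈ t.sub n := by
    intro α
    by_cases h : α = 0
    · exact mem_sub_of_snd_eq v.2 (by simp [c, Matrix.trace, hroot, h])
    · refine mem_sub_of_trace ?_
      simp [c, Matrix.trace, hroot, Ne.symm h]
  refine ⟨s.toList.map fun α => (α, Alg.mk t n ⟨_, hc α⟩), ?_, ?_⟩
  · intro a ha
    obtain ⟨α, -, rfl⟩ := List.mem_map.1 ha
    refine ⟨_, fun i j h => ?_, rfl⟩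
    have h' : ¬ root i j = α := h
    simp [c, h']
  · rw [List.map_map]
    change _ = (s.toList.map fun α => Alg.mk t n ⟨_, hc α⟩).sum
    rw [Finset.sum_map_toList, ← map_sum]
    have hs : ∀ i j : Fin n, root i j ∈ s := fun i j =>
      Finset.mem_insert_of_mem (Finset.mem_image.2 ⟨(i, j), Finset.mem_univ _, rfl⟩)
    congr 1
    ext1
    rw [Submodule.coe_sum]
    refine Prod.ext ?_ ?_
    · ext i j
      simp [Prod.fst_sum, Matrix.sum_apply, c, hs]
    · ext i j
      simp [Prod.snd_sum, Matrix.sum_apply, c, hs]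

theorem J_rightMul (x : U t n) : ∀ ν, ∃ μ, ∀ u ∈ J κ t n μ, u * x ∈ J κ t n ν := by
  induction x using Env.induct with
  | hs r =>
    intro ν
    refine ⟨ν, fun u hu => ?_⟩
    rw [← Algebra.commutes, ← Algebra.smul_def]
    exact smul_mem_J r hu
  | hι x =>
    intro ν
    obtain ⟨l, hl, rfl⟩ := exists_weight_sum x
    induction l with
    | nil => exact ⟨ν, fun u _ => by simp⟩
    | cons a l ih =>
      obtain ⟨μ, hμ⟩ := ih fun b hb => hl b (List.mem_cons_of_mem _ hb)
      obtain ⟨ξ, h1, h2⟩ := Comparison.exists_ge (κ := κ) μ (ν - a.1)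
      refine ⟨ξ, fun u hu => ?_⟩
      simp only [List.map_cons, List.sum_cons, map_add, mul_add]
      refine Submodule.add_mem _ ?_ (hμ u (J_anti h1 hu))
      have := J_mul_ι (hl a (by simp)) (J_anti h2 hu)
      rwa [sub_add_cancel] at this
  | hm a b ha hb =>
    intro ν
    obtain ⟨μ, hμ⟩ := hb ν
    obtain ⟨ξ, hξ⟩ := ha μ
    exact ⟨ξ, fun u hu => by rw [← mul_assoc]; exact hμ _ (hξ u hu)⟩
  | ha a b ha hb =>
    intro ν
    obtain ⟨μ, hμ⟩ := ha ν
    obtain ⟨μ', hμ'⟩ := hb ν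
    obtain ⟨ξ, h1, h2⟩ := Comparison.exists_ge (κ := κ) μ μ'
    refine ⟨ξ, fun u hu => ?_⟩
    rw [mul_add]
    exact Submodule.add_mem _ (hμ u (J_anti h1 hu)) (hμ' u (J_anti h2 hu))

theorem J_basis (κ : Comparison) (t : Kind) (n : ℕ) :
    RingSubgroupsBasis fun ν : RootLattice n => (J κ t n ν).toAddSubgroup where
  inter ν μ := by
    obtain ⟨ξ, h1, h2⟩ := Comparison.exists_ge (κ := κ) ν μ
    exact ⟨ξ, fun u hu => ⟨J_anti h1 hu, J_anti h2 hu⟩⟩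
  mul ν := by
    refine ⟨ν, ?_⟩
    rintro _ ⟨a, -, b, hb, rfl⟩
    exact Ideal.mul_mem_left _ a hb
  leftMul x ν := ⟨ν, fun _ hu => Ideal.mul_mem_left _ x hu⟩
  rightMul x ν := by
    obtain ⟨μ, hμ⟩ := J_rightMul (κ := κ) x ν
    exact ⟨μ, fun u hu => hμ u hu⟩

/-- A copy of `U(g)`, to carry the topology in which the left ideals `J(ν)` (formed with
respect to `κ`) are a basis of neighbourhoods of zero. -/
def TopU (_κ : Comparison) (t : Kind) (n : ℕ) : Type := U t n

variable (κ t n)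

instance : Ring (TopU κ t n) := inferInstanceAs (Ring (U t n))

instance : Algebra ℂ (TopU κ t n) := inferInstanceAs (Algebra ℂ (U t n))

instance : TopologicalSpace (TopU κ t n) := (J_basis κ t n).topology

instance : IsTopologicalRing (TopU κ t n) :=
  (J_basis κ t n).toRingFilterBasis.isTopologicalRing

instance : UniformSpace (TopU κ t n) := IsTopologicalAddGroup.rightUniformSpace (TopU κ t n)

instance : IsUniformAddGroup (TopU κ t n) := isUniformAddGroup_of_addCommGroup

/-- The completion `Û` of `U(g)`. -/
abbrev UHat : Type := UniformSpace.Completion (TopU κ t n)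

/-- The canonical ring homomorphism `U(g) → Û`. -/
def toHat : U t n →+* UHat κ t n :=
  UniformSpace.Completion.coeRingHom (α := TopU κ t n)

/-- The filtration of `Û` extending the canonical one: `F^k(Û)` is the closure of
`F^k(U(g))`. -/
def filtHat (k : ℕ) : Set (UHat κ t n) :=
  closure (toHat κ t n '' (Env.filt (L := Alg t n) k : Set (U t n)))

/-- The degree of an element of `U(g)`. -/
def degU (u : U t n) : WithBot ℕ∞ :=
  filtDeg (fun k => (Env.filt (L := Alg t n) k : Set (U t n))) u

/-- The degree of an element of `Û`. -/
def degHat (u : UHat κ t n) : WithBot ℕ∞ := filtDeg (filtHat κ t n) u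

/-- The elements of parity `i` in `Û`. -/
def hatPart (i : ZMod 2) : Set (UHat κ t n) :=
  closure (toHat κ t n '' (Env.part (L := Alg t n) i : Set (U t n)))

/-- The centre of the superalgebra `Û`: sums of an even and an odd element which
supercommute with all homogeneous elements, `c y = (-1) ^ (p(c) p(y)) y c`. -/
def centre : Set (UHat κ t n) :=
  {z | ∃ c : ZMod 2 → UHat κ t n, (∀ i, c i ∈ hatPart κ t n i) ∧ z = c 0 + c 1 ∧
    ∀ i j, ∀ y ∈ hatPart κ t n j,
      c i * y = toHat κ t n (algebraMap ℂ (U t n) (sgn i j)) * (y * c i)}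

/-- The subgroup `n⁻ U(b⁻) + Û n⁺` of `Û`. -/
def hcKernel : AddSubgroup (UHat κ t n) :=
  ((nMinus t n).map Env.ι * Subalgebra.toSubmodule (UBMinus t n)).toAddSubgroup.map
      (toHat κ t n).toAddMonoidHom ⊔
    (Ideal.span (toHat κ t n '' (Env.ι '' (nPlus t n : Set (Alg t n))))).toAddSubgroup

variable {κ t n}

/-- `a` is a component of `u` in `U(h)` along `Û = U(h) ⊕ (n⁻ U(b⁻) + Û n⁺)`. -/
def IsHC (u : UHat κ t n) (a : U t n) : Prop :=
  a ∈ UCartan t n ∧ u - toHat κ t n a ∈ hcKernel κ t n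

/-- The Harish-Chandra projection `Û → U(h)` along `n⁻ U(b⁻) + Û n⁺`. -/
def HC (u : UHat κ t n) : U t n :=
  open Classical in if h : ∃ a, IsHC u a then h.choose else 0

/-- `u = ∑_{ν ∈ Q⁺} c(ν)` with `c(ν) ∈ J'(ν)`. -/
def IsExpansion (u : UHat κ t n) (c : {ν : RootLattice n // 0 ≤ ν} → U t n) : Prop :=
  (∀ ν, c ν ∈ JPrime t n ν.1) ∧ HasSum (fun ν => toHat κ t n (c ν)) u

end Completion

end QType

set_option linter.unusedSectionVars false

/-! Fix a homogeneous basis of weight vectors of `g`, ordered with `n⁻` first and `n⁺` last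
(`exists_triBasis`). By Poincaré-Birkhoff-Witt the sorted words without repeated odd letters, here
called good, form a basis of `U(g)`. Membership in `J(ξ)`, `J'(ν)`, `U(h)`, a parity component or a
filtration step is then a condition on the words in the support (`mem_J_iff`, `mem_JPrime_iff`,
`mem_UCartan_iff`, `mem_part_iff`, `mem_filt_iff`). The words whose `n⁺`-letters have total weight
`ν` span `J'(ν)`. The projection to `J'(ν)` kills `J(ν + 1)`, where `1` is the sum of the simple
roots, so it extends to `Û`; this gives the expansion. Stripping the last letter of a word gives the
Harish-Chandra decomposition.

PBW is deduced from a faithful graded representation. `U(L)` acts on `V ⊗ U(L)` through a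
coproduct-like formula; the part of the action on `v ⊗ 1` in which one letter hits `v` yields the
contraction of a word by a letter, and iterated contractions separate the good words
(`exists_form`).

For the degrees, a central `z` commutes with an element of `h` that measures heights, so `z(0)` lies
in `U(h)` and is `HC z` (`isHC_comp_zero`). It remains to see that the words of `z(ν)` are not
longer than the longest word of `z(0)`. This goes by induction on the height of `ν`
(`comp_mem_wordSpan`), with the combinatorial core in `length_lt`. Suppose that `z(ν)` has a word
longer than allowed. Among its longest words take those with the most even Cartan letters. As `ν ≠
0`, one of them contains a positive root letter `e`. Choose `f` of opposite weight and equal parity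
such that `[f, e]` involves an even Cartan letter `a`, and among the selected words containing `e`
choose `m` with the most letters `a`. In the supercommutator of `f` with `z`, the word `m'` obtained
from `m` by replacing `e` by `a` has a non-zero contribution from `m`, because contraction by `e`
has a non-zero coefficient. No other word contributes: shorter words cannot because `ad f` does not
increase length, words of `n⁺`-weight not `≤ ν` cannot by weight, and words of the same length are
excluded by the extremal choices (`eq_of_replace`). So `z` would not supercommute with `f`. -/

namespace QType

/-! ### Words in a homogeneous basis and straightening -/

section Words

variable {L : Type*} [AddCommGroup L] [Module ℂ L] [LieSuperalgebra L]

/-- The universal property of `U(L)`. -/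
def Env.lift {A : Type*} [Ring A] [Algebra ℂ A] (f : L →ₗ[ℂ] A)
    (hf : ∀ (i j : ZMod 2) (x y : L), x ∈ LieSuperalgebra.part i → y ∈ LieSuperalgebra.part j →
      f x * f y - sgn i j • (f y * f x) = f (LieSuperalgebra.br x y)) : Env L →ₐ[ℂ] A :=
  RingQuot.liftAlgHom ℂ ⟨TensorAlgebra.lift ℂ f, by
    rintro _ _ ⟨hx, hy⟩
    simpa using hf _ _ _ _ hx hy⟩

theorem Env.lift_ι {A : Type*} [Ring A] [Algebra ℂ A] (f : L →ₗ[ℂ] A) (hf) (x : L) :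
    Env.lift f hf (Env.ι x) = f x := by
  have h : Env.lift f hf (RingQuot.mkAlgHom ℂ (EnvRel L) (TensorAlgebra.ι ℂ x))
      = TensorAlgebra.lift ℂ f (TensorAlgebra.ι ℂ x) := by
    unfold Env.lift
    exact RingQuot.liftAlgHom_mkAlgHom_apply ℂ _ _ _
  rw [TensorAlgebra.lift_ι_apply] at h
  exact h

variable {I : Type*} (b : Module.Basis I ℂ L)

/-- The product in `U(L)` of the basis vectors indexed by a list. -/
def word (l : List I) : Env L := (l.map fun i => Env.ι (b i)).prod

@[simp] theorem word_nil : word b [] = 1 := rfl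

theorem word_cons (i : I) (l : List I) : word b (i :: l) = Env.ι (b i) * word b l := by
  simp [word]

theorem word_append (l m : List I) : word b (l ++ m) = word b l * word b m := by
  simp [word]

/-- The span of the words of length `< k` that satisfy `W`. -/
def wordSpan (W : List I → Prop) (k : ℕ) : Submodule ℂ (Env L) :=
  Submodule.span ℂ (word b '' {l | W l ∧ l.length < k})

variable {b}

theorem word_mem_wordSpan {W : List I → Prop} {k : ℕ} {l : List I} (h : W l)
    (hk : l.length < k) : word b l ∈ wordSpan b W k :=
  Submodule.subset_span ⟨l, ⟨h, hk⟩, rfl⟩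

theorem wordSpan_mono {W W' : List I → Prop} (h : ∀ l, W l → W' l) {k m : ℕ} (hk : k ≤ m) :
    wordSpan b W k ≤ wordSpan b W' m :=
  Submodule.span_mono (Set.image_mono fun _ hl => ⟨h _ hl.1, hl.2.trans_le hk⟩)

/-- A product of words and an element of `L` is a combination of words. -/
theorem word_mul_ι_mul_word_mem {N : Submodule ℂ (Env L)} (l m : List I) (x : L)
    (h : ∀ k, b.repr x k ≠ 0 → word b (l ++ k :: m) ∈ N) :
    word b l * Env.ι x * word b m ∈ N := by
  have hx : x = ∑ k ∈ (b.repr x).support, b.repr x k • b k := by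
    conv_lhs => rw [← b.linearCombination_repr x]
    rfl
  rw [hx, map_sum, Finset.mul_sum, Finset.sum_mul]
  refine Submodule.sum_mem _ fun k hk => ?_
  rw [map_smul, mul_smul_comm, smul_mul_assoc]
  refine Submodule.smul_mem _ _ ?_
  have := h k (Finsupp.mem_support_iff.1 hk)
  rwa [word_append, word_cons, ← mul_assoc] at this

theorem ι_mul_mem_wordSpan {k : ℕ} (x : L) {u : Env L}
    (hu : u ∈ wordSpan b (fun _ => True) k) :
    Env.ι x * u ∈ wordSpan b (fun _ => True) (k + 1) := by
  unfold wordSpan at hu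
  induction hu using Submodule.span_induction with
  | mem u hu =>
    obtain ⟨l, ⟨-, hl⟩, rfl⟩ := hu
    have := word_mul_ι_mul_word_mem (b := b) (N := wordSpan b (fun _ => True) (k + 1)) [] l x
      fun i _ => word_mem_wordSpan trivial (by simpa using hl)
    simpa using this
  | zero => simp
  | add _ _ _ _ h1 h2 => rw [mul_add]; exact Submodule.add_mem _ h1 h2
  | smul c _ _ h => rw [mul_smul_comm]; exact Submodule.smul_mem _ _ h

theorem mul_mem_wordSpan {k m : ℕ} {u v : Env L} (hu : u ∈ wordSpan b (fun _ => True) k)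
    (hv : v ∈ wordSpan b (fun _ => True) (m + 1)) :
    u * v ∈ wordSpan b (fun _ => True) (k + m) := by
  have := Submodule.mul_mem_mul hu hv
  unfold wordSpan at this
  rw [Submodule.span_mul_span] at this
  refine Submodule.span_mono ?_ this
  rintro _ ⟨_, ⟨l, ⟨-, hl⟩, rfl⟩, _, ⟨l', ⟨-, hl'⟩, rfl⟩, rfl⟩
  refine ⟨l ++ l', ⟨trivial, ?_⟩, word_append b l l'⟩
  simp only [List.length_append]
  omega

/-- Parities of the letters, for a homogeneous basis. -/
def Homogeneous (b : Module.Basis I ℂ L) (par : I → ZMod 2) : Prop :=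
  ∀ i, b i ∈ LieSuperalgebra.part (par i)

variable (b) in
/-- A property of lists is stable if it is preserved by the rewriting of words: by swapping
adjacent letters and by replacing two adjacent letters by a letter occurring in their bracket. -/
structure Stable (W : List I → Prop) : Prop where
  swap : ∀ p i j s, W (p ++ i :: j :: s) → W (p ++ j :: i :: s)
  br : ∀ p i j k s, W (p ++ i :: j :: s) → b.repr (LieSuperalgebra.br (b i) (b j)) k ≠ 0 →
    W (p ++ k :: s)

theorem stable_true : Stable b fun _ => True := ⟨fun _ _ _ _ _ => trivial, fun _ _ _ _ _ _ _ => trivial⟩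

variable {par : I → ZMod 2} {W : List I → Prop}

/-- The error term of the swap is the word with the two letters replaced by their bracket, which is
one letter shorter. -/
theorem word_swap (hb : Homogeneous b par) (hW : Stable b W) (p : List I) (i j : I) (s : List I)
    (h : W (p ++ i :: j :: s)) :
    word b (p ++ i :: j :: s) - sgn (par i) (par j) • word b (p ++ j :: i :: s)
      ∈ wordSpan b W (p ++ i :: j :: s).length := by
  have e : word b (p ++ i :: j :: s) - sgn (par i) (par j) • word b (p ++ j :: i :: s)
      = word b p * Env.ι (LieSuperalgebra.br (b i) (b j)) * word b s := by
    have := Env.ι_mul_ι (hb i) (hb j)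
    simp only [word_append, word_cons]
    rw [← mul_assoc (Env.ι (b i)), this, ← mul_assoc (Env.ι (b j))]
    simp only [add_mul, mul_add, smul_mul_assoc, mul_smul_comm, mul_assoc]
    abel
  rw [e]
  refine word_mul_ι_mul_word_mem p s _ fun k hk => word_mem_wordSpan (hW.br p i j k s h hk) ?_
  simp

theorem sgn_eq (i j : ZMod 2) : sgn i j = 1 ∨ sgn i j = -1 := by
  unfold sgn; split_ifs <;> simp

/-- The prefix `p` is there for the induction on the permutation: a fixed head moves into the
prefix. -/
theorem word_perm (hb : Homogeneous b par) (hW : Stable b W) {l m : List I} (h : l.Perm m) :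
    ∀ p, W (p ++ l) → W (p ++ m) ∧ ∃ ε : ℂ, (ε = 1 ∨ ε = -1) ∧
      word b (p ++ l) - ε • word b (p ++ m) ∈ wordSpan b W (p ++ l).length := by
  induction h with
  | nil => exact fun p hp => ⟨hp, 1, Or.inl rfl, by simp⟩
  | cons x _ ih =>
    intro p hp
    have := ih (p ++ [x]) (by simpa using hp)
    simpa using this
  | swap x y l =>
    intro p hp
    exact ⟨hW.swap _ _ _ _ hp, _, sgn_eq _ _, word_swap hb hW p _ _ _ hp⟩
  | trans h1 h2 ih1 ih2 =>
    intro p hp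
    obtain ⟨w1, ε1, he1, hm1⟩ := ih1 p hp
    obtain ⟨w2, ε2, he2, hm2⟩ := ih2 p w1
    refine ⟨w2, ε1 * ε2, ?_, ?_⟩
    · rcases he1 with rfl | rfl <;> rcases he2 with rfl | rfl <;> simp
    · rw [List.length_append, ← h1.length_eq, ← List.length_append] at hm2
      have := Submodule.add_mem _ hm1 (Submodule.smul_mem _ ε1 hm2)
      rw [smul_sub, smul_smul] at this
      simpa using this

variable [LinearOrder I]

/-- The words that form a basis of `U(L)`: they are sorted, and odd letters are not repeated. -/
def Good (par : I → ZMod 2) (l : List I) : Prop :=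
  l.Pairwise (· ≤ ·) ∧ ∀ i, par i = 1 → l.count i ≤ 1

theorem Good.sublist {l m : List I} (h : Good par m) (hl : l.Sublist m) : Good par l :=
  ⟨h.1.sublist hl, fun i hi => (hl.count_le i).trans (h.2 i hi)⟩

theorem Good.eq_of_perm {l m : List I} (h : Good par l) (h' : Good par m) (hp : l.Perm m) :
    l = m := hp.eq_of_pairwise' h.1 h'.1

theorem exists_good_or (hb : Homogeneous b par) (hW : Stable b W) (l : List I) (hl : W l) :
    (∃ m, l.Perm m ∧ Good par m ∧ W m ∧ ∃ ε : ℂ, (ε = 1 ∨ ε = -1) ∧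
      word b l - ε • word b m ∈ wordSpan b W l.length) ∨ word b l ∈ wordSpan b W l.length := by
  by_cases hg : ∀ i, par i = 1 → l.count i ≤ 1
  · left
    have hp : l.Perm (l.insertionSort (· ≤ ·)) := (List.perm_insertionSort _ l).symm
    obtain ⟨h1, ε, hε, h2⟩ := word_perm hb hW hp [] hl
    exact ⟨_, hp, ⟨List.pairwise_insertionSort _ l,
      fun i hi => by rw [← hp.count_eq]; exact hg i hi⟩, h1, ε, hε, h2⟩
  · right
    push Not at hg
    obtain ⟨i, hi, hc⟩ := hg
    have hm : i ∈ l := List.count_pos_iff.1 (by omega)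
    have hm' : i ∈ l.erase i := List.count_pos_iff.1 (by rw [List.count_erase_self]; omega)
    have hp : l.Perm (i :: i :: (l.erase i).erase i) :=
      (List.perm_cons_erase hm).trans ((List.perm_cons_erase hm').cons i)
    obtain ⟨h1, ε, hε, h2⟩ := word_perm hb hW hp [] hl
    -- Swapping two equal odd letters changes the sign, so twice the word is a combination of
    -- shorter ones.
    have h3 := word_swap hb hW [] i i _ h1
    have hs : sgn (par i) (par i) = -1 := by rw [hi]; exact sgn_11
    rw [List.nil_append, ← hp.length_eq, hs, neg_one_smul, sub_neg_eq_add, ← two_smul ℂ] at h3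
    rw [List.nil_append, List.nil_append] at h2
    have h4 := Submodule.smul_mem _ (2⁻¹ : ℂ) h3
    rw [smul_smul, inv_mul_cancel₀ two_ne_zero, one_smul] at h4
    have := Submodule.add_mem _ h2 (Submodule.smul_mem _ ε h4)
    simpa using this

/-- Straightening: the good words span. -/
theorem wordSpan_good (hb : Homogeneous b par) (hW : Stable b W) (k : ℕ) :
    wordSpan b W k = wordSpan b (fun l => W l ∧ Good par l) k := by
  refine le_antisymm ?_ (wordSpan_mono (fun _ h => h.1) le_rfl)
  induction k with
  | zero =>
    refine Submodule.span_le.2 ?_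
    rintro _ ⟨l, ⟨-, h⟩, rfl⟩
    exact absurd h (Nat.not_lt_zero _)
  | succ k ih =>
    refine Submodule.span_le.2 ?_
    rintro _ ⟨l, ⟨hl, hk⟩, rfl⟩
    have key : wordSpan b W l.length ≤ wordSpan b (fun l => W l ∧ Good par l) (k + 1) :=
      (wordSpan_mono (fun _ h => h) (Nat.lt_succ_iff.1 hk)).trans
        (ih.trans (wordSpan_mono (fun _ h => h) (Nat.le_succ k)))
    rcases exists_good_or hb hW l hl with ⟨m, hp, hg, hm, ε, -, h⟩ | h
    · have h' := Submodule.add_mem _ (key h) (Submodule.smul_mem _ ε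
        (word_mem_wordSpan (b := b) (W := fun l => W l ∧ Good par l) (k := k + 1) ⟨hm, hg⟩
          (by rwa [← hp.length_eq])))
      simpa using h'
    · exact key h

end Words

end QType

namespace QType

/-! ### The Poincaré-Birkhoff-Witt theorem -/

section PBW

open TensorProduct

variable {L : Type*} [AddCommGroup L] [Module ℂ L] [LieSuperalgebra L]
  {I : Type*} [LinearOrder I] {b : Module.Basis I ℂ L} {par : I → ZMod 2}

/-- A graded representation of `L` (with grading operator `γ`) with an even vector `v` such that
`v` and the vectors `b i • v` are linearly independent, as is witnessed by the forms `φ i`. -/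
structure VacuumRep (b : Module.Basis I ℂ L) (V : Type*) [AddCommGroup V] [Module ℂ V] where
  ρ : L →ₗ[ℂ] Module.End ℂ V
  γ : Module.End ℂ V
  v : V
  φ : I → V →ₗ[ℂ] ℂ
  ρ_br : ∀ (i j : ZMod 2) (x y : L), x ∈ LieSuperalgebra.part i → y ∈ LieSuperalgebra.part j →
    ρ x * ρ y - sgn i j • (ρ y * ρ x) = ρ (LieSuperalgebra.br x y)
  γ_ρ : ∀ (i : ZMod 2) (x : L), x ∈ LieSuperalgebra.part i → γ * ρ x = sgn 1 i • (ρ x * γ)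
  γ_sq : γ * γ = 1
  γ_v : γ v = v
  φ_v : ∀ i, φ i v = 0
  φ_ρ : ∀ i j, φ i (ρ (b j) v) = if i = j then 1 else 0

namespace VacuumRep

variable {V : Type*} [AddCommGroup V] [Module ℂ V] (R : VacuumRep b V)

theorem γ_pow_ρ {i j : ZMod 2} {x : L} (hx : x ∈ LieSuperalgebra.part j) :
    R.γ ^ i.val * R.ρ x = sgn i j • (R.ρ x * R.γ ^ i.val) := by
  obtain rfl | rfl := zmod2_cases i
  · simp [sgn]
  · simpa [ZMod.val_one] using R.γ_ρ j x hx

/-- The action of `L` on `V ⊗ U(L)`, where `U(L)` is acted upon by left multiplication. -/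
def coact : L →ₗ[ℂ] Module.End ℂ (V ⊗[ℂ] Env L) :=
  (TensorProduct.mapBilinear _ V (Env L) V (Env L)).flip 1 ∘ₗ R.ρ +
  (TensorProduct.mapBilinear _ V (Env L) V (Env L) 1) ∘ₗ LinearMap.mul ℂ (Env L) ∘ₗ Env.ι ∘ₗ
    Submodule.projection _ _ (LieSuperalgebra.isCompl_part (L := L)) +
  (TensorProduct.mapBilinear _ V (Env L) V (Env L) R.γ) ∘ₗ LinearMap.mul ℂ (Env L) ∘ₗ Env.ι ∘ₗ
    Submodule.projection _ _ (LieSuperalgebra.isCompl_part (L := L)).symm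

theorem coact_of_mem {i : ZMod 2} {x : L} (hx : x ∈ LieSuperalgebra.part i) :
    R.coact x = TensorProduct.map (R.ρ x) 1
      + TensorProduct.map (R.γ ^ i.val) (LinearMap.mulLeft ℂ (Env.ι x)) := by
  have key : R.coact x = TensorProduct.map (R.ρ x) 1
      + TensorProduct.map 1 (LinearMap.mulLeft ℂ
        (Env.ι (Submodule.projection _ _ (LieSuperalgebra.isCompl_part (L := L)) x)))
      + TensorProduct.map R.γ (LinearMap.mulLeft ℂ
        (Env.ι (Submodule.projection _ _ (LieSuperalgebra.isCompl_part (L := L)).symm x))) := rfl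
  rw [key]
  obtain rfl | rfl := zmod2_cases i
  · rw [Submodule.projection_apply_of_mem_left _ hx,
      Submodule.projection_apply_of_mem_right _ hx]
    simp
  · rw [Submodule.projection_apply_of_mem_right _ hx,
      Submodule.projection_apply_of_mem_left _ hx]
    simp [ZMod.val_one]

/-- The power of `γ` in the second summand is the Koszul sign of moving the acting element past `V`.
It makes the mixed terms, where one of `x`, `y` acts on each factor, cancel. -/
theorem coact_br (i j : ZMod 2) (x y : L) (hx : x ∈ LieSuperalgebra.part i)
    (hy : y ∈ LieSuperalgebra.part j) :
    R.coact x * R.coact y - sgn i j • (R.coact y * R.coact x)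
      = R.coact (LieSuperalgebra.br x y) := by
  have hs : sgn i j * sgn i j = 1 := by rcases sgn_eq i j with h | h <;> rw [h] <;> norm_num
  have hγ : R.γ ^ j.val * R.ρ x = sgn i j • (R.ρ x * R.γ ^ j.val) := by
    rw [γ_pow_ρ R hx]; congr 1; simp [sgn, and_comm]
  have hp : R.γ ^ j.val * R.γ ^ i.val = R.γ ^ i.val * R.γ ^ j.val := by
    rw [← pow_add, ← pow_add, add_comm]
  have hm : LinearMap.mulLeft ℂ (Env.ι x) * LinearMap.mulLeft ℂ (Env.ι y)
      = sgn i j • (LinearMap.mulLeft ℂ (Env.ι y) * LinearMap.mulLeft ℂ (Env.ι x))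
        + LinearMap.mulLeft ℂ (Env.ι (LieSuperalgebra.br x y)) := by
    ext u
    have := congrArg (· * u) (Env.ι_mul_ι hx hy)
    simpa [add_mul, mul_assoc] using this
  have hbr : R.γ ^ (i + j).val = R.γ ^ i.val * R.γ ^ j.val := by
    obtain rfl | rfl := zmod2_cases i <;> obtain rfl | rfl := zmod2_cases j <;>
      simp [ZMod.val_one, R.γ_sq, show (1 : ZMod 2) + 1 = 0 by decide]
  have hρ := sub_eq_iff_eq_add'.1 (R.ρ_br i j x y hx hy)
  rw [R.coact_of_mem hx, R.coact_of_mem hy, R.coact_of_mem (LieSuperalgebra.br_mem hx hy), hbr,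
    sub_eq_iff_eq_add']
  simp only [mul_add, add_mul, ← TensorProduct.map_mul, one_mul, mul_one, hγ, hm, hρ, hp,
    R.γ_pow_ρ hy, TensorProduct.map_smul_left, TensorProduct.map_smul_right, smul_add, smul_smul,
    hs, one_smul, TensorProduct.map_add_left, TensorProduct.map_add_right]
  abel

/-- The resulting action of `U(L)` on `V ⊗ U(L)`. -/
def comul : Env L →ₐ[ℂ] Module.End ℂ (V ⊗[ℂ] Env L) := Env.lift R.coact R.coact_br

/-- The part of the action of a word on `v ⊗ 1` in which exactly one letter acts on `v`. -/
def lead : List I → V ⊗[ℂ] Env L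
  | [] => 0
  | i :: w => R.ρ (b i) R.v ⊗ₜ word b w
      + TensorProduct.map (R.γ ^ (par i).val) (LinearMap.mulLeft ℂ (Env.ι (b i))) (lead w)

/-- The span of the `x ⊗ w` with a word `w` of length at most `k - 2`. -/
def lower (V : Type*) [AddCommGroup V] [Module ℂ V] (b : Module.Basis I ℂ L) (k : ℕ) :
    Submodule ℂ (V ⊗[ℂ] Env L) :=
  Submodule.span ℂ {t | ∃ (x : V) (w : List I), w.length + 2 ≤ k ∧ t = x ⊗ₜ word b w}

theorem map_mem_lower (f : Module.End ℂ V) (l : List I) {k : ℕ} {t : V ⊗[ℂ] Env L}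
    (ht : t ∈ lower V b k) :
    TensorProduct.map f (LinearMap.mulLeft ℂ (word b l)) t ∈ lower V b (k + l.length) := by
  unfold lower at ht
  induction ht using Submodule.span_induction with
  | mem t ht =>
    obtain ⟨x, w, hw, rfl⟩ := ht
    refine Submodule.subset_span ⟨f x, l ++ w, ?_, ?_⟩
    · simp only [List.length_append]; omega
    · simp [word_append]
  | zero => simp
  | add _ _ _ _ h1 h2 => rw [map_add]; exact Submodule.add_mem _ h1 h2
  | smul c _ _ h => rw [map_smul]; exact Submodule.smul_mem _ _ h

theorem mulLeft_word_nil : LinearMap.mulLeft ℂ (word b ([] : List I)) = 1 := by ext; simp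

theorem mulLeft_word_singleton (i : I) :
    LinearMap.mulLeft ℂ (word b [i]) = LinearMap.mulLeft ℂ (Env.ι (b i)) := by
  ext; simp [word_cons]

theorem lead_mem_lower (w : List I) : R.lead (par := par) w ∈ lower V b (w.length + 1) := by
  induction w with
  | nil => exact Submodule.zero_mem _
  | cons i w ih =>
    refine Submodule.add_mem _ (Submodule.subset_span ⟨_, w, by simp, rfl⟩) ?_
    rw [← mulLeft_word_singleton]
    exact map_mem_lower _ [i] ih

/-- Each letter acts on one of the two tensor factors. If none acts on `v`, the result is `v ⊗ w`;
if one does, it is `lead`; if at least two do, at most `w.length - 2` letters remain on the right.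
-/
theorem comul_word (hb : Homogeneous b par) (w : List I) :
    R.comul (word b w) (R.v ⊗ₜ 1) - (R.v ⊗ₜ word b w + R.lead (par := par) w)
      ∈ lower V b w.length := by
  induction w with
  | nil => simp [lead]
  | cons i w ih =>
    set r := R.comul (word b w) (R.v ⊗ₜ 1) - (R.v ⊗ₜ word b w + R.lead (par := par) w) with hr
    have h1 : R.comul (word b w) (R.v ⊗ₜ 1) = r + (R.v ⊗ₜ word b w + R.lead (par := par) w) := by
      rw [hr]; abel
    have hc : R.comul (Env.ι (b i)) = TensorProduct.map (R.ρ (b i)) 1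
      + TensorProduct.map (R.γ ^ (par i).val) (LinearMap.mulLeft ℂ (Env.ι (b i))) :=
      (Env.lift_ι _ _ _).trans (R.coact_of_mem (hb i))
    have hγ : (R.γ ^ (par i).val) R.v = R.v := by
      obtain h | h := zmod2_cases (par i) <;> simp [h, ZMod.val_one, R.γ_v]
    have e : R.comul (word b (i :: w)) (R.v ⊗ₜ 1)
        - (R.v ⊗ₜ word b (i :: w) + R.lead (par := par) (i :: w))
        = TensorProduct.map (R.ρ (b i)) (LinearMap.mulLeft ℂ (word b ([] : List I))) r
          + TensorProduct.map (R.γ ^ (par i).val) (LinearMap.mulLeft ℂ (word b [i])) r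
          + TensorProduct.map (R.ρ (b i)) (LinearMap.mulLeft ℂ (word b ([] : List I)))
              (R.lead (par := par) w) := by
      rw [mulLeft_word_nil, mulLeft_word_singleton, word_cons, map_mul, Module.End.mul_apply, h1,
        hc, lead]
      simp only [LinearMap.add_apply, map_add, TensorProduct.map_tmul, Module.End.one_apply,
        LinearMap.mulLeft_apply, hγ]
      abel
    rw [e]
    have hmono : lower V b w.length ≤ lower V b (w.length + 1) :=
      Submodule.span_mono fun _ ⟨x, w, h, e⟩ => ⟨x, w, h.trans (Nat.le_succ _), e⟩
    exact Submodule.add_mem _ (Submodule.add_mem _ (hmono (map_mem_lower _ [] ih))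
      (map_mem_lower _ [i] ih)) (map_mem_lower _ [] (R.lead_mem_lower w))

end VacuumRep

/-- The super derivation that contracts the letter `i`, on words. -/
def contract (b : Module.Basis I ℂ L) (par : I → ZMod 2) (i : I) : List I → Env L
  | [] => 0
  | k :: w => (if i = k then word b w else 0)
      + sgn (par i) (par k) • (Env.ι (b k) * contract b par i w)

theorem contract_of_notMem {i : I} {w : List I} (h : i ∉ w) : contract b par i w = 0 := by
  induction w with
  | nil => rfl
  | cons k w ih =>
    rw [List.mem_cons, not_or] at h
    rw [contract, if_neg h.1, ih h.2, mul_zero, smul_zero, add_zero]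

/-- An odd letter occurs once and gives a sign. The copies of an even letter are adjacent and
contribute without signs, so they add up to the multiplicity, which is not zero in characteristic
zero. -/
theorem contract_good {i : I} {w : List I} (hw : Good par w) (h : i ∈ w) :
    ∃ c : ℂ, c ≠ 0 ∧ contract b par i w = c • word b (w.erase i) := by
  -- The exact value for even letters is carried along because the induction needs `1 + c ≠ 0`.
  suffices hs : ∃ c : ℂ, c ≠ 0 ∧ (par i = 0 → c = w.count i) ∧
      contract b par i w = c • word b (w.erase i) by
    obtain ⟨c, h1, -, h2⟩ := hs
    exact ⟨c, h1, h2⟩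
  induction w with
  | nil => simp at h
  | cons k w ih =>
    have hw' : Good par w := hw.sublist (List.sublist_cons_self k w)
    by_cases hik : i = k
    · subst hik
      rw [contract, if_pos rfl, List.erase_cons_head]
      by_cases hiw : i ∈ w
      · have hi : par i = 0 := by
          rcases zmod2_cases (par i) with hi | hi
          · exact hi
          · have := hw.2 i hi
            rw [List.count_cons_self] at this
            exact absurd (List.count_pos_iff.2 hiw) (by omega)
        obtain ⟨c, h1, h2, h3⟩ := ih hw' hiw
        have he : Env.ι (b i) * word b (w.erase i) = word b w := by
          rw [← word_cons]
          congr 1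
          refine (Good.eq_of_perm (par := par) hw' ⟨?_, fun j hj => ?_⟩
            (List.perm_cons_erase hiw)).symm
          · exact hw.1.sublist (List.Sublist.cons_cons i List.erase_sublist)
          · rw [← (List.perm_cons_erase hiw).count_eq]
            exact hw'.2 j hj
        refine ⟨1 + c, ?_, fun _ => ?_, ?_⟩
        · rw [h2 hi]; exact_mod_cast (by omega)
        · rw [h2 hi, List.count_cons_self]; push_cast; ring
        · rw [h3, mul_smul_comm, he, hi, sgn_00, one_smul, add_smul, one_smul]
      · refine ⟨1, one_ne_zero, fun _ => ?_, ?_⟩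
        · rw [List.count_cons_self, List.count_eq_zero_of_not_mem hiw]; simp
        · rw [contract_of_notMem hiw]; simp
    · have hiw : i ∈ w := (List.mem_cons.1 h).resolve_left hik
      obtain ⟨c, h1, h2, h3⟩ := ih hw' hiw
      have hs : sgn (par i) (par k) ≠ 0 := by
        rcases sgn_eq (par i) (par k) with h | h <;> rw [h] <;> norm_num
      refine ⟨sgn (par i) (par k) * c, mul_ne_zero hs h1, fun hi => ?_, ?_⟩
      · rw [h2 hi, hi, List.count_cons_of_ne (Ne.symm hik)]; simp [sgn]
      · rw [contract, if_neg hik, h3, List.erase_cons_tail (by simpa using Ne.symm hik), word_cons,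
          mul_smul_comm, smul_smul, zero_add]

namespace VacuumRep

variable {V : Type*} [AddCommGroup V] [Module ℂ V] (R : VacuumRep b V)

/-- All terms of `lead` have a vector `ρ (b j) v` on the left (`hspan`); on it `γ` acts by the sign
of `j`, and `φ i` picks out `j = i`. So both sides obey the same recursion. -/
theorem contract_lead (hb : Homogeneous b par) (i : I) (w : List I) :
    TensorProduct.lid ℂ (Env L) (TensorProduct.map (R.φ i) LinearMap.id (R.lead (par := par) w))
      = contract b par i w := by
  have hspan : ∀ w : List I, R.lead (par := par) w ∈
      Submodule.span ℂ {t | ∃ (j : I) (u : Env L), t = R.ρ (b j) R.v ⊗ₜ u} := by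
    intro w
    induction w with
    | nil => exact Submodule.zero_mem _
    | cons k w ih =>
      refine Submodule.add_mem _ (Submodule.subset_span ⟨_, _, rfl⟩) ?_
      generalize R.lead (par := par) w = t at ih
      induction ih using Submodule.span_induction with
      | mem t ht =>
        obtain ⟨j, u, rfl⟩ := ht
        have := congrArg (fun f : Module.End ℂ V => f R.v) (R.γ_pow_ρ (i := par k) (hb j))
        have hγ : (R.γ ^ (par k).val) R.v = R.v := by
          obtain h | h := zmod2_cases (par k) <;> simp [h, ZMod.val_one, R.γ_v]
        simp only [Module.End.mul_apply, LinearMap.smul_apply, hγ] at this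
        rw [TensorProduct.map_tmul, this, ← TensorProduct.smul_tmul']
        exact Submodule.smul_mem _ _ (Submodule.subset_span ⟨_, _, rfl⟩)
      | zero => simp
      | add _ _ _ _ h1 h2 => rw [map_add]; exact Submodule.add_mem _ h1 h2
      | smul c _ _ h => rw [map_smul]; exact Submodule.smul_mem _ _ h
  induction w with
  | nil => simp [lead, contract]
  | cons k w ih =>
    rw [lead, map_add, map_add, contract, ← ih]
    congr 1
    · rw [TensorProduct.map_tmul, R.φ_ρ]
      split_ifs <;> simp
    · have h := hspan w
      clear ih
      generalize R.lead (par := par) w = t at h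
      induction h using Submodule.span_induction with
      | mem t ht =>
        obtain ⟨j, u, rfl⟩ := ht
        have := congrArg (fun f : Module.End ℂ V => f R.v) (R.γ_pow_ρ (i := par k) (hb j))
        have hγ : (R.γ ^ (par k).val) R.v = R.v := by
          obtain h | h := zmod2_cases (par k) <;> simp [h, ZMod.val_one, R.γ_v]
        simp only [Module.End.mul_apply, LinearMap.smul_apply, hγ] at this
        simp only [TensorProduct.map_tmul, this, R.φ_ρ, map_smul, LinearMap.mulLeft_apply,
          LinearMap.id_apply, TensorProduct.lid_tmul]
        by_cases hij : i = j
        · subst hij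
          simp [sgn, and_comm]
        · simp [hij]
      | zero => simp
      | add _ _ _ _ h1 h2 => simp only [map_add, mul_add, smul_add, h1, h2]
      | smul c _ _ h => simp only [map_smul, h, mul_smul_comm]; rw [smul_comm]

/-- The forms on `U(L)` that separate the good words. -/
theorem exists_form (R : VacuumRep b V) (hb : Homogeneous b par) {l : List I} (hl : Good par l) :
    ∃ Ψ : Env L →ₗ[ℂ] ℂ, Ψ (word b l) ≠ 0 ∧
      ∀ w, Good par w → w.length ≤ l.length → w ≠ l → Ψ (word b w) = 0 := by
  induction l with
  | nil =>
    -- For the empty word the counit does.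
    refine ⟨(Env.lift (A := ℂ) 0 (by simp)).toLinearMap, by simp, fun w _ h h' => ?_⟩
    exact absurd (List.length_eq_zero_iff.1 (Nat.le_zero.1 h)) h'
  | cons i l ih =>
    have hl' : Good par l := hl.sublist (List.sublist_cons_self i l)
    obtain ⟨Ψ, h1, h2⟩ := ih hl'
    -- By straightening, `Ψ` kills all words shorter than `l`, sorted or not. This makes the `lower`
    -- terms below invisible.
    have hΨ : ∀ u ∈ wordSpan b (fun _ => True) l.length, Ψ u = 0 := by
      intro u hu
      rw [wordSpan_good hb stable_true] at hu
      refine (Submodule.span_le (p := LinearMap.ker Ψ)).2 ?_ hu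
      rintro _ ⟨w, ⟨⟨-, hw⟩, hlen⟩, rfl⟩
      exact h2 w hw hlen.le (by rintro rfl; exact lt_irrefl _ hlen)
    let Φ : V ⊗[ℂ] Env L →ₗ[ℂ] ℂ :=
      Ψ ∘ₗ (TensorProduct.lid ℂ (Env L)).toLinearMap ∘ₗ TensorProduct.map (R.φ i) LinearMap.id
    have hΦ : ∀ w : List I, w.length ≤ l.length + 1 →
        Φ (R.comul (word b w) (R.v ⊗ₜ 1)) = Ψ (contract b par i w) := by
      intro w hw
      have h := R.comul_word (par := par) hb w
      have h0 : ∀ t ∈ lower V b w.length, Φ t = 0 := by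
        intro t ht
        refine (Submodule.span_le (p := LinearMap.ker Φ)).2 ?_ ht
        rintro _ ⟨x, w', hw', rfl⟩
        have : Ψ (word b w') = 0 := hΨ _ (word_mem_wordSpan trivial (by omega))
        simp [Φ, this]
      have h3 := h0 _ h
      rw [map_sub, sub_eq_zero, map_add] at h3
      rw [h3]
      simp only [Φ, LinearMap.comp_apply, LinearEquiv.coe_coe, R.contract_lead hb,
        TensorProduct.map_tmul, R.φ_v]
      simp
    refine ⟨Φ ∘ₗ LinearMap.applyₗ (R.v ⊗ₜ 1) ∘ₗ R.comul.toLinearMap, ?_, ?_⟩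
    · change Φ (R.comul (word b (i :: l)) (R.v ⊗ₜ 1)) ≠ 0
      rw [hΦ _ (by simp)]
      obtain ⟨c, hc, h⟩ := contract_good (b := b) hl List.mem_cons_self
      rw [h, map_smul, List.erase_cons_head]
      exact mul_ne_zero hc h1
    · intro w hw hlen hne
      change Φ (R.comul (word b w) (R.v ⊗ₜ 1)) = 0
      rw [hΦ _ (by simpa using hlen)]
      -- A good word is determined by its multiset of letters, so erasing `i` from `w ≠ i :: l` does
      -- not give `l`.
      by_cases hi : i ∈ w
      · obtain ⟨c, hc, h⟩ := contract_good (b := b) hw hi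
        rw [h, map_smul, h2 _ (hw.sublist List.erase_sublist), smul_zero]
        · rw [List.length_erase_of_mem hi]
          simp only [List.length_cons] at hlen
          omega
        · intro h'
          refine hne (hw.eq_of_perm hl ?_)
          rw [← h']
          exact List.perm_cons_erase hi
      · rw [contract_of_notMem hi, map_zero]

/-- The form belonging to a longest word of a linear relation vanishes on all other words of the
relation. -/
theorem linearIndependent (R : VacuumRep b V) (hb : Homogeneous b par) :
    LinearIndependent ℂ fun l : {l : List I // Good par l} => word b l.1 := by
  rw [linearIndependent_iff]
  intro f hf
  by_contra hne
  obtain ⟨l, hl, hmax⟩ := Finset.exists_max_image f.support (fun l => l.1.length)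
    (Finsupp.support_nonempty_iff.2 hne)
  obtain ⟨Ψ, h1, h2⟩ := R.exists_form hb l.2
  have := congrArg Ψ hf
  rw [Finsupp.linearCombination_apply, Finsupp.sum, map_sum, map_zero,
    Finset.sum_eq_single l] at this
  · rw [map_smul, smul_eq_zero] at this
    exact this.elim (Finsupp.mem_support_iff.1 hl) h1
  · intro m hm hml
    rw [map_smul, h2 m.1 m.2 (hmax m hm) (fun h => hml (Subtype.ext h)), smul_zero]
  · intro h
    exact absurd hl h

/-- The Poincaré-Birkhoff-Witt basis. -/
def pbw (R : VacuumRep b V) (hb : Homogeneous b par) : Module.Basis {l : List I // Good par l} ℂ (Env L) :=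
  Module.Basis.mk (R.linearIndependent hb) (by
    rintro u -
    have hu : ∃ k, u ∈ wordSpan b (fun _ => True) k := by
      induction u using Env.induct with
      | hs r =>
        refine ⟨1, ?_⟩
        rw [Algebra.algebraMap_eq_smul_one]
        exact Submodule.smul_mem _ _ (word_mem_wordSpan (l := []) trivial (by simp))
      | hι x =>
        refine ⟨2, ?_⟩
        have := ι_mul_mem_wordSpan (b := b) (k := 1) x
          (word_mem_wordSpan (l := []) trivial (by simp))
        simpa using this
      | hm a c ha hc =>
        obtain ⟨k, hk⟩ := ha
        obtain ⟨m, hm⟩ := hc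
        exact ⟨_, mul_mem_wordSpan hk (wordSpan_mono (fun _ h => h) (Nat.le_succ m) hm)⟩
      | ha a c ha hc =>
        obtain ⟨k, hk⟩ := ha
        obtain ⟨m, hm⟩ := hc
        exact ⟨max k m, Submodule.add_mem _ (wordSpan_mono (fun _ h => h) (le_max_left _ _) hk)
          (wordSpan_mono (fun _ h => h) (le_max_right _ _) hm)⟩
    obtain ⟨k, hk⟩ := hu
    rw [wordSpan_good hb stable_true] at hk
    refine Submodule.span_mono ?_ hk
    rintro _ ⟨w, ⟨⟨-, hw⟩, -⟩, rfl⟩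
    exact ⟨⟨w, hw⟩, rfl⟩)

@[simp] theorem pbw_apply (R : VacuumRep b V) (hb : Homogeneous b par) (l : {l : List I // Good par l}) :
    R.pbw hb l = word b l.1 := Module.Basis.mk_apply _ _ _

end VacuumRep

end PBW

end QType

namespace QType

/-! ### A basis adapted to the triangular decomposition -/

/-- A homogeneous basis of weight vectors, ordered such that `n⁻` comes first and `n⁺` last. -/
structure TriBasis (t : Kind) (n : ℕ) (I : Type) [LinearOrder I] where
  b : Module.Basis I ℂ (Alg t n)
  par : I → ZMod 2
  wt : I → RootLattice n
  homog : Homogeneous b par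
  trichotomy : ∀ i, wt i < 0 ∨ wt i = 0 ∨ 0 < wt i
  lt_of_neg : ∀ i j, wt i < 0 → ¬ wt j < 0 → i < j
  lt_of_pos : ∀ i j, ¬ 0 < wt i → 0 < wt j → i < j
  mem_wt : ∀ i, b i ∈ induced t (supported fun p q => root p q = wt i)
  wt_br : ∀ i j k, b.repr (LieSuperalgebra.br (b i) (b j)) k ≠ 0 → wt k = wt i + wt j
  nMinus_eq : nMinus t n = Submodule.span ℂ (b '' {i | wt i < 0})
  cartan_eq : cartan t n = Submodule.span ℂ (b '' {i | wt i = 0})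
  nPlus_eq : nPlus t n = Submodule.span ℂ (b '' {i | 0 < wt i})
  nPlusRoot_eq : ∀ α, nPlusRoot t n α = Submodule.span ℂ (b '' {i | 0 < wt i ∧ wt i = α})
  exists_dual : ∀ e, 0 < wt e → ∃ f a, wt f = -wt e ∧ par f = par e ∧ wt a = 0 ∧ par a = 0 ∧
    b.repr (LieSuperalgebra.br (b f) (b e)) a ≠ 0
  eq_of_wt_par : ∀ e e', 0 < wt e → wt e = wt e' → par e = par e' → e = e'
  exists_grading : ∃ h ∈ LieSuperalgebra.part (L := Alg t n) 0,
    h ∈ induced t (supported fun p q => root p q = 0) ∧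
    ∀ i, LieSuperalgebra.br h (b i) = (height (wt i) : ℂ) • b i
  vac : VacuumRep b (ℂ × Module.End ℂ (Q n))

section Concrete

variable {t : Kind} {n : ℕ}

theorem root_pos {i j : Fin n} (h : i < j) : 0 < root i j := by
  have h' : i.val < j.val := h
  refine lt_of_le_of_ne (fun k => ?_) fun h0 => ?_
  · simp only [root, Pi.zero_apply]
    split_ifs <;> omega
  · have := congrFun h0 ⟨i.val, by omega⟩
    simp [root, not_le.2 h] at this

theorem root_neg {i j : Fin n} (h : j < i) : root i j < 0 := by
  have h1 := root_pos h
  have h2 : root i j = -root j i := by funext k; simp [root]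
  rw [h2]
  exact neg_neg_of_pos h1

theorem root_self (i : Fin n) : root i i = 0 := by funext k; simp [root]

theorem root_eq_zero {i j : Fin n} (h : root i j = 0) : i = j := by
  rcases lt_trichotomy i j with h' | h' | h'
  · exact absurd h (root_pos h').ne'
  · exact h'
  · exact absurd h (root_neg h').ne

theorem lt_of_root_pos {i j : Fin n} (h : 0 < root i j) : i < j := by
  rcases lt_trichotomy i j with h' | h' | h'
  · exact h'
  · rw [h', root_self] at h; exact absurd h (lt_irrefl _)
  · exact absurd (h.trans (root_neg h')) (lt_irrefl _)

theorem lt_of_root_neg {i j : Fin n} (h : root i j < 0) : j < i := by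
  rcases lt_trichotomy i j with h' | h' | h'
  · exact absurd (h.trans (root_pos h')) (lt_irrefl _)
  · rw [h', root_self] at h; exact absurd h (lt_irrefl _)
  · exact h'

/-- For `i < j` the coordinates of `root i j` are the indicator function of the interval `[i, j)`.
-/
theorem root_injective {i j k l : Fin n} (h : i < j) (h' : k < l) (e : root i j = root k l) :
    i = k ∧ j = l := by
  have h1 : i.val < j.val := h
  have h2 : k.val < l.val := h'
  have hj := j.2
  have hl := l.2
  have key : ∀ m : ℕ, m < n - 1 → (i.val ≤ m ∧ m < j.val ↔ k.val ≤ m ∧ m < l.val) := by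
    intro m hm
    have := congrFun e ⟨m, hm⟩
    simp only [root] at this
    split_ifs at this <;> omega
  have a1 := key i (by omega)
  have a2 := key k (by omega)
  have a3 := key (j - 1) (by omega)
  have a4 := key (l - 1) (by omega)
  constructor <;> apply Fin.ext <;> omega

/-- The matrix units `X_{E,0}` and `X_{0,E}`. -/
def unit (i j : Fin n) (p : ZMod 2) : Q n :=
  if p = 0 then (Matrix.single i j 1, 0) else (0, Matrix.single i j 1)

theorem unit_zero (i j : Fin n) : unit i j 0 = (Matrix.single i j 1, 0) := rfl

theorem unit_one (i j : Fin n) : unit i j 1 = (0, Matrix.single i j 1) := rfl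

theorem unit_mem_sub {i j : Fin n} (h : i ≠ j) (p : ZMod 2) : unit i j p ∈ t.sub n := by
  refine mem_sub_of_trace ?_
  obtain rfl | rfl := zmod2_cases p
  · simp [unit_zero]
  · simp [unit_one, Matrix.trace_single_eq_of_ne _ _ _ h]

theorem unit_mem_qPart (i j : Fin n) (p : ZMod 2) : unit i j p ∈ qPart n p := by
  obtain rfl | rfl := zmod2_cases p
  · simp [unit_zero, mem_qPart_zero]
  · simp [unit_one, mem_qPart_one]

theorem unit_mem_supported {P : Fin n → Fin n → Prop} {i j : Fin n} (h : P i j) (p : ZMod 2) :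
    unit i j p ∈ supported P := by
  intro k l hkl
  have : ¬ (i = k ∧ j = l) := by rintro ⟨rfl, rfl⟩; exact hkl h
  obtain rfl | rfl := zmod2_cases p <;> simp [unit_zero, unit_one, this]

/-- The positions off the diagonal. -/
abbrev OffDiag (n : ℕ) : Type := {p : Fin n × Fin n // p.1 ≠ p.2}

/-- The even and the odd part of the Cartan subalgebra. -/
def cartanPart (t : Kind) (n : ℕ) (p : ZMod 2) : Submodule ℂ (Alg t n) :=
  cartan t n ⊓ LieSuperalgebra.part p

variable (t n) in
/-- The index set of a basis of the algebra. -/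
abbrev Idx : Type := (OffDiag n × ZMod 2) ⊕
  (Fin (Module.finrank ℂ (cartanPart t n 0)) ⊕ Fin (Module.finrank ℂ (cartanPart t n 1)))

/-- The root vectors. -/
def rootVec (k : OffDiag n × ZMod 2) : Alg t n :=
  Alg.mk t n ⟨unit k.1.1.1 k.1.1.2 k.2, unit_mem_sub k.1.2 k.2⟩

/-- The entries off the diagonal, as linear forms. -/
def entry (k : OffDiag n × ZMod 2) : Alg t n →ₗ[ℂ] ℂ :=
  Submodule.liftQ _ ((if k.2 = 0 then Matrix.entryLinearMap ℂ ℂ k.1.1.1 k.1.1.2 ∘ₗ LinearMap.fst ℂ _ _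
    else Matrix.entryLinearMap ℂ ℂ k.1.1.1 k.1.1.2 ∘ₗ LinearMap.snd ℂ _ _) ∘ₗ (t.sub n).subtype) (by
    intro x hx
    obtain ⟨c, hc⟩ := ideal_cases (t := t) (n := n) hx
    rw [LinearMap.mem_ker, LinearMap.comp_apply]
    have : (t.sub n).subtype x = (c • 1, 0) := hc
    rw [this]
    split_ifs <;> simp [Matrix.one_apply_ne k.1.2])

theorem entry_mk (k : OffDiag n × ZMod 2) (x : t.sub n) :
    entry k (Alg.mk t n x) = if k.2 = 0 then (x : Q n).1 k.1.1.1 k.1.1.2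
      else (x : Q n).2 k.1.1.1 k.1.1.2 := by
  change ((if k.2 = 0 then _ else _ : Q n →ₗ[ℂ] ℂ) ∘ₗ _) x = _
  split_ifs <;> rfl

theorem entry_rootVec (k l : OffDiag n × ZMod 2) :
    entry k (rootVec (t := t) l) = if k = l then 1 else 0 := by
  obtain ⟨⟨⟨i, j⟩, hij⟩, p⟩ := k
  obtain ⟨⟨⟨i', j'⟩, hij'⟩, p'⟩ := l
  rw [rootVec, entry_mk]
  obtain rfl | rfl := zmod2_cases p <;> obtain rfl | rfl := zmod2_cases p' <;>
    simp [unit_zero, unit_one, Matrix.single_apply, eq_comm]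

theorem entry_cartan {x : Alg t n} (hx : x ∈ cartan t n) (k : OffDiag n × ZMod 2) :
    entry k x = 0 := by
  obtain ⟨v, hv, rfl⟩ := hx
  have := hv k.1.1.1 k.1.1.2 k.1.2
  rw [entry_mk]
  split_ifs
  · exact this.1
  · exact this.2

theorem linearIndependent_rootVec : LinearIndependent ℂ (rootVec (t := t) (n := n)) := by
  rw [Fintype.linearIndependent_iff]
  intro g hg k
  have := congrArg (entry k) hg
  simpa [map_sum, entry_rootVec] using this

variable (t n) in
/-- The basis of the even or odd part of the Cartan subalgebra. -/
def cartanVec (p : ZMod 2) (k : Fin (Module.finrank ℂ (cartanPart t n p))) : Alg t n :=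
  (Module.finBasis ℂ (cartanPart t n p) k : Alg t n)

theorem cartanVec_mem (p : ZMod 2) (k) : cartanVec t n p k ∈ cartanPart t n p := Subtype.prop _

theorem span_cartanVec (p : ZMod 2) :
    Submodule.span ℂ (Set.range (cartanVec t n p)) = cartanPart t n p := by
  have h : Set.range (cartanVec t n p) = (cartanPart t n p).subtype ''
      Set.range (Module.finBasis ℂ (cartanPart t n p)) := by
    rw [← Set.range_comp]; rfl
  rw [h, ← Submodule.map_span, Module.Basis.span_eq, Submodule.map_top, Submodule.range_subtype]

theorem linearIndependent_cartanVec (p : ZMod 2) : LinearIndependent ℂ (cartanVec t n p) := by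
  have h : cartanVec t n p = (cartanPart t n p).subtype ∘ Module.finBasis ℂ (cartanPart t n p) :=
    rfl
  have hli := (Module.finBasis ℂ (cartanPart t n p)).linearIndependent
  rw [h]
  exact LinearIndependent.map' hli (cartanPart t n p).subtype (Submodule.ker_subtype _)

/-- The basis vectors. -/
def vec : Idx t n → Alg t n :=
  Sum.elim rootVec (Sum.elim (cartanVec t n 0) (cartanVec t n 1))

theorem cartan_vec (l) : vec (t := t) (n := n) (Sum.inr l) ∈ cartan t n := by
  rcases l with k | k
  · exact (cartanVec_mem 0 k).1
  · exact (cartanVec_mem 1 k).1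

/-- The off-diagonal entries separate the root vectors and vanish on the Cartan subalgebra, whose
even and odd parts are independent by parity. -/
theorem linearIndependent_vec : LinearIndependent ℂ (vec (t := t) (n := n)) := by
  have h23 : LinearIndependent ℂ (Sum.elim (cartanVec t n 0) (cartanVec t n 1)) := by
    refine (linearIndependent_cartanVec 0).sum_type (linearIndependent_cartanVec 1) ?_
    rw [span_cartanVec, span_cartanVec]
    exact (LieSuperalgebra.isCompl_part (L := Alg t n)).disjoint.mono inf_le_right inf_le_right
  refine linearIndependent_rootVec.sum_type h23 ?_
  rw [Submodule.disjoint_def]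
  intro x hx hx'
  have hc : x ∈ cartan t n := by
    refine Submodule.span_le.2 ?_ hx'
    rintro _ ⟨k, rfl⟩
    exact cartan_vec k
  obtain ⟨g, rfl⟩ := (Submodule.mem_span_range_iff_exists_fun ℂ).1 hx
  refine Finset.sum_eq_zero fun k _ => ?_
  have := entry_cartan hc k
  have hk : g k = 0 := by simpa [map_sum, entry_rootVec] using this
  rw [hk, zero_smul]

/-- The property `P` of the position of a basis vector. -/
def IdxIn (P : Fin n → Fin n → Prop) : Idx t n → Prop
  | Sum.inl k => P k.1.1.1 k.1.1.2
  | Sum.inr _ => ∃ i, P i i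

theorem cartan_le_span : cartan t n ≤ Submodule.span ℂ
    (vec '' {k : Idx t n | ∃ l, k = Sum.inr l}) := by
  intro x hx
  have hp : ∀ p, ∀ y ∈ cartanPart t n p, y ∈ Submodule.span ℂ (Set.range (cartanVec t n p)) :=
    fun p y hy => by rwa [span_cartanVec]
  obtain ⟨x0, h0, x1, h1, p0, p1, rfl⟩ := induced_parity hx
  refine Submodule.add_mem _ (Submodule.span_mono ?_ (hp 0 x0 ⟨h0, p0⟩))
    (Submodule.span_mono ?_ (hp 1 x1 ⟨h1, p1⟩))
  · rintro _ ⟨k, rfl⟩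
    exact ⟨Sum.inr (Sum.inl k), ⟨_, rfl⟩, rfl⟩
  · rintro _ ⟨k, rfl⟩
    exact ⟨Sum.inr (Sum.inr k), ⟨_, rfl⟩, rfl⟩

theorem induced_le_span (P : Fin n → Fin n → Prop) :
    induced t (supported P) ≤ Submodule.span ℂ (vec '' {k : Idx t n | IdxIn P k}) := by
  rintro _ ⟨v, hv, rfl⟩
  have hv' : ∀ i j, ¬ P i j → (v : Q n).1 i j = 0 ∧ (v : Q n).2 i j = 0 := hv
  have hd : ((Matrix.diagonal (v : Q n).1.diag, Matrix.diagonal (v : Q n).2.diag) : Q n)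
      ∈ t.sub n := mem_sub_of_snd_eq v.2 (by simp [Matrix.trace])
  have e : v = ⟨_, hd⟩ + ∑ k : OffDiag n,
      ((v : Q n).1 k.1.1 k.1.2 • (⟨unit k.1.1 k.1.2 0, unit_mem_sub k.2 0⟩ : t.sub n)
        + (v : Q n).2 k.1.1 k.1.2 • (⟨unit k.1.1 k.1.2 1, unit_mem_sub k.2 1⟩ : t.sub n)) := by
    have key : ∀ A : Matrix (Fin n) (Fin n) ℂ, A = Matrix.diagonal A.diag
        + ∑ k : OffDiag n, A k.1.1 k.1.2 • Matrix.single k.1.1 k.1.2 1 := by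
      intro A
      ext i j
      rw [Matrix.add_apply, Matrix.sum_apply]
      by_cases hij : i = j
      · subst hij
        rw [Finset.sum_eq_zero, add_zero, Matrix.diagonal_apply_eq, Matrix.diag_apply]
        intro k _
        have : ¬ (k.1.1 = i ∧ k.1.2 = i) := by rintro ⟨h1, h2⟩; exact k.2 (h1.trans h2.symm)
        simp [this]
      · rw [Matrix.diagonal_apply_ne _ hij, zero_add, Finset.sum_eq_single ⟨(i, j), hij⟩]
        · simp
        · intro k _ hk
          have : ¬ (k.1.1 = i ∧ k.1.2 = j) := by
            rintro ⟨h1, h2⟩; exact hk (Subtype.ext (Prod.ext h1 h2))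
          simp [this]
        · simp
    ext1
    rw [Submodule.coe_add, Submodule.coe_sum]
    refine Prod.ext ?_ ?_
    · rw [Prod.fst_add, Prod.fst_sum]
      simpa [unit_zero, unit_one] using key (v : Q n).1
    · rw [Prod.snd_add, Prod.snd_sum]
      simpa [unit_zero, unit_one] using key (v : Q n).2
  rw [e, map_add, map_sum]
  refine Submodule.add_mem _ ?_ (Submodule.sum_mem _ fun k _ => ?_)
  · by_cases hP : ∃ i, P i i
    · refine Submodule.span_mono (Set.image_mono ?_) (cartan_le_span ⟨⟨_, hd⟩, fun i j hij => ?_, rfl⟩)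
      · rintro _ ⟨l, rfl⟩
        exact hP
      · simp [Matrix.diagonal_apply_ne _ hij]
    · have h0 : (⟨_, hd⟩ : t.sub n) = 0 := by
        push Not at hP
        ext1
        refine Prod.ext ?_ ?_
        · change Matrix.diagonal _ = 0
          rw [Matrix.diagonal_eq_zero]
          funext i
          exact (hv' i i (hP i)).1
        · change Matrix.diagonal _ = 0
          rw [Matrix.diagonal_eq_zero]
          funext i
          exact (hv' i i (hP i)).2
      rw [h0, map_zero]
      exact Submodule.zero_mem _
  · rw [map_add, map_smul, map_smul]
    by_cases hk : P k.1.1 k.1.2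
    · exact Submodule.add_mem _
        (Submodule.smul_mem _ _ (Submodule.subset_span ⟨Sum.inl (k, 0), hk, rfl⟩))
        (Submodule.smul_mem _ _ (Submodule.subset_span ⟨Sum.inl (k, 1), hk, rfl⟩))
    · rw [(hv' _ _ hk).1, (hv' _ _ hk).2, zero_smul, zero_smul, add_zero]
      exact Submodule.zero_mem _

variable (t n) in
/-- The basis of the algebra. -/
def basis : Module.Basis (Idx t n) ℂ (Alg t n) :=
  Module.Basis.mk linearIndependent_vec (by
    intro x _
    have h : x ∈ induced t (supported fun _ _ => True) := by
      obtain ⟨v, rfl⟩ := Submodule.mkQ_surjective _ x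
      exact ⟨v, fun i j h => absurd trivial h, rfl⟩
    exact Submodule.span_mono (Set.image_subset_range _ _) (induced_le_span _ h))

theorem basis_apply (k : Idx t n) : basis t n k = vec k := Module.Basis.mk_apply _ _ _

theorem vec_mem_induced {P : Fin n → Fin n → Prop} (hP : ∀ i j, P i i → P j j) {k : Idx t n}
    (hk : IdxIn P k) : vec k ∈ induced t (supported P) := by
  rcases k with k | k
  · exact ⟨_, unit_mem_supported hk k.2, rfl⟩
  · obtain ⟨i, hi⟩ := hk
    refine induced_mono (supported_mono ?_) (cartan_vec k)
    rintro j l rfl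
    exact hP i j hi

/-- The Cartan basis vectors are not tied to single diagonal positions, so `P` has to contain all of
the diagonal or none of it. -/
theorem induced_eq_span {P : Fin n → Fin n → Prop} (hP : ∀ i j, P i i → P j j) :
    induced t (supported P) = Submodule.span ℂ (basis t n '' {k | IdxIn P k}) := by
  have h : (basis t n : Idx t n → Alg t n) = vec := funext basis_apply
  rw [h]
  refine le_antisymm (induced_le_span P) (Submodule.span_le.2 ?_)
  rintro _ ⟨k, hk, rfl⟩
  exact vec_mem_induced hP hk

end Concrete

end QType

/-! ### Faithful representations of the four algebras. -/

namespace QType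

section Concrete

variable {t : Kind} {n : ℕ}

/-- The left multiplications of `q(n)`, considered as the associative algebra of the block
matrices `X_{A,B}`. -/
def mulQ (n : ℕ) : Q n →ₗ[ℂ] Module.End ℂ (Q n) :=
  LinearMap.mk₂ ℂ (fun x y => (x.1 * y.1 + x.2 * y.2, x.1 * y.2 + x.2 * y.1))
    (by intros; ext1 <;> simp only [Prod.fst_add, Prod.snd_add] <;> noncomm_ring)
    (by intros; ext1 <;> simp [smul_add])
    (by intros; ext1 <;> simp only [Prod.fst_add, Prod.snd_add] <;> noncomm_ring)
    (by intros; ext1 <;> simp [smul_add])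

theorem mulQ_apply (x y : Q n) :
    mulQ n x y = (x.1 * y.1 + x.2 * y.2, x.1 * y.2 + x.2 * y.1) := rfl

/-- The grading operator of `q(n)`. -/
def gradQ (n : ℕ) : Module.End ℂ (Q n) := LinearMap.prodMap LinearMap.id (-LinearMap.id)

theorem gradQ_apply (x : Q n) : gradQ n x = (x.1, -x.2) := rfl

theorem mulQ_br {i j : ZMod 2} {x y : Q n} (hx : x ∈ qPart n i) (hy : y ∈ qPart n j) :
    mulQ n x * mulQ n y - sgn i j • (mulQ n y * mulQ n x) = mulQ n (qBr n x y) := by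
  obtain ⟨x1, x2⟩ := x
  obtain ⟨y1, y2⟩ := y
  refine LinearMap.ext ?_
  rintro ⟨z1, z2⟩
  obtain rfl | rfl := zmod2_cases i <;> obtain rfl | rfl := zmod2_cases j <;>
    simp only [mem_qPart_zero, mem_qPart_one] at hx hy <;> subst hx <;> subst hy <;>
    simp only [sgn_00, sgn_01, sgn_10, sgn_11, one_smul, neg_smul, qBr_apply, mulQ_apply,
      LinearMap.sub_apply, LinearMap.smul_apply, Module.End.mul_apply] <;>
    ext1 <;> simp only [Prod.fst_neg, Prod.snd_neg, Prod.fst_sub, Prod.snd_sub] <;>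
    noncomm_ring

theorem qBr_br {i j : ZMod 2} {x y : Q n} (hx : x ∈ qPart n i) (hy : y ∈ qPart n j) :
    (qBr n x : Module.End ℂ (Q n)) * qBr n y - sgn i j • ((qBr n y : Module.End ℂ (Q n)) * qBr n x)
      = qBr n (qBr n x y) := by
  refine LinearMap.ext fun z => ?_
  have := qBr_jacobi hx hy z
  simp only [LinearMap.sub_apply, LinearMap.smul_apply, Module.End.mul_apply]
  rw [this]
  abel

theorem gradQ_mulQ {i : ZMod 2} {x : Q n} (hx : x ∈ qPart n i) :
    gradQ n * mulQ n x = sgn 1 i • (mulQ n x * gradQ n) := by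
  obtain ⟨x1, x2⟩ := x
  refine LinearMap.ext ?_
  rintro ⟨z1, z2⟩
  obtain rfl | rfl := zmod2_cases i <;>
    simp only [mem_qPart_zero, mem_qPart_one] at hx <;> subst hx <;>
    simp only [sgn_10, sgn_11, one_smul, neg_smul, mulQ_apply, gradQ_apply,
      LinearMap.smul_apply, Module.End.mul_apply] <;>
    ext1 <;> simp only [Prod.fst_neg, Prod.snd_neg] <;> noncomm_ring

theorem gradQ_qBr {i : ZMod 2} {x : Q n} (hx : x ∈ qPart n i) :
    gradQ n * (qBr n x : Module.End ℂ (Q n))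
      = sgn 1 i • ((qBr n x : Module.End ℂ (Q n)) * gradQ n) := by
  obtain ⟨x1, x2⟩ := x
  refine LinearMap.ext ?_
  rintro ⟨z1, z2⟩
  obtain rfl | rfl := zmod2_cases i <;>
    simp only [mem_qPart_zero, mem_qPart_one] at hx <;> subst hx <;>
    simp only [sgn_10, sgn_11, one_smul, neg_smul, qBr_apply, gradQ_apply,
      LinearMap.smul_apply, Module.End.mul_apply] <;>
    ext1 <;> simp only [Prod.fst_neg, Prod.snd_neg] <;> noncomm_ring

theorem gradQ_sq : gradQ n * gradQ n = 1 := by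
  refine LinearMap.ext fun z => ?_
  simp [gradQ_apply]

theorem eq_zero_of_mulQ {x : Q n} (h : mulQ n x = 0) : x = 0 := by
  have := LinearMap.congr_fun h (1, 0)
  simpa [mulQ_apply] using this

theorem exists_smul_one {A : Matrix (Fin n) (Fin n) ℂ}
    (h : ∀ i j, A * Matrix.single i j 1 = Matrix.single i j 1 * A) : ∃ c : ℂ, A = c • 1 := by
  obtain ⟨c, hc⟩ := Matrix.mem_range_scalar_of_commute_single (M := A) fun i j _ => (h i j).symm
  refine ⟨c, ?_⟩
  rw [← hc]
  ext i j
  simp [Matrix.diagonal_apply, Matrix.one_apply]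

/-- Commuting with the even matrix units forces both blocks to be scalar; the bracket with the odd
element `(0, 1)` is twice the second block, which therefore vanishes. -/
theorem exists_smul_one_of_qBr {x : Q n} (h : qBr n x = 0) : ∃ c : ℂ, x = (c • 1, 0) := by
  have h1 : ∀ i j, x.1 * Matrix.single i j 1 = Matrix.single i j 1 * x.1 ∧
      x.2 * Matrix.single i j 1 = Matrix.single i j 1 * x.2 := by
    intro i j
    have := LinearMap.congr_fun h (Matrix.single i j 1, 0)
    simpa [qBr_apply, Prod.ext_iff, sub_eq_zero] using this
  obtain ⟨c, hc⟩ := exists_smul_one fun i j => (h1 i j).1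
  obtain ⟨d, hd⟩ := exists_smul_one fun i j => (h1 i j).2
  refine ⟨c, Prod.ext hc ?_⟩
  have := LinearMap.congr_fun h (0, 1)
  have h2 : x.2 + x.2 = 0 := by simpa [qBr_apply, Prod.ext_iff] using (Prod.ext_iff.1 this).1
  rw [← two_smul ℂ] at h2
  exact (smul_eq_zero.1 h2).resolve_left two_ne_zero

/-- A faithful action of each of the algebras on `q(n)`. -/
theorem exists_faithful (t : Kind) (n : ℕ) : ∃ ρ : Alg t n →ₗ[ℂ] Module.End ℂ (Q n),
    Function.Injective ρ ∧
    (∀ (i j : ZMod 2) (x y : Alg t n), x ∈ LieSuperalgebra.part (L := Alg t n) i → y ∈ LieSuperalgebra.part (L := Alg t n) j →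
      ρ x * ρ y - sgn i j • (ρ y * ρ x) = ρ (LieSuperalgebra.br x y)) ∧
    ∀ (i : ZMod 2) (x : Alg t n), x ∈ LieSuperalgebra.part (L := Alg t n) i →
      gradQ n * ρ x = sgn 1 i • (ρ x * gradQ n) := by
  have key : ∀ f : Q n →ₗ[ℂ] Module.End ℂ (Q n), (∀ x, f x = 0 → x ∈ t.sub n → x ∈ t.ideal n) →
      (∀ x ∈ t.ideal n, f x = 0) →
      (∀ {i j : ZMod 2} {x y : Q n}, x ∈ qPart n i → y ∈ qPart n j →
        f x * f y - sgn i j • (f y * f x) = f (qBr n x y)) →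
      (∀ {i : ZMod 2} {x : Q n}, x ∈ qPart n i →
        gradQ n * f x = sgn 1 i • (f x * gradQ n)) → ∃ ρ : Alg t n →ₗ[ℂ] Module.End ℂ (Q n),
    Function.Injective ρ ∧
    (∀ (i j : ZMod 2) (x y : Alg t n), x ∈ LieSuperalgebra.part (L := Alg t n) i → y ∈ LieSuperalgebra.part (L := Alg t n) j →
      ρ x * ρ y - sgn i j • (ρ y * ρ x) = ρ (LieSuperalgebra.br x y)) ∧
    ∀ (i : ZMod 2) (x : Alg t n), x ∈ LieSuperalgebra.part (L := Alg t n) i →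
      gradQ n * ρ x = sgn 1 i • (ρ x * gradQ n) := by
    intro f h1 h2 h3 h4
    refine ⟨Submodule.liftQ _ (f ∘ₗ (t.sub n).subtype) fun x hx => h2 x hx, ?_, ?_, ?_⟩
    · rw [injective_iff_map_eq_zero]
      intro x hx
      obtain ⟨v, rfl⟩ := Submodule.mkQ_surjective _ x
      exact (Submodule.Quotient.mk_eq_zero _).2 (h1 _ hx v.2)
    · rintro i j _ _ ⟨v, hv, rfl⟩ ⟨w, hw, rfl⟩
      exact h3 hv hw
    · rintro i _ ⟨v, hv, rfl⟩
      exact h4 hv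
  -- Left multiplication is faithful on `q(n)` and `sq(n)`. In the quotients `Id` has to act by
  -- zero, and the adjoint action on `q(n)`, with kernel the scalars, takes its place.
  cases t
  · exact key (mulQ n) (fun x h _ => (Submodule.mem_bot ℂ).2 (eq_zero_of_mulQ h))
      (fun x h => by rw [(Submodule.mem_bot ℂ).1 h, map_zero]) mulQ_br gradQ_mulQ
  · exact key (mulQ n) (fun x h _ => (Submodule.mem_bot ℂ).2 (eq_zero_of_mulQ h))
      (fun x h => by rw [(Submodule.mem_bot ℂ).1 h, map_zero]) mulQ_br gradQ_mulQ
  · refine key (qBr n) (fun x h _ => ?_)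
      (fun x h => LinearMap.ext fun y => qBr_ideal_left (t := .pq) h y) qBr_br gradQ_qBr
    obtain ⟨c, rfl⟩ := exists_smul_one_of_qBr h
    exact Submodule.mem_span_singleton.2 ⟨c, by simp⟩
  · refine key (qBr n) (fun x h _ => ?_)
      (fun x h => LinearMap.ext fun y => qBr_ideal_left (t := .psq) h y) qBr_br gradQ_qBr
    obtain ⟨c, rfl⟩ := exists_smul_one_of_qBr h
    exact Submodule.mem_span_singleton.2 ⟨c, by simp⟩

/-- `L` acts on endomorphisms by left multiplication with `ρ x`, so that `ρ x` applied to `1`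
recovers `x` by faithfulness. The trivial summand `ℂ` detaches the vacuum `(1, 1)` from the vectors
`(0, ρ x)`, even if `1` lies in the image of `ρ`; subtracting `g 1` times the first coordinate makes
the forms vanish on it. -/
theorem exists_vacuumRep {I : Type} [LinearOrder I] (b : Module.Basis I ℂ (Alg t n)) :
    Nonempty (VacuumRep b (ℂ × Module.End ℂ (Q n))) := by
  obtain ⟨ρ, h1, h2, h3⟩ := exists_faithful t n
  obtain ⟨g, hg⟩ := LinearMap.exists_leftInverse_of_injective ρ (LinearMap.ker_eq_bot.2 h1)
  have hg' : ∀ x, g (ρ x) = x := fun x => LinearMap.congr_fun hg x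
  refine ⟨{
    ρ := {
      toFun := fun x => LinearMap.prodMap 0 (LinearMap.mulLeft ℂ (ρ x))
      map_add' := fun x y => by
        refine LinearMap.ext fun z => ?_
        simp [add_mul]
      map_smul' := fun c x => by
        refine LinearMap.ext fun z => ?_
        simp }
    γ := LinearMap.prodMap LinearMap.id
      (LinearMap.mulLeft ℂ (gradQ n) ∘ₗ LinearMap.mulRight ℂ (gradQ n))
    v := (1, 1)
    φ := fun i => b.coord i ∘ₗ (g ∘ₗ LinearMap.snd ℂ _ _ - (LinearMap.fst ℂ _ _).smulRight (g 1))
    ρ_br := fun i j x y hx hy => ?_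
    γ_ρ := fun i x hx => ?_
    γ_sq := ?_
    γ_v := ?_
    φ_v := fun i => by simp
    φ_ρ := fun i j => ?_ }⟩
  · refine LinearMap.ext fun z => ?_
    have := congrArg (· * z.2) (h2 i j x y hx hy)
    simp only [sub_mul, smul_mul_assoc, mul_assoc] at this
    refine Prod.ext ?_ ?_
    · simp
    · simpa using this
  · refine LinearMap.ext fun z => ?_
    have := congrArg (· * (z.2 * gradQ n)) (h3 i x hx)
    simp only [smul_mul_assoc, mul_assoc] at this
    refine Prod.ext ?_ ?_
    · obtain rfl | rfl := zmod2_cases i <;> simp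
    · simpa [mul_assoc] using this
  · refine LinearMap.ext fun z => ?_
    refine Prod.ext ?_ ?_
    · simp
    · simp only [Module.End.mul_apply, LinearMap.prodMap_apply, LinearMap.comp_apply,
        LinearMap.mulLeft_apply, LinearMap.mulRight_apply, Module.End.one_apply]
      rw [mul_assoc, mul_assoc z.2, gradQ_sq, mul_one, ← mul_assoc, gradQ_sq, one_mul]
  · refine Prod.ext ?_ ?_
    · simp
    · simp [gradQ_sq]
  · simp [hg', Finsupp.single_apply, eq_comm]

end Concrete

end QType

/-! ### Weights, parities and order of the basis; existence of the adapted basis. -/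

namespace QType

section Concrete

variable {t : Kind} {n : ℕ}

/-- The weights of the basis vectors. -/
def idxWt : Idx t n → RootLattice n
  | Sum.inl k => root k.1.1.1 k.1.1.2
  | Sum.inr _ => 0

/-- The parities of the basis vectors. -/
def idxPar : Idx t n → ZMod 2
  | Sum.inl k => k.2
  | Sum.inr (Sum.inl _) => 0
  | Sum.inr (Sum.inr _) => 1

/-- The position of a basis vector in the triangular decomposition. -/
def idxClass (k : Idx t n) : ℕ :=
  open Classical in if idxWt k < 0 then 0 else if 0 < idxWt k then 2 else 1

/-- The position in the triangular decomposition decides; the enumeration only breaks ties. -/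
instance : LinearOrder (Idx t n) :=
  LinearOrder.lift' (fun k => toLex (idxClass k, Fintype.equivFin (Idx t n) k)) fun k l h => by
    have := congrArg (fun x => (ofLex x).2) h
    simpa using this

theorem idx_lt {k l : Idx t n} (h : idxClass k < idxClass l) : k < l := by
  change toLex (idxClass k, Fintype.equivFin (Idx t n) k)
    < toLex (idxClass l, Fintype.equivFin (Idx t n) l)
  rw [Prod.Lex.toLex_lt_toLex]
  exact Or.inl h

theorem idx_homog : Homogeneous (basis t n) idxPar := by
  intro k
  rw [basis_apply]
  rcases k with k | k | k
  · exact ⟨_, unit_mem_qPart _ _ _, rfl⟩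
  · exact (cartanVec_mem 0 k).2
  · exact (cartanVec_mem 1 k).2

theorem idxIn_root (α : RootLattice n) (k : Idx t n) :
    IdxIn (fun i j => root i j = α) k → idxWt k = α := by
  rcases k with k | k
  · exact id
  · rintro ⟨i, hi⟩
    rw [← hi, root_self]; rfl

theorem basis_mem_weight (k : Idx t n) :
    basis t n k ∈ induced t (supported fun i j => root i j = idxWt k) := by
  rw [basis_apply]
  rcases k with k | k
  · exact ⟨_, unit_mem_supported (P := fun i j => root i j = root k.1.1.1 k.1.1.2) rfl k.2, rfl⟩
  · refine induced_mono (supported_mono ?_) (cartan_vec k)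
    rintro j l rfl
    exact root_self j

theorem wt_of_repr {α : RootLattice n} {x : Alg t n}
    (hx : x ∈ induced t (supported fun i j => root i j = α)) {k : Idx t n}
    (hk : (basis t n).repr x k ≠ 0) : idxWt k = α := by
  rw [induced_eq_span fun i j h => by rw [root_self] at h ⊢; exact h] at hx
  have := (Module.Basis.mem_span_image (basis t n)).1 hx (Finsupp.mem_support_iff.2 hk)
  exact idxIn_root _ _ this

/-- The coordinates of a homogeneous element are homogeneous. -/
theorem par_of_repr {L : Type*} [AddCommGroup L] [Module ℂ L] [LieSuperalgebra L] {I : Type*}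
    {b : Module.Basis I ℂ L} {par : I → ZMod 2} (hb : Homogeneous b par) {p : ZMod 2} {x : L}
    (hx : x ∈ LieSuperalgebra.part p) {k : I} (hk : b.repr x k ≠ 0) : par k = p := by
  by_contra hne
  have hd : Disjoint (LieSuperalgebra.part (L := L) p) (LieSuperalgebra.part (p + 1)) := by
    have := (LieSuperalgebra.isCompl_part (L := L)).disjoint
    obtain rfl | rfl := zmod2_cases p
    · exact this
    · exact this.symm
  have hpar : ∀ p q : ZMod 2, q ≠ p → q = p + 1 := by decide
  classical
  let s := (b.repr x).support
  have hsum : x = ∑ i ∈ s with par i = p, b.repr x i • b i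
      + ∑ i ∈ s with ¬ par i = p, b.repr x i • b i := by
    rw [Finset.sum_filter_add_sum_filter_not]
    conv_lhs => rw [← b.linearCombination_repr x]
    rfl
  have h1 : ∑ i ∈ s with par i = p, b.repr x i • b i ∈ LieSuperalgebra.part (L := L) p := by
    refine Submodule.sum_mem _ fun i hi => Submodule.smul_mem _ _ ?_
    have := hb i
    rwa [(Finset.mem_filter.1 hi).2] at this
  have h2 : ∑ i ∈ s with ¬ par i = p, b.repr x i • b i ∈ LieSuperalgebra.part (L := L) (p + 1) := by
    refine Submodule.sum_mem _ fun i hi => Submodule.smul_mem _ _ ?_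
    have := hb i
    rwa [hpar _ _ (Finset.mem_filter.1 hi).2] at this
  have h3 : ∑ i ∈ s with ¬ par i = p, b.repr x i • b i = 0 := by
    refine Submodule.disjoint_def.1 hd _ ?_ h2
    rw [← sub_eq_iff_eq_add'.2 hsum]
    exact Submodule.sub_mem _ hx h1
  have h4 := linearIndependent_iff'.1 b.linearIndependent _ _ h3 k
    (Finset.mem_filter.2 ⟨Finsupp.mem_support_iff.2 hk, hne⟩)
  exact hk h4

theorem mk_eq_zero_iff (x : t.sub n) : Alg.mk t n x = 0 ↔ (x : Q n) ∈ t.ideal n :=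
  Submodule.Quotient.mk_eq_zero _

/-- The bracket is `E_jj - E_ii` for even and `E_jj + E_ii` for odd root vectors. For `n = 2` the
latter is `Id`, which is why the quotients by `Id` need `n ≥ 3`: then some third diagonal entry
vanishes and the bracket is not scalar. -/
theorem mk_br_rootVec_ne_zero (hn : t.minRank ≤ n) {i j : Fin n} (hij : i ≠ j) (p : ZMod 2) :
    LieSuperalgebra.br (rootVec (t := t) (⟨(j, i), hij.symm⟩, p)) (rootVec (⟨(i, j), hij⟩, p))
      ≠ 0 := by
  change Alg.mk t n ⟨qBr n (unit j i p) (unit i j p), _⟩ ≠ 0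
  rw [Ne, mk_eq_zero_iff]
  change ¬ qBr n (unit j i p) (unit i j p) ∈ t.ideal n
  have hjj : (qBr n (unit j i p) (unit i j p)).1 j j = 1 := by
    obtain rfl | rfl := zmod2_cases p <;>
      simp [qBr_apply, unit_zero, unit_one, hij]
  have h0 : ∀ k, k ≠ i → k ≠ j → (qBr n (unit j i p) (unit i j p)).1 k k = 0 := by
    intro k h1 h2
    obtain rfl | rfl := zmod2_cases p <;>
      simp [qBr_apply, unit_zero, unit_one, h1.symm, h2.symm]
  have hbot : (qBr n (unit j i p) (unit i j p)) ≠ 0 := by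
    intro h
    rw [h] at hjj
    simp at hjj
  have hspan : 3 ≤ n → ¬ qBr n (unit j i p) (unit i j p) ∈ Submodule.span ℂ {((1, 0) : Q n)} := by
    intro h3 h
    obtain ⟨c, hc⟩ := Submodule.mem_span_singleton.1 h
    obtain ⟨k, hk⟩ : ∃ k : Fin n, k ∉ ({i, j} : Finset (Fin n)) := by
      by_contra hall
      push Not at hall
      have h2 : (Finset.univ : Finset (Fin n)) ⊆ {i, j} := fun k _ => hall k
      have := Finset.card_le_card h2
      rw [Finset.card_univ, Fintype.card_fin] at this
      have := Finset.card_le_two (a := i) (b := j)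
      omega
    simp only [Finset.mem_insert, Finset.mem_singleton, not_or] at hk
    have h4 := h0 k hk.1 hk.2
    rw [← hc] at h4 hjj
    simp at h4 hjj
    rw [h4] at hjj
    exact zero_ne_one hjj
  cases t
  · exact fun h => hbot ((Submodule.mem_bot ℂ).1 h)
  · exact fun h => hbot ((Submodule.mem_bot ℂ).1 h)
  · exact hspan hn
  · exact hspan hn

theorem exists_triBasis (hn : t.minRank ≤ n) : Nonempty (TriBasis t n (Idx t n)) := by
  have hext : ∀ P : Fin n → Fin n → Prop, ∀ p : Idx t n → Prop, (∀ i j, P i i → P j j) →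
      (∀ k, IdxIn P k ↔ p k) →
      induced t (supported P) = Submodule.span ℂ (basis t n '' {k | p k}) := by
    intro P p hP h
    rw [induced_eq_span hP]
    congr 2
    ext k
    exact h k
  have hn2 : 0 < n := by cases t <;> simp [Kind.minRank] at hn <;> omega
  obtain ⟨R⟩ := exists_vacuumRep (basis t n)
  refine ⟨{
    b := basis t n
    par := idxPar
    wt := idxWt
    homog := idx_homog
    trichotomy := ?_
    lt_of_neg := ?_
    lt_of_pos := ?_
    mem_wt := basis_mem_weight
    wt_br := ?_
    nMinus_eq := ?_
    cartan_eq := ?_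
    nPlus_eq := ?_
    nPlusRoot_eq := ?_
    exists_dual := ?_
    eq_of_wt_par := ?_
    exists_grading := ?_
    vac := R }⟩
  · rintro (k | k)
    · rcases lt_or_gt_of_ne k.1.2 with h | h
      · exact Or.inr (Or.inr (root_pos h))
      · exact Or.inl (root_neg h)
    · exact Or.inr (Or.inl rfl)
  · intro i j hi hj
    refine idx_lt ?_
    rw [idxClass, idxClass, if_pos hi, if_neg hj]
    split_ifs <;> norm_num
  · intro i j hi hj
    refine idx_lt ?_
    rw [idxClass, idxClass, if_neg hi, if_neg (not_lt_of_gt hj), if_pos hj]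
    split_ifs <;> norm_num
  · intro i j k hk
    refine wt_of_repr ?_ hk
    obtain ⟨v, hv, hv'⟩ := basis_mem_weight i
    obtain ⟨w, hw, hw'⟩ := basis_mem_weight j
    rw [← hv', ← hw']
    exact ⟨_, qBr_supported hv hw, (algBr_mk v w).symm⟩
  · refine hext _ _ (fun i j h => absurd h (lt_irrefl _)) ?_
    rintro (k | k)
    · exact ⟨root_neg, lt_of_root_neg⟩
    · exact ⟨fun ⟨i, hi⟩ => absurd hi (lt_irrefl _), fun h => absurd h (lt_irrefl _)⟩
  · refine hext _ _ (fun i j h => rfl) ?_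
    rintro (k | k)
    · exact ⟨fun h => absurd h k.1.2, fun h => absurd (root_eq_zero h) k.1.2⟩
    · exact ⟨fun _ => rfl, fun _ => ⟨⟨0, hn2⟩, rfl⟩⟩
  · refine hext _ _ (fun i j h => absurd h (lt_irrefl _)) ?_
    rintro (k | k)
    · exact ⟨root_pos, lt_of_root_pos⟩
    · exact ⟨fun ⟨i, hi⟩ => absurd hi (lt_irrefl _), fun h => absurd h (lt_irrefl _)⟩
  · intro α
    refine hext _ _ (fun i j h => absurd h.1 (lt_irrefl _)) ?_
    rintro (k | k)
    · exact ⟨fun h => ⟨root_pos h.1, h.2⟩, fun h => ⟨lt_of_root_pos h.1, h.2⟩⟩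
    · exact ⟨fun ⟨i, hi⟩ => absurd hi.1 (lt_irrefl _), fun h => absurd h.1 (lt_irrefl _)⟩
  · rintro (⟨⟨⟨i, j⟩, hij⟩, p⟩ | k) he
    · have h0 := mk_br_rootVec_ne_zero (t := t) hn hij p
      set y := LieSuperalgebra.br (rootVec (t := t) (⟨(j, i), Ne.symm hij⟩, p))
        (rootVec (⟨(i, j), hij⟩, p)) with hy
      -- Any letter occurring in the bracket will do: it has weight zero and is even by homogeneity.
      obtain ⟨a, ha⟩ : ∃ a, (basis t n).repr y a ≠ 0 := by
        by_contra hall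
        push Not at hall
        exact h0 ((basis t n).repr.map_eq_zero_iff.1 (Finsupp.ext hall))
      refine ⟨Sum.inl (⟨(j, i), Ne.symm hij⟩, p), a, ?_, rfl, ?_, ?_, ?_⟩
      · funext k; simp [idxWt, root]
      · refine wt_of_repr ?_ ha
        have h1 := qBr_supported (unit_mem_supported (P := fun k l => root k l = root j i) rfl p)
          (unit_mem_supported (P := fun k l => root k l = root i j) rfl p)
        rw [root_add, root_self] at h1
        exact ⟨_, h1, rfl⟩
      · refine par_of_repr idx_homog ?_ ha
        have h1 := qBr_mem (unit_mem_qPart j i p) (unit_mem_qPart i j p)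
        rw [CharTwo.add_self_eq_zero] at h1
        exact ⟨_, h1, rfl⟩
      · rw [basis_apply, basis_apply]
        exact ha
    · exact absurd he (lt_irrefl _)
  · rintro (⟨⟨⟨i, j⟩, hij⟩, p⟩ | k) (⟨⟨⟨i', j'⟩, hij'⟩, p'⟩ | k') h hw hp
    · have h1 : root i j = root i' j' := hw
      have h2 : 0 < root i j := h
      obtain ⟨rfl, rfl⟩ := root_injective (lt_of_root_pos h2) (lt_of_root_pos (h1 ▸ h2)) h1
      have h3 : p = p' := hp
      subst h3
      rfl
    · exact absurd (root_eq_zero hw) hij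
    · exact absurd h (lt_irrefl _)
    · exact absurd h (lt_irrefl _)
  -- The entries are chosen so that the `i`-th minus the `j`-th is the height of `root i j`.
  · let d : Q n := (Matrix.diagonal fun i => ∑ k : Fin (n - 1), if i.val ≤ k.val then 1 else 0, 0)
    have hd : d ∈ t.sub n := mem_sub_of_trace (by simp [d])
    have hbr : ∀ v : Q n, ∀ α, v ∈ supported (fun i j => root i j = α) →
        qBr n d v = (height α : ℂ) • v := by
      intro v α hv
      have hv' : ∀ i j, ¬ root i j = α → v.1 i j = 0 ∧ v.2 i j = 0 := hv
      have key : ∀ A : Matrix (Fin n) (Fin n) ℂ, (∀ i j, ¬ root i j = α → A i j = 0) →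
          d.1 * A - A * d.1 = (height α : ℂ) • A := by
        intro A hA
        ext i j
        by_cases hij : root i j = α
        · subst hij
          simp only [d, Matrix.sub_apply, Matrix.diagonal_mul, Matrix.mul_diagonal,
            Matrix.smul_apply, smul_eq_mul, height, root]
          push_cast
          rw [Finset.sum_sub_distrib]
          ring
        · simp [d, Matrix.diagonal_mul, Matrix.mul_diagonal, hA i j hij]
      refine Prod.ext ?_ ?_
      · have := key v.1 fun i j h => (hv' i j h).1
        simpa [qBr_apply, d] using this
      · have := key v.2 fun i j h => (hv' i j h).2
        simpa [qBr_apply, d] using this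
    refine ⟨Alg.mk t n ⟨d, hd⟩, ⟨_, mem_qPart_zero.2 rfl, rfl⟩, ⟨_, ?_, rfl⟩, fun i => ?_⟩
    · intro i j hij
      have : i ≠ j := by rintro rfl; exact hij (root_self i)
      simp [d, this]
    · obtain ⟨v, hv, hv'⟩ := basis_mem_weight i
      rw [← hv', ← map_smul]
      change Alg.mk t n ⟨qBr n d v, _⟩ = _
      congr 1
      ext1
      exact hbr _ _ hv

end Concrete

end QType

namespace QType

/-! ### Subspaces of the enveloping algebra spanned by words -/

section WordsOf

variable {L : Type*} [AddCommGroup L] [Module ℂ L] [LieSuperalgebra L]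
  {I : Type*} (b : Module.Basis I ℂ L)

/-- The span of the words that satisfy `W`. -/
def wordsOf (W : List I → Prop) : Submodule ℂ (Env L) := Submodule.span ℂ (word b '' {l | W l})

variable {b}

theorem word_mem_wordsOf {W : List I → Prop} {l : List I} (h : W l) : word b l ∈ wordsOf b W :=
  Submodule.subset_span ⟨l, h, rfl⟩

theorem wordsOf_le {W : List I → Prop} {N : Submodule ℂ (Env L)} (h : ∀ l, W l → word b l ∈ N) :
    wordsOf b W ≤ N := by
  refine Submodule.span_le.2 ?_
  rintro _ ⟨l, hl, rfl⟩
  exact h l hl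

theorem wordsOf_mono {W W' : List I → Prop} (h : ∀ l, W l → W' l) :
    wordsOf b W ≤ wordsOf b W' := wordsOf_le fun l hl => word_mem_wordsOf (h l hl)

theorem mul_mem_wordsOf {W W' W'' : List I → Prop} (h : ∀ l m, W l → W' m → W'' (l ++ m))
    {u v : Env L} (hu : u ∈ wordsOf b W) (hv : v ∈ wordsOf b W') : u * v ∈ wordsOf b W'' := by
  have := Submodule.mul_mem_mul hu hv
  unfold wordsOf at this
  rw [Submodule.span_mul_span] at this
  refine Submodule.span_mono ?_ this
  rintro _ ⟨_, ⟨l, hl, rfl⟩, _, ⟨l', hl', rfl⟩, rfl⟩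
  exact ⟨l ++ l', h _ _ hl hl', word_append b l l'⟩

theorem ι_mem_wordsOf {S : Set I} {x : L} (hx : x ∈ Submodule.span ℂ (b '' S))
    {W : List I → Prop} (h : ∀ i ∈ S, W [i]) : Env.ι x ∈ wordsOf b W := by
  refine (Submodule.span_le (p := (wordsOf b W).comap Env.ι)).2 ?_ hx
  rintro _ ⟨i, hi, rfl⟩
  have := word_mem_wordsOf (b := b) (h i hi)
  rwa [word_cons, word_nil, mul_one] at this

theorem adjoin_eq_wordsOf {S : I → Prop} {N : Submodule ℂ L}
    (hN : N = Submodule.span ℂ (b '' {i | S i})) :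
    Subalgebra.toSubmodule (Algebra.adjoin ℂ (Env.ι '' (N : Set L)))
      = wordsOf b fun l => ∀ i ∈ l, S i := by
  refine le_antisymm ?_ (wordsOf_le fun l hl => ?_)
  · intro u hu
    have hu' : u ∈ Algebra.adjoin ℂ (Env.ι '' (N : Set L)) := hu
    clear hu
    induction hu' using Algebra.adjoin_induction with
    | mem u hu =>
      obtain ⟨x, hx, rfl⟩ := hu
      have hx' : x ∈ N := hx
      rw [hN] at hx'
      exact ι_mem_wordsOf hx' fun i hi j hj => by rwa [List.mem_singleton.1 hj]
    | algebraMap r =>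
      rw [Algebra.algebraMap_eq_smul_one]
      exact Submodule.smul_mem _ _ (word_mem_wordsOf (l := []) (by simp))
    | add _ _ _ _ h1 h2 => exact Submodule.add_mem _ h1 h2
    | mul _ _ _ _ h1 h2 =>
      refine mul_mem_wordsOf (fun l m hl hm i hi => ?_) h1 h2
      exact (List.mem_append.1 hi).elim (hl i) (hm i)
  · refine Subalgebra.list_prod_mem _ fun u hu => ?_
    obtain ⟨i, hi, rfl⟩ := List.mem_map.1 hu
    refine Algebra.subset_adjoin ⟨b i, ?_, rfl⟩
    rw [hN]
    exact Submodule.subset_span ⟨i, hl i hi, rfl⟩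

theorem gradedSpan_eq_wordsOf {G : Type*} [AddMonoid G] {P : G → Submodule ℂ L} {S : I → Prop}
    {deg : I → G} (hP : ∀ g, P g = Submodule.span ℂ (b '' {i | S i ∧ deg i = g})) (g : G) :
    gradedSpan P g = wordsOf b fun l => (∀ i ∈ l, S i) ∧ (l.map deg).sum = g := by
  refine le_antisymm (Submodule.span_le.2 ?_) (wordsOf_le ?_)
  · rintro _ ⟨l, hl, rfl, rfl⟩
    induction l with
    | nil => exact word_mem_wordsOf (l := []) (by simp)
    | cons a l ih =>
      have ha := hl a List.mem_cons_self
      rw [hP] at ha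
      have h1 := ι_mem_wordsOf (W := fun l => (∀ i ∈ l, S i) ∧ (l.map deg).sum = a.1) ha
        fun i hi => ⟨fun j hj => by rw [List.mem_singleton.1 hj]; exact hi.1, by simpa using hi.2⟩
      have h2 := ih fun c hc => hl c (List.mem_cons_of_mem _ hc)
      simp only [List.map_cons, List.prod_cons, List.sum_cons]
      refine mul_mem_wordsOf (fun p q hp hq => ⟨fun i hi => ?_, ?_⟩) h1 h2
      · exact (List.mem_append.1 hi).elim (hp.1 i) (hq.1 i)
      · rw [List.map_append, List.sum_append, hp.2, hq.2]
  · rintro l ⟨hl, rfl⟩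
    refine Submodule.subset_span ⟨l.map fun i => (deg i, b i), ?_, ?_, ?_⟩
    · intro a ha
      obtain ⟨i, hi, rfl⟩ := List.mem_map.1 ha
      rw [hP]
      exact Submodule.subset_span ⟨i, ⟨hl i hi, rfl⟩, rfl⟩
    · rw [List.map_map]; rfl
    · rw [List.map_map]; rfl

/-- The shift by one comes from the strict inequality in `wordSpan`, whose member with index `0` is
the zero space; this lets degree `-∞` be treated like any other. -/
theorem wordSpan_one_le_filt (k : ℕ) : wordSpan b (fun _ => True) (k + 1) = Env.filt (L := L) k := by
  have hone : (1 : Submodule ℂ (Env L)) ≤ 1 ⊔ LinearMap.range (Env.ι (L := L)) := le_sup_left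
  refine le_antisymm (Submodule.span_le.2 ?_) ?_
  · rintro _ ⟨l, ⟨-, hl⟩, rfl⟩
    have h1 : word b l ∈ Env.filt (L := L) l.length := by
      clear hl
      induction l with
      | nil => exact Submodule.one_le.1 le_rfl
      | cons i l ih =>
        rw [Env.filt, List.length_cons, pow_succ', word_cons]
        exact Submodule.mul_mem_mul (Submodule.mem_sup_right ⟨_, rfl⟩) ih
    have h2 : Env.filt (L := L) l.length ≤ Env.filt k :=
      pow_le_pow_right' hone (Nat.lt_succ_iff.1 hl)
    exact h2 h1
  · induction k with
    | zero =>
      rw [Env.filt, pow_zero, Submodule.one_le]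
      exact word_mem_wordSpan (l := []) trivial (by simp)
    | succ k ih =>
      rw [Env.filt, pow_succ', Submodule.mul_le]
      intro u hu v hv
      obtain ⟨c, hc, y, ⟨x, rfl⟩, rfl⟩ := Submodule.mem_sup.1 hu
      obtain ⟨r, rfl⟩ := Submodule.mem_one.1 hc
      rw [add_mul]
      refine Submodule.add_mem _ ?_ (ι_mul_mem_wordSpan _ (ih hv))
      rw [← Algebra.smul_def]
      exact Submodule.smul_mem _ _ (wordSpan_mono (fun _ h => h) (Nat.le_succ _) (ih hv))

theorem part_eq_span {par : I → ZMod 2} (hb : Homogeneous b par) (p : ZMod 2) :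
    LieSuperalgebra.part (L := L) p = Submodule.span ℂ (b '' {i | True ∧ par i = p}) := by
  refine le_antisymm (fun x hx => ?_) (Submodule.span_le.2 ?_)
  · rw [Module.Basis.mem_span_image]
    intro i hi
    exact ⟨trivial, par_of_repr hb hx (Finsupp.mem_support_iff.1 hi)⟩
  · rintro _ ⟨i, ⟨-, rfl⟩, rfl⟩
    exact hb i

variable [LinearOrder I]

theorem wordsOf_good {par : I → ZMod 2} (hb : Homogeneous b par) {W : List I → Prop}
    (hW : Stable b W) : wordsOf b W = wordsOf b fun l => W l ∧ Good par l := by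
  refine le_antisymm (wordsOf_le fun l hl => ?_) (wordsOf_mono fun _ h => h.1)
  have h := word_mem_wordSpan (b := b) hl (Nat.lt_succ_self _)
  rw [wordSpan_good hb hW] at h
  refine Submodule.span_mono ?_ h
  rintro _ ⟨m, ⟨hm, -⟩, rfl⟩
  exact ⟨m, hm, rfl⟩

end WordsOf

/-! ### Subspaces of `U(g)` in terms of PBW coordinates. -/

namespace TriBasis

variable {t : Kind} {n : ℕ} {I : Type} [LinearOrder I] (T : TriBasis t n I)

/-- The Poincaré-Birkhoff-Witt basis of `U(g)`. -/
def B : Module.Basis {l : List I // Good T.par l} ℂ (U t n) := T.vac.pbw T.homog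

theorem B_apply (l) : T.B l = word T.b l.1 := T.vac.pbw_apply T.homog l

theorem mem_wordsOf_good {p : List I → Prop} {u : U t n} :
    u ∈ wordsOf T.b (fun l => p l ∧ Good T.par l) ↔ ∀ l, T.B.repr u l ≠ 0 → p l.1 := by
  have : word T.b '' {l | p l ∧ Good T.par l} = T.B '' {l | p l.1} := by
    ext u
    constructor
    · rintro ⟨l, hl, rfl⟩
      exact ⟨⟨l, hl.2⟩, hl.1, T.B_apply _⟩
    · rintro ⟨l, hl, rfl⟩
      exact ⟨l.1, ⟨hl, l.2⟩, (T.B_apply l).symm⟩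
  rw [wordsOf, this, Module.Basis.mem_span_image]
  exact ⟨fun h l hl => h (Finsupp.mem_support_iff.2 hl),
    fun h l hl => h l (Finsupp.mem_support_iff.1 hl)⟩

theorem par_br {i j k : I} (h : T.b.repr (LieSuperalgebra.br (T.b i) (T.b j)) k ≠ 0) :
    T.par k = T.par i + T.par j :=
  par_of_repr T.homog (LieSuperalgebra.br_mem (T.homog i) (T.homog j)) h

/-- Brackets add weights and parities, so rewriting preserves the total weight and total parity of a
word. The closure condition on `S` takes care of the letters that brackets create. -/
theorem stable {S : I → Prop} (hS : ∀ i j k, S i → S j → T.wt k = T.wt i + T.wt j → S k)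
    (R : RootLattice n → ZMod 2 → Prop) :
    Stable T.b fun l => (∀ i ∈ l, S i) ∧ R (l.map T.wt).sum (l.map T.par).sum where
  swap := by
    rintro p i j s ⟨h1, h2⟩
    have hp : (p ++ j :: i :: s).Perm (p ++ i :: j :: s) := (List.Perm.swap i j s).append_left p
    refine ⟨fun k hk => h1 k (hp.mem_iff.1 hk), ?_⟩
    rwa [(hp.map _).sum_eq, (hp.map _).sum_eq]
  br := by
    rintro p i j k s ⟨h1, h2⟩ hk
    refine ⟨fun m hm => ?_, ?_⟩
    · rcases List.mem_append.1 hm with hm | hm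
      · exact h1 m (List.mem_append_left _ hm)
      · rcases List.mem_cons.1 hm with rfl | hm
        · exact hS i j m (h1 _ (by simp)) (h1 _ (by simp)) (T.wt_br i j m hk)
        · exact h1 m (by simp [hm])
    · convert h2 using 1 <;> simp [T.wt_br i j k hk, T.par_br hk, add_assoc]

theorem stable_nonpos : Stable T.b fun l => ∀ i ∈ l, ¬ 0 < T.wt i := by
  have := T.stable (S := fun i => ¬ 0 < T.wt i) (fun i j k hi hj hk => ?_) fun _ _ => True
  · simpa using this
  · have h : ∀ i, ¬ 0 < T.wt i → T.wt i ≤ 0 := fun i hi => by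
      rcases T.trichotomy i with h | h | h
      · exact h.le
      · exact h.le
      · exact absurd h hi
    rw [hk]
    exact not_lt_of_ge (add_nonpos (h i hi) (h j hj))

theorem stable_pos (ν : RootLattice n) :
    Stable T.b fun l => (∀ i ∈ l, 0 < T.wt i) ∧ (l.map T.wt).sum = ν :=
  T.stable (S := fun i => 0 < T.wt i) (fun i j k hi hj hk => by rw [hk]; exact add_pos hi hj)
    fun ν' _ => ν' = ν

theorem stable_zero : Stable T.b fun l => ∀ i ∈ l, T.wt i = 0 := by
  have := T.stable (S := fun i => T.wt i = 0) (fun i j k hi hj hk => by rw [hk, hi, hj, add_zero])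
    fun _ _ => True
  simpa using this

theorem stable_parity (p : ZMod 2) : Stable T.b fun l => (l.map T.par).sum = p := by
  have := T.stable (S := fun _ => True) (fun i j k _ _ _ => trivial) fun _ q => q = p
  simpa using this

/-- The weight of the `n⁺`-part of a word. -/
def posWt (l : List I) : RootLattice n :=
  open Classical in ((l.filter fun i => 0 < T.wt i).map T.wt).sum

theorem posWt_append (l m : List I) : T.posWt (l ++ m) = T.posWt l + T.posWt m := by
  simp [posWt]

theorem posWt_of_nonpos {l : List I} (h : ∀ i ∈ l, ¬ 0 < T.wt i) : T.posWt l = 0 := by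
  classical
  rw [posWt, List.filter_eq_nil_iff.2 (by simpa using h)]
  rfl

theorem posWt_of_pos {l : List I} (h : ∀ i ∈ l, 0 < T.wt i) : T.posWt l = (l.map T.wt).sum := by
  classical
  rw [posWt, List.filter_eq_self.2 (by simpa using h)]

theorem posWt_nonneg (l : List I) : 0 ≤ T.posWt l := by
  classical
  refine List.sum_nonneg fun x hx => ?_
  obtain ⟨i, hi, rfl⟩ := List.mem_map.1 hx
  exact (of_decide_eq_true (List.mem_filter.1 hi).2).le

theorem good_append {l m : List I} (hl : Good T.par l) (hm : Good T.par m)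
    (hl' : ∀ i ∈ l, ¬ 0 < T.wt i) (hm' : ∀ i ∈ m, 0 < T.wt i) : Good T.par (l ++ m) := by
  refine ⟨List.pairwise_append.2 ⟨hl.1, hm.1, fun i hi j hj =>
    (T.lt_of_pos i j (hl' i hi) (hm' j hj)).le⟩, fun i hi => ?_⟩
  rw [List.count_append]
  by_cases h : 0 < T.wt i
  · rw [List.count_eq_zero_of_not_mem fun h' => hl' i h' h, zero_add]
    exact hm.2 i hi
  · rw [List.count_eq_zero_of_not_mem fun h' => h (hm' i h'), add_zero]
    exact hl.2 i hi

theorem exists_split {l : List I} (hl : Good T.par l) : ∃ l1 l2, l = l1 ++ l2 ∧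
    Good T.par l1 ∧ Good T.par l2 ∧ (∀ i ∈ l1, ¬ 0 < T.wt i) ∧ ∀ i ∈ l2, 0 < T.wt i := by
  classical
  have h1 : Good T.par (l.filter fun i => ¬ 0 < T.wt i) := hl.sublist List.filter_sublist
  have h2 : Good T.par (l.filter fun i => 0 < T.wt i) := hl.sublist List.filter_sublist
  have h3 : ∀ i ∈ l.filter fun i => ¬ 0 < T.wt i, ¬ 0 < T.wt i :=
    fun i hi => by simpa using (List.mem_filter.1 hi).2
  have h4 : ∀ i ∈ l.filter fun i => 0 < T.wt i, 0 < T.wt i :=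
    fun i hi => by simpa using (List.mem_filter.1 hi).2
  refine ⟨_, _, ?_, h1, h2, h3, h4⟩
  refine hl.eq_of_perm (T.good_append h1 h2 h3 h4) ?_
  have := List.filter_append_perm (fun i => decide (0 < T.wt i)) l
  refine this.symm.trans (List.perm_append_comm.trans ?_)
  simp

theorem UBMinus_eq : Subalgebra.toSubmodule (UBMinus t n)
    = wordsOf T.b fun l => ∀ i ∈ l, ¬ 0 < T.wt i := by
  refine adjoin_eq_wordsOf ?_
  rw [bMinus, T.nMinus_eq, T.cartan_eq, ← Submodule.span_union, ← Set.image_union]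
  congr 2
  ext i
  simp only [Set.mem_union, Set.mem_ofPred_eq]
  rcases T.trichotomy i with h | h | h
  · exact ⟨fun _ => not_lt_of_gt h, fun _ => Or.inl h⟩
  · exact ⟨fun _ => by rw [h]; exact lt_irrefl _, fun _ => Or.inr h⟩
  · exact ⟨fun h' => h'.elim (fun h' => absurd h (not_lt_of_gt h')) fun h' => absurd h'.symm h.ne,
      fun h' => absurd h h'⟩

theorem UCartan_eq : Subalgebra.toSubmodule (UCartan t n)
    = wordsOf T.b fun l => ∀ i ∈ l, T.wt i = 0 := adjoin_eq_wordsOf T.cartan_eq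

theorem UNPlus_eq (ν : RootLattice n) : UNPlus t n ν
    = wordsOf T.b fun l => (∀ i ∈ l, 0 < T.wt i) ∧ (l.map T.wt).sum = ν :=
  gradedSpan_eq_wordsOf T.nPlusRoot_eq ν

theorem mem_UCartan_iff {u : U t n} :
    u ∈ UCartan t n ↔ ∀ l, T.B.repr u l ≠ 0 → ∀ i ∈ l.1, T.wt i = 0 := by
  rw [← Subalgebra.mem_toSubmodule, T.UCartan_eq, wordsOf_good T.homog T.stable_zero,
    T.mem_wordsOf_good]

theorem mem_UBMinus_iff {u : U t n} :
    u ∈ UBMinus t n ↔ ∀ l, T.B.repr u l ≠ 0 → ∀ i ∈ l.1, ¬ 0 < T.wt i := by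
  rw [← Subalgebra.mem_toSubmodule, T.UBMinus_eq, wordsOf_good T.homog T.stable_nonpos,
    T.mem_wordsOf_good]

theorem mem_part_iff {p : ZMod 2} {u : U t n} :
    u ∈ Env.part (L := Alg t n) p ↔ ∀ l, T.B.repr u l ≠ 0 → (l.1.map T.par).sum = p := by
  rw [Env.part, gradedSpan_eq_wordsOf (part_eq_span T.homog)]
  have : (fun l : List I => (∀ i ∈ l, True) ∧ (l.map T.par).sum = p)
      = fun l => (l.map T.par).sum = p := by simp
  rw [this, wordsOf_good T.homog (T.stable_parity p), T.mem_wordsOf_good]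

theorem mem_wordSpan_iff {k : ℕ} {u : U t n} :
    u ∈ wordSpan T.b (fun _ => True) k ↔ ∀ l, T.B.repr u l ≠ 0 → l.1.length < k := by
  rw [wordSpan_good T.homog stable_true, ← T.mem_wordsOf_good (p := fun l => l.length < k)]
  have : {l : List I | (True ∧ Good T.par l) ∧ l.length < k}
      = {l | l.length < k ∧ Good T.par l} := by ext; simp [and_comm]
  rw [wordSpan, this]; rfl

theorem mem_filt_iff {k : ℕ} {u : U t n} :
    u ∈ Env.filt (L := Alg t n) k ↔ ∀ l, T.B.repr u l ≠ 0 → l.1.length < k + 1 := by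
  rw [← wordSpan_one_le_filt (b := T.b), T.mem_wordSpan_iff]

/-- After straightening both factors separately, their concatenation is already good, since the
letters of `n⁺` are the largest. -/
theorem JPrime_eq (ν : RootLattice n) :
    JPrime t n ν = wordsOf T.b fun l => T.posWt l = ν ∧ Good T.par l := by
  rw [JPrime, T.UBMinus_eq, T.UNPlus_eq, wordsOf_good T.homog T.stable_nonpos,
    wordsOf_good T.homog (T.stable_pos ν)]
  refine le_antisymm (Submodule.mul_le.2 fun u hu v hv => ?_) (wordsOf_le ?_)
  · refine mul_mem_wordsOf (fun l m hl hm => ⟨?_, ?_⟩) hu hv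
    · rw [posWt_append, T.posWt_of_nonpos hl.1, T.posWt_of_pos hm.1.1, zero_add, hm.1.2]
    · exact T.good_append hl.2 hm.2 hl.1 hm.1.1
  · rintro l ⟨rfl, hl⟩
    obtain ⟨l1, l2, rfl, g1, g2, h1, h2⟩ := T.exists_split hl
    rw [word_append]
    refine Submodule.mul_mem_mul (word_mem_wordsOf ⟨h1, g1⟩) (word_mem_wordsOf ⟨⟨h2, ?_⟩, g2⟩)
    rw [posWt_append, T.posWt_of_nonpos h1, T.posWt_of_pos h2, zero_add]

theorem mem_JPrime_iff {ν : RootLattice n} {u : U t n} :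
    u ∈ JPrime t n ν ↔ ∀ l, T.B.repr u l ≠ 0 → T.posWt l.1 = ν := by
  rw [T.JPrime_eq, T.mem_wordsOf_good]

theorem UNPlus_mul (T : TriBasis t n I) {ν μ : RootLattice n} {u v : U t n} (hu : u ∈ UNPlus t n ν)
    (hv : v ∈ UNPlus t n μ) : u * v ∈ UNPlus t n (ν + μ) := by
  rw [T.UNPlus_eq] at hu hv ⊢
  refine mul_mem_wordsOf (fun l m hl hm => ⟨fun i hi => ?_, ?_⟩) hu hv
  · exact (List.mem_append.1 hi).elim (hl.1 i) (hm.1 i)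
  · rw [List.map_append, List.sum_append, hl.2, hm.2]

/-- Write the words of `u` as a `b⁻`-word followed by an `n⁺`-word. The latter multiplies `v` inside
the graded algebra `U(n⁺)`, so the `n⁺`-weight can only grow. -/
theorem mul_UNPlus_mem (u : U t n) {ν : RootLattice n} {v : U t n} (hv : v ∈ UNPlus t n ν) :
    u * v ∈ wordsOf T.b fun l => ν ≤ T.posWt l ∧ Good T.par l := by
  have hu := T.B.mem_span u
  induction hu using Submodule.span_induction with
  | zero => rw [zero_mul]; exact Submodule.zero_mem _
  | mem u hu =>
    obtain ⟨l, rfl⟩ := hu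
    obtain ⟨l1, l2, h, g1, g2, h1, h2⟩ := T.exists_split l.2
    rw [T.B_apply, h, word_append, mul_assoc]
    have h3 : word T.b l2 ∈ UNPlus t n (l2.map T.wt).sum := by
      rw [T.UNPlus_eq]; exact word_mem_wordsOf ⟨h2, rfl⟩
    have h4 : word T.b l1 ∈ Subalgebra.toSubmodule (UBMinus t n) := by
      rw [T.UBMinus_eq]; exact word_mem_wordsOf h1
    have h5 : word T.b l1 * (word T.b l2 * v) ∈ JPrime t n ((l2.map T.wt).sum + ν) :=
      Submodule.mul_mem_mul h4 (T.UNPlus_mul h3 hv)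
    rw [T.JPrime_eq] at h5
    refine wordsOf_mono ?_ h5
    rintro m ⟨hm, g⟩
    refine ⟨?_, g⟩
    rw [hm]
    refine le_add_of_nonneg_left ?_
    rw [← T.posWt_of_pos h2]
    exact T.posWt_nonneg _
  | add _ _ _ _ h1 h2 => rw [add_mul]; exact Submodule.add_mem _ h1 h2
  | smul c _ _ h => rw [smul_mul_assoc]; exact Submodule.smul_mem _ _ h

theorem word_mem_J (κ : Comparison) {l : List I} (hl : Good T.par l) :
    word T.b l ∈ J κ t n (T.posWt l) := by
  obtain ⟨l1, l2, rfl, -, -, h1, h2⟩ := T.exists_split hl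
  rw [word_append]
  refine Ideal.mul_mem_left _ _ (Ideal.subset_span ⟨_, Comparison.le_refl _, ?_⟩)
  rw [T.UNPlus_eq, posWt_append, T.posWt_of_nonpos h1, T.posWt_of_pos h2, zero_add]
  exact word_mem_wordsOf ⟨h2, rfl⟩

theorem mem_J_iff {κ : Comparison} {ξ : RootLattice n} {u : U t n} :
    u ∈ J κ t n ξ ↔ ∀ l, T.B.repr u l ≠ 0 → κ.le ξ (T.posWt l.1) := by
  rw [← T.mem_wordsOf_good (p := fun l => κ.le ξ (T.posWt l))]
  constructor
  · intro hu
    -- All left multiples are treated at once, because the induction runs over a span with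
    -- coefficients in `U(g)`.
    have : ∀ a : U t n, a * u ∈ wordsOf T.b fun l => κ.le ξ (T.posWt l) ∧ Good T.par l := by
      unfold J Ideal.span at hu
      induction hu using Submodule.span_induction with
      | mem u hu =>
        obtain ⟨μ, hμ, hu⟩ := hu
        intro a
        refine wordsOf_mono ?_ (T.mul_UNPlus_mem a hu)
        rintro l ⟨h, g⟩
        exact ⟨Comparison.le_trans hμ (Comparison.le_of_le h), g⟩
      | zero => intro a; rw [mul_zero]; exact Submodule.zero_mem _
      | add _ _ _ _ h1 h2 => intro a; rw [mul_add]; exact Submodule.add_mem _ (h1 a) (h2 a)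
      | smul c _ _ h => intro a; rw [smul_eq_mul, ← mul_assoc]; exact h _
    simpa using this 1
  · intro hu
    unfold wordsOf at hu
    induction hu using Submodule.span_induction with
    | mem u hu =>
      obtain ⟨l, ⟨h, g⟩, rfl⟩ := hu
      exact J_anti h (T.word_mem_J κ g)
    | zero => exact Submodule.zero_mem _
    | add _ _ _ _ h1 h2 => exact Submodule.add_mem _ h1 h2
    | smul c _ _ h => exact smul_mem_J _ h

end TriBasis

end QType

namespace QType

/-! ### Commutators with negative root vectors -/

section Twisted

variable {L : Type*} [AddCommGroup L] [Module ℂ L] [LieSuperalgebra L]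
  {I : Type*} (b : Module.Basis I ℂ L) (par : I → ZMod 2)

/-- The super derivation of parity `q` that replaces a letter `x` by `g x`, on words. -/
def twisted (q : ZMod 2) (g : I → L) : List I → Env L
  | [] => 0
  | x :: l => Env.ι (g x) * word b l + sgn q (par x) • (Env.ι (b x) * twisted q g l)

variable {b par}

theorem sgn_add (i j k : ZMod 2) : sgn i (j + k) = sgn i j * sgn i k := by
  have h2 : (1 : ZMod 2) + 1 = 0 := by decide
  obtain rfl | rfl := zmod2_cases i <;> obtain rfl | rfl := zmod2_cases j <;>
    obtain rfl | rfl := zmod2_cases k <;> simp [sgn, h2]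

theorem twisted_add (q : ZMod 2) (g h : I → L) (l : List I) :
    twisted b par q (fun x => g x + h x) l = twisted b par q g l + twisted b par q h l := by
  induction l with
  | nil => simp [twisted]
  | cons x l ih =>
    simp only [twisted, ih, map_add, add_mul, mul_add, smul_add]
    abel

theorem commutator_word (hb : Homogeneous b par) (f : I) (l : List I) :
    Env.ι (b f) * word b l - sgn (par f) (l.map par).sum • (word b l * Env.ι (b f))
      = twisted b par (par f) (fun x => LieSuperalgebra.br (b f) (b x)) l := by
  induction l with
  | nil => simp [twisted, sgn]
  | cons x l ih =>
    rw [twisted, ← ih, List.map_cons, List.sum_cons, sgn_add, word_cons, ← mul_assoc,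
      Env.ι_mul_ι (hb f) (hb x)]
    simp only [add_mul, mul_sub, smul_sub, smul_mul_assoc, mul_smul_comm, mul_assoc, smul_smul]
    abel

/-- The prefix `p` collects the letters already passed; `twisted_mem` is the case of the empty
prefix. -/
theorem word_mul_twisted_mem {N : Submodule ℂ (Env L)} (q : ZMod 2) (g : I → L) (l : List I) :
    ∀ p : List I, (∀ l1 x l2 y, l = l1 ++ x :: l2 → b.repr (g x) y ≠ 0 →
      word b (p ++ (l1 ++ y :: l2)) ∈ N) → word b p * twisted b par q g l ∈ N := by
  induction l with
  | nil => intro p _; simp [twisted]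
  | cons x l ih =>
    intro p h
    rw [twisted, mul_add, mul_smul_comm, ← mul_assoc, ← mul_assoc]
    refine Submodule.add_mem _ (word_mul_ι_mul_word_mem p l _ fun y hy => ?_)
      (Submodule.smul_mem _ _ ?_)
    · simpa using h [] x l y rfl hy
    · have := ih (p ++ [x]) fun l1 x' l2 y hl hy => by
        simpa using h (x :: l1) x' l2 y (by rw [hl]; rfl) hy
      rwa [word_append, word_cons, word_nil, mul_one] at this

theorem twisted_mem {N : Submodule ℂ (Env L)} {q : ZMod 2} {g : I → L} {l : List I}
    (h : ∀ l1 x l2 y, l = l1 ++ x :: l2 → b.repr (g x) y ≠ 0 → word b (l1 ++ y :: l2) ∈ N) :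
    twisted b par q g l ∈ N := by
  simpa using word_mul_twisted_mem (N := N) (par := par) q g l [] h

variable [LinearOrder I]

/-- Replacing the letter `e` by an even letter `a`, modulo shorter words. -/
theorem twisted_single (hb : Homogeneous b par) {e a : I} (ha : par a = 0) (c : ℂ) (l : List I) :
    twisted b par (par e) (fun x => if x = e then c • b a else 0) l
      - c • (Env.ι (b a) * contract b par e l) ∈ wordSpan b (fun _ => True) l.length := by
  have hc : ∀ l, contract b par e l ∈ wordSpan b (fun _ => True) l.length := by
    intro l
    induction l with
    | nil => exact Submodule.zero_mem _
    | cons x l ih =>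
      refine Submodule.add_mem _ ?_ (Submodule.smul_mem _ _ (ι_mul_mem_wordSpan _ ih))
      split_ifs
      · exact word_mem_wordSpan trivial (by simp)
      · exact Submodule.zero_mem _
  induction l with
  | nil => simp [twisted, contract]
  | cons x l ih =>
    have e1 : Env.ι (b x) * Env.ι (b a)
        = Env.ι (b a) * Env.ι (b x) + Env.ι (LieSuperalgebra.br (b x) (b a)) := by
      have := Env.ι_mul_ι (hb x) (hb a)
      rwa [ha, show sgn (par x) 0 = 1 by simp [sgn], one_smul] at this
    -- Moving the even letter `a` to the front past `b x` costs only the bracket `[x, a]`, and this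
    -- multiplies a contraction, which is one letter shorter.
    have e2 : twisted b par (par e) (fun x => if x = e then c • b a else 0) (x :: l)
        - c • (Env.ι (b a) * contract b par e (x :: l))
        = sgn (par e) (par x) • (Env.ι (b x) *
            (twisted b par (par e) (fun x => if x = e then c • b a else 0) l
              - c • (Env.ι (b a) * contract b par e l)))
          + (sgn (par e) (par x) * c) • (Env.ι (LieSuperalgebra.br (b x) (b a))
              * contract b par e l) := by
      have e3 : Env.ι (if x = e then c • b a else 0) * word b l
          = c • (Env.ι (b a) * if e = x then word b l else 0) := by
        by_cases h : x = e
        · subst h; simp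
        · simp [h, Ne.symm h]
      have e4 : Env.ι (b x) * (Env.ι (b a) * contract b par e l)
          = Env.ι (b a) * (Env.ι (b x) * contract b par e l)
            + Env.ι (LieSuperalgebra.br (b x) (b a)) * contract b par e l := by
        rw [← mul_assoc, e1, add_mul, mul_assoc]
      simp only [twisted, contract, e3, mul_add, mul_sub, mul_smul_comm, e4, smul_add, smul_sub,
        smul_smul]
      rw [mul_comm c]
      abel
    rw [e2]
    exact Submodule.add_mem _ (Submodule.smul_mem _ _ (ι_mul_mem_wordSpan _ ih))
      (Submodule.smul_mem _ _ (ι_mul_mem_wordSpan _ (hc l)))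

end Twisted

/-! ### Leading terms of commutators and the extremal word argument. -/

namespace TriBasis

variable {t : Kind} {n : ℕ} {I : Type} [LinearOrder I] (T : TriBasis t n I)

theorem repr_B (l m) : T.B.repr (word T.b l.1) m = if l = m then 1 else 0 := by
  rw [← T.B_apply, T.B.repr_self, Finsupp.single_apply]

theorem repr_eq_zero_of_wordSpan {k : ℕ} {u : U t n} (hu : u ∈ wordSpan T.b (fun _ => True) k)
    {m : {l : List I // Good T.par l}} (hm : k ≤ m.1.length) : T.B.repr u m = 0 := by
  by_contra h
  exact absurd (T.mem_wordSpan_iff.1 hu m h) (not_lt.2 hm)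

theorem repr_word_of_perm {w : List I} {m : {l : List I // Good T.par l}} (h : w.Perm m.1) :
    T.B.repr (word T.b w) m ≠ 0 := by
  obtain ⟨-, ε, hε, h2⟩ := word_perm T.homog stable_true h [] trivial
  have h3 := T.repr_eq_zero_of_wordSpan h2 (m := m) (by simp [h.length_eq])
  rw [List.nil_append, List.nil_append, map_sub, map_smul, Finsupp.sub_apply, Finsupp.smul_apply,
    T.repr_B, if_pos rfl, sub_eq_zero] at h3
  rw [h3]
  rcases hε with rfl | rfl <;> simp

/-- In top length, straightening does not alter the multiset of letters. -/
theorem repr_word_of_not_perm {w : List I} {m : {l : List I // Good T.par l}}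
    (hw : w.length = m.1.length) (h : ¬ w.Perm m.1) : T.B.repr (word T.b w) m = 0 := by
  rcases exists_good_or T.homog stable_true w trivial with ⟨l, hp, hg, -, ε, -, h2⟩ | h2
  · have h3 := T.repr_eq_zero_of_wordSpan h2 (m := m) hw.le
    rw [map_sub, map_smul, Finsupp.sub_apply, Finsupp.smul_apply, T.repr_B ⟨l, hg⟩, if_neg,
      smul_zero, sub_zero] at h3
    · exact h3
    · rintro rfl
      exact h hp
  · exact T.repr_eq_zero_of_wordSpan h2 hw.le

theorem posWt_perm {l m : List I} (h : l.Perm m) : T.posWt l = T.posWt m := by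
  classical
  exact ((h.filter _).map _).sum_eq

/-- The commutator of `b f` with a word. -/
def ad (f : I) (l : List I) : U t n :=
  twisted T.b T.par (T.par f) (fun x => LieSuperalgebra.br (T.b f) (T.b x)) l

/-- Split `[f, ·]` into the single replacement of `e` by a multiple of `a` and the rest. The former
has leading term `a` times the contraction by `e`, with non-zero coefficient; by `h` the rest
produces no word with the letters of `m'`. -/
theorem repr_ad_ne_zero {m m' : {l : List I // Good T.par l}} {e f a : I} (he : e ∈ m.1)
    (hf : T.par f = T.par e) (ha : T.par a = 0)
    (hfe : T.b.repr (LieSuperalgebra.br (T.b f) (T.b e)) a ≠ 0)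
    (hm' : (a :: m.1.erase e).Perm m'.1)
    (h : ∀ l1 x l2 y, m.1 = l1 ++ x :: l2 →
      T.b.repr (LieSuperalgebra.br (T.b f) (T.b x)) y ≠ 0 → (l1 ++ y :: l2).Perm m'.1 →
      x = e ∧ y = a) : T.B.repr (T.ad f m.1) m' ≠ 0 := by
  have hlen : m'.1.length = m.1.length := by
    rw [← hm'.length_eq, List.length_cons, List.length_erase_add_one he]
  set c := T.b.repr (LieSuperalgebra.br (T.b f) (T.b e)) a with hc
  let g1 : I → Alg t n := fun x => if x = e then c • T.b a else 0
  let g2 : I → Alg t n := fun x => LieSuperalgebra.br (T.b f) (T.b x) - g1 x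
  have e1 : T.ad f m.1 = twisted T.b T.par (T.par e) g1 m.1
      + twisted T.b T.par (T.par e) g2 m.1 := by
    rw [← twisted_add, ad, hf]
    congr 1
    funext x
    simp [g2]
  have e2 : twisted T.b T.par (T.par e) g2 m.1 ∈ LinearMap.ker (T.B.coord m') := by
    refine twisted_mem fun l1 x l2 y hl hy => ?_
    rw [LinearMap.mem_ker, Module.Basis.coord_apply]
    refine T.repr_word_of_not_perm ?_ fun hp => ?_
    · rw [hlen, hl]; simp
    · by_cases hxy : x = e ∧ y = a
      · obtain ⟨rfl, rfl⟩ := hxy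
        exact hy (by simp [g2, g1, hc])
      · refine hxy (h l1 x l2 y hl (fun h0 => hy ?_) hp)
        simp only [g2, g1, map_sub, Finsupp.sub_apply, h0, zero_sub, neg_eq_zero]
        by_cases hx : x = e
        · have : ¬ a = y := fun h' => hxy ⟨hx, h'.symm⟩
          simp [hx, this]
        · simp [hx]
  obtain ⟨d, hd, e3⟩ := contract_good (b := T.b) m.2 he
  have e4 := T.repr_eq_zero_of_wordSpan (twisted_single T.homog (e := e) ha c m.1) (m := m')
    hlen.ge
  rw [e3, mul_smul_comm, ← word_cons, smul_smul, map_sub, map_smul, Finsupp.sub_apply,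
    Finsupp.smul_apply, sub_eq_zero] at e4
  rw [e1, map_add, Finsupp.add_apply, e4, (show T.B.repr _ m' = 0 from e2), add_zero, smul_eq_mul]
  exact mul_ne_zero (mul_ne_zero hfe hd) (T.repr_word_of_perm hm')

/-- Left multiplication by `b f` preserves `J(posWt l)`, and right multiplication shifts it by `wt
f`. -/
theorem ad_mem_J (f : I) (l : {l : List I // Good T.par l}) :
    T.ad f l.1 ∈ J .order t n (T.posWt l.1 ⊓ (T.posWt l.1 + T.wt f)) := by
  have h1 := T.word_mem_J .order l.2
  rw [ad, ← commutator_word T.homog]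
  refine Submodule.sub_mem _ (J_anti ?_ (Ideal.mul_mem_left _ _ h1))
    (J_anti ?_ (smul_mem_J _ (J_mul_ι (T.mem_wt f) h1)))
  · exact inf_le_left (α := RootLattice n)
  · exact inf_le_right (α := RootLattice n)

theorem ad_mem_wordSpan (f : I) (l : List I) :
    T.ad f l ∈ wordSpan T.b (fun _ => True) (l.length + 1) := by
  refine twisted_mem fun l1 x l2 y hl _ => word_mem_wordSpan trivial ?_
  rw [hl]
  simp

theorem commutator_eq_sum (f : I) {p : ZMod 2} {u : U t n}
    (hu : u ∈ Env.part (L := Alg t n) p) :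
    Env.ι (T.b f) * u - sgn (T.par f) p • (u * Env.ι (T.b f))
      = ∑ l ∈ (T.B.repr u).support, T.B.repr u l • T.ad f l.1 := by
  have h : u = ∑ l ∈ (T.B.repr u).support, T.B.repr u l • word T.b l.1 := by
    conv_lhs => rw [← T.B.linearCombination_repr u]
    simp only [← T.B_apply]
    rfl
  conv_lhs => rw [h]
  rw [Finset.mul_sum, Finset.sum_mul, Finset.smul_sum, ← Finset.sum_sub_distrib]
  refine Finset.sum_congr rfl fun l hl => ?_
  rw [ad, ← commutator_word T.homog, T.mem_part_iff.1 hu l (Finsupp.mem_support_iff.1 hl),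
    mul_smul_comm, smul_mul_assoc, smul_comm, smul_sub]

/-- The number of even Cartan letters. -/
def cartanCount (l : List I) : ℕ :=
  open Classical in (l.map fun i => if T.wt i = 0 ∧ T.par i = 0 then 1 else 0).sum

theorem cartanCount_append (l m : List I) :
    T.cartanCount (l ++ m) = T.cartanCount l + T.cartanCount m := by simp [cartanCount]

theorem cartanCount_cons_of_pos {i : I} (h : T.wt i = 0 ∧ T.par i = 0) (l : List I) :
    T.cartanCount (i :: l) = T.cartanCount l + 1 := by
  simp [cartanCount, h, add_comm]

theorem cartanCount_cons_of_neg {i : I} (h : ¬ (T.wt i = 0 ∧ T.par i = 0)) (l : List I) :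
    T.cartanCount (i :: l) = T.cartanCount l := by
  simp [cartanCount, h]

theorem cartanCount_perm {l m : List I} (h : l.Perm m) : T.cartanCount l = T.cartanCount m :=
  (h.map _).sum_eq

theorem posWt_cons (i : I) (l : List I) : T.posWt (i :: l) = T.posWt [i] + T.posWt l :=
  T.posWt_append [i] l

theorem exists_max_of_mem {α : Type*} (s : Finset α) (P : α → Prop) (g : α → ℕ) {a : α}
    (ha : a ∈ s) (hP : P a) : ∃ m ∈ s, P m ∧ ∀ x ∈ s, P x → g x ≤ g m := by
  classical
  obtain ⟨m, hm, h⟩ := Finset.exists_max_image (s.filter P) g ⟨a, Finset.mem_filter.2 ⟨ha, hP⟩⟩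
  exact ⟨m, (Finset.mem_filter.1 hm).1, (Finset.mem_filter.1 hm).2,
    fun x hx hx' => h x (Finset.mem_filter.2 ⟨hx, hx'⟩)⟩

/-- A word of maximal length with a maximal number of even Cartan letters, and a maximal number
of letters `a` among those that contain `e`, is determined by the result of replacing `e` by `a`. -/
theorem eq_of_replace {e f a x y : I} {m l l1 l2 : List I} (he : 0 < T.wt e)
    (hf : T.wt f = -T.wt e) (hpf : T.par f = T.par e) (ha : T.wt a = 0 ∧ T.par a = 0)
    (hem : e ∈ m) (hl : l = l1 ++ x :: l2)
    (hxy : T.b.repr (LieSuperalgebra.br (T.b f) (T.b x)) y ≠ 0)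
    (hp : (l1 ++ y :: l2).Perm (a :: m.erase e))
    (h1 : T.cartanCount l ≤ T.cartanCount m)
    (h2 : T.cartanCount l = T.cartanCount m → e ∈ l → l.count a ≤ m.count a) :
    x = e ∧ y = a := by
  have hea : e ≠ a := fun h => by rw [← h] at ha; exact he.ne' ha.1
  have hperm := List.perm_cons_erase hem
  have hne : ∀ i, T.wt i = T.wt e → ¬ (T.wt i = 0 ∧ T.par i = 0) :=
    fun i hi h => he.ne' (hi ▸ h.1)
  have c1 := T.cartanCount_perm hp
  have c2 := T.cartanCount_perm hperm
  rw [T.cartanCount_cons_of_neg (hne e rfl)] at c2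
  rw [T.cartanCount_cons_of_pos ha, ← c2, T.cartanCount_append] at c1
  have c3 : T.cartanCount l = T.cartanCount l1 + T.cartanCount (x :: l2) := by
    rw [hl, T.cartanCount_append]
  have c4 : T.cartanCount l2 ≤ T.cartanCount (x :: l2) := by
    by_cases h : T.wt x = 0 ∧ T.par x = 0
    · rw [T.cartanCount_cons_of_pos h]; exact Nat.le_succ _
    · rw [T.cartanCount_cons_of_neg h]
  -- Otherwise `l` would itself have the additional even Cartan letter, against the maximality of
  -- `m`.
  have hy : T.wt y = 0 ∧ T.par y = 0 := by
    by_contra hy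
    rw [T.cartanCount_cons_of_neg hy] at c1
    omega
  have hx : T.wt x = T.wt e := by
    have := T.wt_br f x y hxy
    rw [hy.1, hf, eq_comm, neg_add_eq_sub, sub_eq_zero] at this
    exact this
  have hxp : T.par x = T.par e := by
    have := T.par_br hxy
    rw [hy.2, hpf] at this
    exact add_left_cancel (this.symm.trans (CharTwo.add_self_eq_zero (T.par e)).symm)
  have hxe : e = x := T.eq_of_wt_par e x he hx.symm hxp.symm
  subst hxe
  refine ⟨rfl, ?_⟩
  -- If `y ≠ a`, the extra `a` was already in `l`, so `l` has more letters `a` than `m`.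
  by_contra hya
  rw [T.cartanCount_cons_of_pos hy] at c1
  rw [T.cartanCount_cons_of_neg (hne e rfl)] at c3
  have c5 := h2 (by omega) (by rw [hl]; simp)
  have c6 := hp.count_eq a
  rw [List.count_cons_self, List.count_erase_of_ne hea.symm, List.count_append,
    List.count_cons_of_ne hya] at c6
  rw [hl, List.count_append, List.count_cons_of_ne hea] at c5
  omega

/-- If `u` supercommutes with `n⁻` in weight `ν`, up to terms of length `< K`, then the component
of `u` in `J'(ν)` consists of terms of length `< K`. -/
theorem length_lt {p : ZMod 2} {u : U t n} (hu : u ∈ Env.part (L := Alg t n) p)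
    {ν : RootLattice n} (hν : ν ≠ 0) {K : ℕ}
    (hlow : ∀ l, T.B.repr u l ≠ 0 → T.posWt l.1 < ν → l.1.length < K)
    (hcomm : ∀ f, T.wt f < 0 → ∀ m, T.posWt m.1 = ν + T.wt f →
      T.B.repr (Env.ι (T.b f) * u - sgn (T.par f) p • (u * Env.ι (T.b f))) m = 0) :
    ∀ l, T.B.repr u l ≠ 0 → T.posWt l.1 = ν → l.1.length < K := by
  intro l0 hl0 hν0
  by_contra hK
  rw [not_lt] at hK
  obtain ⟨m1, hm1, hP1, hmax1⟩ := exists_max_of_mem (T.B.repr u).support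
    (fun l => T.posWt l.1 = ν) (fun l => l.1.length) (Finsupp.mem_support_iff.2 hl0) hν0
  have hr : K ≤ m1.1.length := hK.trans (hmax1 l0 (Finsupp.mem_support_iff.2 hl0) hν0)
  generalize hr' : m1.1.length = r at hr
  -- Three successive maximal choices: length, number of even Cartan letters, and, once `e` and `a`
  -- are fixed, the number of letters `a` among the words containing `e`.
  obtain ⟨m2, hm2, hP2, hmax2⟩ := exists_max_of_mem (T.B.repr u).support
    (fun l => T.posWt l.1 = ν ∧ l.1.length = r) (fun l => T.cartanCount l.1) hm1 ⟨hP1, hr'⟩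
  obtain ⟨e, hem, he⟩ : ∃ e ∈ m2.1, 0 < T.wt e := by
    by_contra hall
    push Not at hall
    refine hν ?_
    rw [← hP2.1]
    exact T.posWt_of_nonpos hall
  obtain ⟨f, a, hf, hpf, ha, hpa, hfe⟩ := T.exists_dual e he
  obtain ⟨m, hmu, ⟨hmν, hmr, hmh, hme⟩, hmax3⟩ := exists_max_of_mem (T.B.repr u).support
    (fun l => T.posWt l.1 = ν ∧ l.1.length = r ∧ T.cartanCount l.1 = T.cartanCount m2.1 ∧ e ∈ l.1)
    (fun l => l.1.count a) hm2 ⟨hP2.1, hP2.2, rfl, hem⟩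
  have hperm := List.perm_cons_erase hme
  -- The new letter `a` is even, so it may be repeated.
  have hgood : Good T.par ((a :: m.1.erase e).insertionSort (· ≤ ·)) := by
    refine ⟨List.pairwise_insertionSort _ _, fun i hi => ?_⟩
    have hai : a ≠ i := fun h => zero_ne_one (hpa.symm.trans (h ▸ hi))
    rw [(List.perm_insertionSort _ _).count_eq, List.count_cons_of_ne hai]
    exact (List.erase_sublist.count_le i).trans (m.2.2 i hi)
  obtain ⟨m', hpm'⟩ : ∃ m' : {l : List I // Good T.par l}, (a :: m.1.erase e).Perm m'.1 :=
    ⟨⟨_, hgood⟩, (List.perm_insertionSort _ _).symm⟩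
  have hlen' : m'.1.length = r := by
    rw [← hpm'.length_eq, List.length_cons, List.length_erase_add_one hme, hmr]
  have hνm' : T.posWt m'.1 = ν + T.wt f := by
    rw [← T.posWt_perm hpm', ← hmν, T.posWt_perm hperm, T.posWt_cons a, T.posWt_cons e,
      T.posWt_of_nonpos (l := [a]) (by simp [ha]), T.posWt_of_pos (l := [e]) (by simpa using he), hf]
    simp
  have hfneg : T.wt f < 0 := by rw [hf]; exact neg_neg_of_pos he
  have claim : ∀ l ∈ (T.B.repr u).support, T.posWt l.1 = ν → l.1.length = r → ∀ l1 x l2 y,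
      l.1 = l1 ++ x :: l2 → T.b.repr (LieSuperalgebra.br (T.b f) (T.b x)) y ≠ 0 →
      (l1 ++ y :: l2).Perm m'.1 → x = e ∧ y = a := by
    intro l hl hlν hlr l1 x l2 y hsplit hxy hp
    refine T.eq_of_replace he hf hpf ⟨ha, hpa⟩ hme hsplit hxy (hp.trans hpm'.symm) ?_
      fun h h' => hmax3 l hl ⟨hlν, hlr, h.trans hmh, h'⟩
    rw [hmh]
    exact hmax2 l hl ⟨hlν, hlr⟩
  -- The coefficient of the commutator at `m'` vanishes by assumption, yet only the term of `m`
  -- contributes to it.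
  have hz := hcomm f hfneg m' hνm'
  rw [T.commutator_eq_sum f hu, map_sum, Finsupp.finsetSum_apply, Finset.sum_eq_single m] at hz
  · rw [map_smul, Finsupp.smul_apply, smul_eq_mul, mul_eq_zero] at hz
    exact hz.elim (Finsupp.mem_support_iff.1 hmu)
      (T.repr_ad_ne_zero hme hpf hpa hfe hpm' (claim m hmu hmν hmr))
  · intro l hl hlm
    rw [map_smul, Finsupp.smul_apply, smul_eq_mul]
    refine mul_eq_zero_of_right _ ?_
    have hshort : l.1.length < r → T.B.repr (T.ad f l.1) m' = 0 := fun h =>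
      T.repr_eq_zero_of_wordSpan (T.ad_mem_wordSpan f l.1) (by omega)
    by_cases hlν : T.posWt l.1 = ν
    · rcases (hmax1 l hl hlν).lt_or_eq with h | h
      · exact hshort (h.trans_eq hr')
      · have hlr : l.1.length = r := h.trans hr'
        have : T.ad f l.1 ∈ LinearMap.ker (T.B.coord m') := by
          refine twisted_mem fun l1 x l2 y hsplit hxy => ?_
          rw [LinearMap.mem_ker, Module.Basis.coord_apply]
          refine T.repr_word_of_not_perm ?_ fun hp => hlm ?_
          · rw [hlen', ← hlr, hsplit]; simp
          · obtain ⟨rfl, rfl⟩ := claim l hl hlν hlr l1 x l2 y hsplit hxy hp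
            refine Subtype.ext (l.2.eq_of_perm m.2 ?_)
            have p1 := (List.perm_middle.symm.trans hp).trans hpm'.symm
            rw [hsplit]
            exact List.perm_middle.trans ((p1.cons_inv.cons x).trans hperm.symm)
        exact this
    -- Words of smaller `n⁺`-weight are too short by `hlow`. For the others `ad f` lowers the
    -- `n⁺`-weight by at most that of `e`, which does not lead to `m'`.
    · by_cases hlt : T.posWt l.1 < ν
      · exact hshort ((hlow l (Finsupp.mem_support_iff.1 hl) hlt).trans_le hr)
      · by_contra hne
        have h1 : T.posWt l.1 ⊓ (T.posWt l.1 + T.wt f) ≤ T.posWt m'.1 :=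
          T.mem_J_iff.1 (T.ad_mem_J f l) m' hne
        rw [hνm', inf_eq_right.2 (add_le_of_nonpos_right hfneg.le)] at h1
        exact hlt (lt_of_le_of_ne (le_of_add_le_add_right h1) hlν)
  · intro h
    exact absurd hmu h

end TriBasis

end QType

namespace QType

/-! ### The completion -/

section Completion

variable {κ : Comparison} {t : Kind} {n : ℕ}

theorem nhds_zero_TopU :
    (nhds (0 : TopU κ t n)).HasBasis (fun _ => True) fun ξ => (J κ t n ξ : Set (U t n)) :=
  (J_basis κ t n).hasBasis_nhds_zero

variable (κ t n) in
/-- The ideal `J(ξ)`, as a subgroup of the topological ring. -/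
def topJ (ξ : RootLattice n) : AddSubgroup (TopU κ t n) := (J κ t n ξ).toAddSubgroup

variable (κ t n) in
/-- The closure of `J(ξ)` in the completion. -/
def hatJ (ξ : RootLattice n) : AddSubgroup (UHat κ t n) :=
  ((J κ t n ξ).toAddSubgroup.map (toHat κ t n).toAddMonoidHom).topologicalClosure

theorem mem_hatJ {ξ : RootLattice n} {u : UHat κ t n} :
    u ∈ hatJ κ t n ξ ↔ u ∈ closure (toHat κ t n '' (J κ t n ξ : Set (U t n))) := Iff.rfl

theorem nhds_zero_UHat :
    (nhds (0 : UHat κ t n)).HasBasis (fun _ => True) fun ξ => (hatJ κ t n ξ : Set (UHat κ t n)) := by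
  have h := nhds_zero_TopU.hasBasis_of_isDenseInducing
    (UniformSpace.Completion.isDenseInducing_coe (α := TopU κ t n))
  rw [UniformSpace.Completion.coe_zero] at h
  exact h

/-- An open subgroup is closed, so taking the closure in `Û` adds no elements of `U(g)`. -/
theorem toHat_mem_hatJ {ξ : RootLattice n} {a : U t n} :
    toHat κ t n a ∈ hatJ κ t n ξ ↔ a ∈ J κ t n ξ := by
  have hopen : IsOpen (topJ κ t n ξ : Set (TopU κ t n)) :=
    AddSubgroup.isOpen_of_mem_nhds (g := (0 : TopU κ t n)) _ (nhds_zero_TopU.mem_of_mem trivial)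
  have hclosed : IsClosed (topJ κ t n ξ : Set (TopU κ t n)) :=
    AddSubgroup.isClosed_of_isOpen _ hopen
  have h := (UniformSpace.Completion.isDenseInducing_coe (α := TopU κ t n)).isInducing
    |>.closure_eq_preimage_closure_image (topJ κ t n ξ : Set (TopU κ t n))
  rw [hclosed.closure_eq] at h
  have h2 := congrArg (fun s : Set (TopU κ t n) => (a : TopU κ t n) ∈ s) h
  exact (Iff.of_eq h2).symm

theorem hatJ_anti {ξ ξ' : RootLattice n} (h : κ.le ξ ξ') : hatJ κ t n ξ' ≤ hatJ κ t n ξ :=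
  closure_mono (Set.image_mono (J_anti h))

theorem nhds_UHat (u : UHat κ t n) :
    (nhds u).HasBasis (fun _ => True) fun ξ => {v | v - u ∈ hatJ κ t n ξ} := by
  have h := nhds_zero_UHat (κ := κ) (t := t) (n := n).comap fun v => v - u
  rw [show (0 : UHat κ t n) = u - u by rw [sub_self]] at h
  rw [(Homeomorph.subRight u).nhds_eq_comap]
  exact h

theorem mem_closure_iff_approx {S : Set (U t n)} {u : UHat κ t n} :
    u ∈ closure (toHat κ t n '' S) ↔ ∀ ξ, ∃ a ∈ S, u - toHat κ t n a ∈ hatJ κ t n ξ := by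
  rw [mem_closure_iff_nhds_basis (nhds_UHat u)]
  constructor
  · intro h ξ
    obtain ⟨_, ⟨a, ha, rfl⟩, h'⟩ := h ξ trivial
    refine ⟨a, ha, ?_⟩
    rw [← neg_sub]
    exact neg_mem h'
  · intro h ξ _
    obtain ⟨a, ha, h'⟩ := h ξ
    refine ⟨_, ⟨a, ha, rfl⟩, ?_⟩
    change _ ∈ hatJ κ t n ξ
    rw [← neg_sub]
    exact neg_mem h'

theorem denseRange_toHat : DenseRange (toHat κ t n) :=
  UniformSpace.Completion.denseRange_coe (α := TopU κ t n)

theorem exists_approx (u : UHat κ t n) (ξ : RootLattice n) :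
    ∃ a, u - toHat κ t n a ∈ hatJ κ t n ξ := by
  have h : u ∈ closure (toHat κ t n '' Set.univ) := by
    rw [Set.image_univ]; exact denseRange_toHat u
  obtain ⟨a, -, ha⟩ := mem_closure_iff_approx.1 h ξ
  exact ⟨a, ha⟩

theorem mul_mem_hatJ {ξ : RootLattice n} (x : UHat κ t n) {y : UHat κ t n}
    (hy : y ∈ hatJ κ t n ξ) : x * y ∈ hatJ κ t n ξ := by
  refine map_mem_closure₂ continuous_mul (denseRange_toHat x) hy ?_
  rintro _ ⟨a, rfl⟩ _ ⟨b, hb, rfl⟩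
  exact ⟨a * b, Ideal.mul_mem_left _ _ hb, (toHat κ t n).map_mul a b⟩

theorem mul_ι_mem_hatJ {ξ α : RootLattice n} {x : Alg t n}
    (hx : x ∈ induced t (supported fun i j => root i j = α)) {y : UHat κ t n}
    (hy : y ∈ hatJ κ t n ξ) : y * toHat κ t n (Env.ι x) ∈ hatJ κ t n (ξ + α) := by
  refine map_mem_closure (f := fun y => y * toHat κ t n (Env.ι x))
    (continuous_id.mul continuous_const) hy ?_
  rintro _ ⟨a, ha, rfl⟩
  exact ⟨a * Env.ι x, J_mul_ι hx ha, (toHat κ t n).map_mul _ _⟩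

/-- Linear maps that are continuous for the topology given by the ideals `J(ξ)`. -/
def JContinuous (κ : Comparison) (A : U t n →ₗ[ℂ] U t n) : Prop :=
  ∀ ξ, ∃ ξ', ∀ u ∈ J κ t n ξ', A u ∈ J κ t n ξ

variable (κ) in
/-- A linear map, as a homomorphism of the topological additive group. -/
def topHom (A : U t n →ₗ[ℂ] U t n) : TopU κ t n →+ TopU κ t n where
  toFun := A
  map_zero' := A.map_zero
  map_add' := A.map_add

theorem JContinuous.continuous {A : U t n →ₗ[ℂ] U t n} (hA : JContinuous κ A) :
    Continuous (topHom κ A) := by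
  refine continuous_of_continuousAt_zero (topHom κ A) ?_
  rw [ContinuousAt, map_zero]
  refine (nhds_zero_TopU.tendsto_iff nhds_zero_TopU).2 fun ξ _ => ?_
  obtain ⟨ξ', h⟩ := hA ξ
  exact ⟨ξ', trivial, h⟩

/-- The continuous extension to the completion. -/
def extend {A : U t n →ₗ[ℂ] U t n} (hA : JContinuous κ A) : UHat κ t n →+ UHat κ t n :=
  AddMonoidHom.completion (topHom κ A) hA.continuous

theorem continuous_extend {A : U t n →ₗ[ℂ] U t n} (hA : JContinuous κ A) :
    Continuous (extend hA) := AddMonoidHom.continuous_completion _ _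

theorem extend_toHat {A : U t n →ₗ[ℂ] U t n} (hA : JContinuous κ A) (a : U t n) :
    extend hA (toHat κ t n a) = toHat κ t n (A a) :=
  AddMonoidHom.completion_coe (topHom κ A) hA.continuous a

/-- Here `1` is the sum of all simple roots, which is non-zero because `n ≥ 2`. Under either
comparison, knowing an element modulo `J(ν + 1)` thus determines its components of weight `≤ ν`. -/
theorem not_le_add_one (hn : 2 ≤ n) (ν : RootLattice n) : ¬ κ.le (ν + 1) ν := by
  have : Nonempty (Fin (n - 1)) := ⟨⟨0, by omega⟩⟩
  cases κ
  · intro h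
    have h' : ν + 1 ≤ ν := h
    have := h' ⟨0, by omega⟩
    simp at this
  · intro h
    have h' : height (ν + 1) ≤ height ν := h
    rw [height_add] at h'
    have : height (1 : RootLattice n) = (n - 1 : ℕ) := by simp [height]
    rw [this] at h'
    omega

end Completion

/-! ### Components in `J'(ν)` and convergent expansions. -/

namespace TriBasis

variable {κ : Comparison} {t : Kind} {n : ℕ} {I : Type} [LinearOrder I] (T : TriBasis t n I)

theorem toHat_injective (T : TriBasis t n I) (hn : 2 ≤ n) : Function.Injective (toHat κ t n) := by
  rw [injective_iff_map_eq_zero]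
  intro a ha
  have h : ∀ ξ, a ∈ J κ t n ξ := fun ξ => toHat_mem_hatJ.1 (ha ▸ zero_mem _)
  refine T.B.repr.map_eq_zero_iff.1 (Finsupp.ext fun l => ?_)
  by_contra hl
  exact not_le_add_one hn _ (T.mem_J_iff.1 (h (T.posWt l.1 + 1)) l hl)

/-- The projection of `U(g)` to `J'(ν)`. -/
def proj (ν : RootLattice n) : U t n →ₗ[ℂ] U t n :=
  open Classical in
  T.B.constr ℂ fun l => if T.posWt l.1 = ν then word T.b l.1 else 0

theorem repr_proj (ν : RootLattice n) (u : U t n) (l) :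
    T.B.repr (T.proj ν u) l = open Classical in if T.posWt l.1 = ν then T.B.repr u l else 0 := by
  classical
  have h : T.B.coord l ∘ₗ T.proj ν = if T.posWt l.1 = ν then T.B.coord l else 0 := by
    refine T.B.ext fun m => ?_
    rw [LinearMap.comp_apply, proj, T.B.constr_basis, Module.Basis.coord_apply]
    by_cases h : l = m
    · subst h
      by_cases h1 : T.posWt l.1 = ν <;> simp [h1, T.repr_B]
    · have h' : ¬ m = l := fun h' => h h'.symm
      by_cases h1 : T.posWt m.1 = ν <;> by_cases h2 : T.posWt l.1 = ν <;>
        simp [h1, h2, T.repr_B, h']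
  have := LinearMap.congr_fun h u
  rw [LinearMap.comp_apply, Module.Basis.coord_apply] at this
  rw [this]
  split_ifs <;> simp

theorem proj_mem_JPrime (ν : RootLattice n) (u : U t n) : T.proj ν u ∈ JPrime t n ν := by
  rw [T.mem_JPrime_iff]
  intro l hl
  by_contra h
  rw [T.repr_proj, if_neg h] at hl
  exact hl rfl

theorem proj_eq_zero {ξ ν : RootLattice n} (h : ¬ κ.le ξ ν) {u : U t n} (hu : u ∈ J κ t n ξ) :
    T.proj ν u = 0 := by
  refine T.B.repr.map_eq_zero_iff.1 (Finsupp.ext fun l => ?_)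
  rw [T.repr_proj]
  split_ifs with h'
  · by_contra hl
    exact h (h' ▸ T.mem_J_iff.1 hu l hl)
  · rfl

theorem proj_of_mem_JPrime {ν μ : RootLattice n} {u : U t n} (hu : u ∈ JPrime t n μ) :
    T.proj ν u = open Classical in if μ = ν then u else 0 := by
  classical
  rw [T.mem_JPrime_iff] at hu
  refine T.B.repr.injective (Finsupp.ext fun l => ?_)
  rw [T.repr_proj]
  by_cases hl : T.B.repr u l = 0
  · split_ifs <;> simp [hl]
  · rw [hu l hl]
    split_ifs <;> simp

theorem jContinuous_proj (hn : 2 ≤ n) (ν : RootLattice n) : JContinuous κ (T.proj ν) :=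
  fun ξ => ⟨ν + 1, fun u hu => by
    rw [T.proj_eq_zero (not_le_add_one hn ν) hu]; exact zero_mem _⟩

/-- The projection of the completion to `J'(ν)`. -/
def hatProj (κ : Comparison) (hn : 2 ≤ n) (ν : RootLattice n) : UHat κ t n →+ UHat κ t n :=
  extend (T.jContinuous_proj (κ := κ) hn ν)

theorem hatProj_toHat (hn : 2 ≤ n) (ν : RootLattice n) (a : U t n) :
    T.hatProj κ hn ν (toHat κ t n a) = toHat κ t n (T.proj ν a) := extend_toHat _ a

theorem hatProj_eq_zero (hn : 2 ≤ n) {ξ ν : RootLattice n} (h : ¬ κ.le ξ ν) {u : UHat κ t n}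
    (hu : u ∈ hatJ κ t n ξ) : T.hatProj κ hn ν u = 0 := by
  have h1 : T.hatProj κ hn ν u ∈ closure {(0 : UHat κ t n)} := by
    refine map_mem_closure (continuous_extend _) (mem_hatJ.1 hu) ?_
    rintro _ ⟨a, ha, rfl⟩
    exact (T.hatProj_toHat hn ν a).trans (by rw [T.proj_eq_zero h ha, map_zero])
  rwa [isClosed_singleton.closure_eq, Set.mem_singleton_iff] at h1

theorem hatProj_of_approx (hn : 2 ≤ n) {ξ ν : RootLattice n} (h : ¬ κ.le ξ ν) {u : UHat κ t n}
    {a : U t n} (hu : u - toHat κ t n a ∈ hatJ κ t n ξ) :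
    T.hatProj κ hn ν u = toHat κ t n (T.proj ν a) := by
  have := T.hatProj_eq_zero hn h hu
  rwa [map_sub, T.hatProj_toHat, sub_eq_zero] at this

/-- The extended projection has values in `U(g)` itself: one approximation modulo `J(ν + 1)` already
has the right component. -/
theorem exists_comp (hn : 2 ≤ n) (u : UHat κ t n) (ν : RootLattice n) :
    ∃ c, T.hatProj κ hn ν u = toHat κ t n c := by
  obtain ⟨a, ha⟩ := exists_approx u (ν + 1)
  exact ⟨_, T.hatProj_of_approx hn (not_le_add_one hn ν) ha⟩

/-- The component in `J'(ν)` of an element of the completion. -/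
def comp (hn : 2 ≤ n) (u : UHat κ t n) (ν : RootLattice n) : U t n :=
  (T.exists_comp hn u ν).choose

theorem toHat_comp (hn : 2 ≤ n) (u : UHat κ t n) (ν : RootLattice n) :
    toHat κ t n (T.comp hn u ν) = T.hatProj κ hn ν u := (T.exists_comp hn u ν).choose_spec.symm

theorem comp_of_approx (hn : 2 ≤ n) {ξ ν : RootLattice n} (h : ¬ κ.le ξ ν) {u : UHat κ t n}
    {a : U t n} (hu : u - toHat κ t n a ∈ hatJ κ t n ξ) : T.comp hn u ν = T.proj ν a :=
  T.toHat_injective (κ := κ) hn (by rw [T.toHat_comp, T.hatProj_of_approx hn h hu])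

theorem comp_mem_JPrime (hn : 2 ≤ n) (u : UHat κ t n) (ν : RootLattice n) :
    T.comp hn u ν ∈ JPrime t n ν := by
  obtain ⟨a, ha⟩ := exists_approx u (ν + 1)
  rw [T.comp_of_approx hn (not_le_add_one hn ν) ha]
  exact T.proj_mem_JPrime ν a

theorem comp_add (hn : 2 ≤ n) (u v : UHat κ t n) (ν : RootLattice n) :
    T.comp hn (u + v) ν = T.comp hn u ν + T.comp hn v ν :=
  T.toHat_injective (κ := κ) hn (by simp only [map_add, T.toHat_comp])

theorem isExpansion_comp (hn : 2 ≤ n) (u : UHat κ t n) :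
    IsExpansion u fun ν => T.comp hn u ν.1 := by
  classical
  refine ⟨fun ν => T.comp_mem_JPrime hn u ν.1, ?_⟩
  rw [HasSum, (nhds_UHat u).tendsto_right_iff]
  intro ξ _
  obtain ⟨a, ha⟩ := exists_approx u ξ
  -- Outside the weights `≽ ξ` the components of `u` are those of `a`, so only the finitely many
  -- weights occurring in `a` matter.
  let S0 : Finset {ν : RootLattice n // 0 ≤ ν} :=
    (T.B.repr a).support.image fun l => ⟨T.posWt l.1, T.posWt_nonneg l.1⟩
  filter_upwards [Filter.eventually_ge_atTop S0] with S hS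
  have key : ∑ ν ∈ S, T.comp hn u ν.1 - a ∈ J κ t n ξ := by
    rw [T.mem_J_iff]
    intro l hl
    by_contra hξ
    refine hl ?_
    rw [map_sub, map_sum, Finsupp.sub_apply, Finsupp.finsetSum_apply, sub_eq_zero]
    have hne : ∀ ν : {ν : RootLattice n // 0 ≤ ν}, ν ≠ ⟨T.posWt l.1, T.posWt_nonneg l.1⟩ →
        T.B.repr (T.comp hn u ν.1) l = 0 := by
      intro ν hν
      by_contra h
      exact hν (Subtype.ext (T.mem_JPrime_iff.1 (T.comp_mem_JPrime hn u ν.1) l h).symm)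
    have heq : T.B.repr (T.comp hn u (T.posWt l.1)) l = T.B.repr a l := by
      rw [T.comp_of_approx hn hξ ha, T.repr_proj, if_pos rfl]
    rw [Finset.sum_eq_single ⟨T.posWt l.1, T.posWt_nonneg l.1⟩ (fun ν _ hν => hne ν hν)]
    · exact heq
    · intro hnot
      rw [heq]
      by_contra h
      exact hnot (hS (Finset.mem_image.2 ⟨l, Finsupp.mem_support_iff.2 h, rfl⟩))
  have h2 := sub_mem (toHat_mem_hatJ.2 key) ha
  rw [map_sub, map_sum] at h2
  change _ ∈ hatJ κ t n ξ
  convert h2 using 1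
  abel

/-- The continuous projection to `J'(ν)` can be applied term by term and leaves a single term. -/
theorem eq_comp_of_isExpansion (hn : 2 ≤ n) {u : UHat κ t n}
    {c : {ν : RootLattice n // 0 ≤ ν} → U t n} (h : IsExpansion u c) :
    c = fun ν => T.comp hn u ν.1 := by
  classical
  funext ν
  refine T.toHat_injective (κ := κ) hn ?_
  rw [T.toHat_comp]
  have h1 := h.2.map (T.hatProj κ hn ν.1) (continuous_extend _)
  have h2 : (T.hatProj κ hn ν.1 ∘ fun μ => toHat κ t n (c μ))
      = fun μ => if μ = ν then toHat κ t n (c ν) else 0 := by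
    funext μ
    rw [Function.comp_apply, T.hatProj_toHat, T.proj_of_mem_JPrime (h.1 μ)]
    by_cases hμ : μ = ν
    · subst hμ; simp
    · rw [if_neg hμ, if_neg fun h => hμ (Subtype.ext h), map_zero]
  rw [h2] at h1
  exact (hasSum_ite_eq ν _).unique h1

theorem eq_zero_of_comp (hn : 2 ≤ n) {u : UHat κ t n} (h : ∀ ν, 0 ≤ ν → T.comp hn u ν = 0) :
    u = 0 := by
  have h1 := (T.isExpansion_comp hn u).2
  have h2 : (fun ν : {ν : RootLattice n // 0 ≤ ν} => toHat κ t n (T.comp hn u ν.1)) = 0 := by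
    funext ν
    rw [h ν.1 ν.2, map_zero]; rfl
  rw [h2] at h1
  exact h1.unique hasSum_zero

/-- Projecting to `J'(ν)` selects PBW words, hence preserves the filtration; conversely an element
is the limit of the partial sums of its expansion. -/
theorem mem_filtHat_iff (hn : 2 ≤ n) {u : UHat κ t n} {k : ℕ} :
    u ∈ filtHat κ t n k ↔ ∀ ν, 0 ≤ ν → T.comp hn u ν ∈ Env.filt (L := Alg t n) k := by
  constructor
  · intro hu ν _
    obtain ⟨a, ha, h⟩ := mem_closure_iff_approx.1 hu (ν + 1)
    rw [T.comp_of_approx hn (not_le_add_one hn ν) h, T.mem_filt_iff]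
    intro l hl
    rw [T.repr_proj] at hl
    refine T.mem_filt_iff.1 ha l fun h0 => hl ?_
    rw [h0]
    split_ifs <;> rfl
  · intro h
    refine mem_closure_of_tendsto (T.isExpansion_comp hn u).2 (Filter.Eventually.of_forall fun S => ?_)
    rw [← map_sum]
    exact ⟨_, Submodule.sum_mem _ fun ν _ => h ν.1 ν.2, rfl⟩

end TriBasis

end QType

namespace QType

/-! ### The Harish-Chandra projection -/

theorem height_lt {n : ℕ} {ν μ : RootLattice n} (h : ν < μ) : height ν < height μ := by
  obtain ⟨h1, k, hk⟩ := Pi.lt_def.1 h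
  exact Finset.sum_lt_sum (fun i _ => h1 i) ⟨k, Finset.mem_univ _, hk⟩

theorem height_zero {n : ℕ} : height (0 : RootLattice n) = 0 := by simp [height]

namespace TriBasis

variable {κ : Comparison} {t : Kind} {n : ℕ} {I : Type} [LinearOrder I] (T : TriBasis t n I)

theorem posWt_pos {i : I} {l : List I} (hi : i ∈ l) (h : 0 < T.wt i) : 0 < T.posWt l := by
  rw [T.posWt_perm (List.perm_cons_erase hi), T.posWt_cons,
    T.posWt_of_pos (l := [i]) (by simpa using h)]
  simp only [List.map_cons, List.map_nil, List.sum_cons, List.sum_nil, add_zero]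
  exact add_pos_of_pos_of_nonneg h (T.posWt_nonneg _)

theorem nonpos_of_posWt {l : List I} (h : T.posWt l = 0) : ∀ i ∈ l, ¬ 0 < T.wt i :=
  fun _ hi hi' => (T.posWt_pos hi hi').ne' h

theorem height_sum_nonpos {l : List I} (h : ∀ i ∈ l, ¬ 0 < T.wt i) :
    height (l.map T.wt).sum ≤ 0 ∧
      (height (l.map T.wt).sum = 0 → ∀ i ∈ l, T.wt i = 0) := by
  induction l with
  | nil => simp [height_zero]
  | cons i l ih =>
    obtain ⟨h1, h2⟩ := ih fun j hj => h j (List.mem_cons_of_mem _ hj)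
    rw [List.map_cons, List.sum_cons, height_add]
    rcases T.trichotomy i with hi | hi | hi
    · have := height_lt hi
      rw [height_zero] at this
      exact ⟨by omega, fun h' => by omega⟩
    · rw [hi, height_zero, zero_add]
      refine ⟨h1, fun h' j hj => ?_⟩
      rcases List.mem_cons.1 hj with rfl | hj
      · exact hi
      · exact h2 h' j hj
    · exact absurd hi (h i List.mem_cons_self)

/-- `n⁻ U(b⁻)`. -/
abbrev nMinusUBMinus (t : Kind) (n : ℕ) : Submodule ℂ (U t n) :=
  (nMinus t n).map Env.ι * Subalgebra.toSubmodule (UBMinus t n)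

/-- A sorted word of non-positive letters that are not all in `h` begins with a letter of `n⁻`. -/
theorem UBMinus_le (T : TriBasis t n I) : Subalgebra.toSubmodule (UBMinus t n) ≤
    Subalgebra.toSubmodule (UCartan t n) ⊔ nMinusUBMinus t n := by
  rw [nMinusUBMinus, T.UBMinus_eq, wordsOf_good T.homog T.stable_nonpos, T.UCartan_eq]
  refine wordsOf_le ?_
  rintro l ⟨hl, hg⟩
  by_cases h : ∀ i ∈ l, T.wt i = 0
  · exact Submodule.mem_sup_left (word_mem_wordsOf h)
  · refine Submodule.mem_sup_right ?_
    obtain _ | ⟨i, l⟩ := l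
    · simp at h
    · have hi : T.wt i < 0 := by
        by_contra hi
        refine h fun j hj => ?_
        rcases T.trichotomy j with hj' | hj' | hj'
        · rcases List.mem_cons.1 hj with rfl | hjl
          · exact absurd hj' hi
          · exact absurd (T.lt_of_neg j i hj' hi)
              (not_lt.2 ((List.pairwise_cons.1 hg.1).1 j hjl))
        · exact hj'
        · exact absurd hj' (hl j hj)
      rw [word_cons]
      refine Submodule.mul_mem_mul ⟨T.b i, ?_, rfl⟩ (word_mem_wordsOf
        ⟨fun j hj => hl j (List.mem_cons_of_mem _ hj), hg.sublist (List.sublist_cons_self i l)⟩)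
      rw [T.nMinus_eq]
      exact Submodule.subset_span ⟨i, hi, rfl⟩

theorem nMinusUBMinus_le_UBMinus :
    nMinusUBMinus t n ≤ Subalgebra.toSubmodule (UBMinus t n) := by
  refine Submodule.mul_le.2 fun u hu v hv => ?_
  obtain ⟨x, hx, rfl⟩ := hu
  exact Subalgebra.mul_mem _ (Algebra.subset_adjoin ⟨x, Submodule.mem_sup_left hx, rfl⟩) hv

/-- The words of `n⁻ U(b⁻)` have negative total height, those of `U(h)` have height zero. -/
theorem eq_zero_of_mem_UCartan (T : TriBasis t n I) {u : U t n} (hu : u ∈ UCartan t n)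
    (hu' : u ∈ nMinusUBMinus t n) : u = 0 := by
  have hst : Stable T.b fun l => height (l.map T.wt).sum < 0 := by
    have := T.stable (S := fun _ => True) (fun i j k _ _ _ => trivial) fun ν _ => height ν < 0
    simpa using this
  have h1 : u ∈ wordsOf T.b fun l => height (l.map T.wt).sum < 0 := by
    refine Submodule.mul_le.2 (fun v hv w hw => ?_) hu'
    obtain ⟨x, hx, rfl⟩ := hv
    have hx' : x ∈ nMinus t n := hx
    rw [T.nMinus_eq] at hx'
    rw [T.UBMinus_eq] at hw
    have hv := ι_mem_wordsOf (W := fun l => height (l.map T.wt).sum < 0) hx' fun i hi => by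
      have := height_lt hi
      rw [height_zero] at this
      simpa using this
    refine mul_mem_wordsOf (fun l m hl hm => ?_) hv hw
    have := (T.height_sum_nonpos hm).1
    rw [List.map_append, List.sum_append, height_add]
    omega
  rw [wordsOf_good T.homog hst, T.mem_wordsOf_good] at h1
  refine T.B.repr.map_eq_zero_iff.1 (Finsupp.ext fun l => ?_)
  by_contra hl
  have h2 := h1 l hl
  have h3 : (l.1.map T.wt).sum = 0 := List.sum_eq_zero fun x hx => by
    obtain ⟨i, hi, rfl⟩ := List.mem_map.1 hx
    exact T.mem_UCartan_iff.1 hu l hl i hi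
  rw [h3, height_zero] at h2
  exact lt_irrefl _ h2

theorem comp_zero_mem_UBMinus (hn : 2 ≤ n) (u : UHat κ t n) : T.comp hn u 0 ∈ UBMinus t n :=
  T.mem_UBMinus_iff.2 fun l hl =>
    T.nonpos_of_posWt (T.mem_JPrime_iff.1 (T.comp_mem_JPrime hn u 0) l hl)

theorem proj_zero_of_mem_UBMinus {u : U t n} (hu : u ∈ UBMinus t n) : T.proj 0 u = u := by
  rw [T.proj_of_mem_JPrime (μ := 0), if_pos rfl]
  rw [T.mem_JPrime_iff]
  exact fun l hl => T.posWt_of_nonpos (T.mem_UBMinus_iff.1 hu l hl)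

/-- Removes the last letter `e` of the words. -/
def strip (e : I) : U t n →ₗ[ℂ] U t n :=
  T.B.constr ℂ fun l => if l.1.getLast? = some e then word T.b l.1.dropLast else 0

theorem strip_word (e : I) (l : {l : List I // Good T.par l}) :
    T.strip e (word T.b l.1) = if l.1.getLast? = some e then word T.b l.1.dropLast else 0 := by
  rw [← T.B_apply, strip, T.B.constr_basis]

theorem jContinuous_strip {e : I} (he : 0 < T.wt e) : JContinuous κ (T.strip e) := by
  intro ξ
  refine ⟨ξ + T.wt e, fun u hu => ?_⟩
  rw [T.mem_J_iff, ← T.mem_wordsOf_good (p := fun l => κ.le (ξ + T.wt e) (T.posWt l))] at hu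
  have hle : wordsOf T.b (fun l => κ.le (ξ + T.wt e) (T.posWt l) ∧ Good T.par l)
      ≤ ((J κ t n ξ).restrictScalars ℂ).comap (T.strip e) := by
    refine wordsOf_le ?_
    rintro l ⟨hl, hg⟩
    rw [Submodule.mem_comap, T.strip_word e ⟨l, hg⟩]
    split_ifs with h
    · have hl' : l = l.dropLast ++ [e] := (List.dropLast_append_getLast? e h).symm
      refine J_anti ?_ (T.word_mem_J κ (hg.sublist (List.dropLast_sublist l)))
      rw [hl', posWt_append, T.posWt_of_pos (l := [e]) (by simpa using he)] at hl
      have := Comparison.add_right hl (-T.wt e)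
      simpa using this
    · exact zero_mem _
  exact hle hu

-- A good word with a letter of `n⁺` ends in one, so it is recovered from its stripped form. The sum
-- is finite and its terms are continuous, hence the identity passes to `Û`.
open Classical in
theorem sub_proj_zero [Fintype I] (u : U t n) : u - T.proj 0 u
    = ∑ e : {e : I // 0 < T.wt e}, T.strip e.1 u * Env.ι (T.b e.1) := by
  have h : LinearMap.id - T.proj 0 = ∑ e : {e : I // 0 < T.wt e},
      LinearMap.mulRight ℂ (Env.ι (T.b e.1)) ∘ₗ T.strip e.1 := by
    refine T.B.ext fun l => ?_
    rw [LinearMap.sum_apply, T.B_apply, LinearMap.sub_apply, LinearMap.id_apply]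
    have hP : word T.b l.1 ∈ JPrime t n (T.posWt l.1) := by
      rw [T.JPrime_eq]; exact word_mem_wordsOf ⟨rfl, l.2⟩
    by_cases hl : ∀ i ∈ l.1, ¬ 0 < T.wt i
    · rw [T.proj_of_mem_JPrime hP, if_pos (T.posWt_of_nonpos hl), sub_self,
        Finset.sum_eq_zero]
      intro e _
      rw [LinearMap.comp_apply, T.strip_word, if_neg, map_zero]
      intro h
      exact hl e.1 (List.mem_of_getLast? h) e.2
    · push Not at hl
      obtain ⟨i, hi, hi'⟩ := hl
      rw [T.proj_of_mem_JPrime hP, if_neg (T.posWt_pos hi hi').ne', sub_zero]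
      obtain ⟨m, e, hme⟩ := List.eq_nil_or_concat' l.1 |>.resolve_left (by
        intro h; rw [h] at hi; simp at hi)
      have he : 0 < T.wt e := by
        by_contra he
        rw [hme] at hi
        rcases List.mem_append.1 hi with hm | hm
        · have hs := l.2.1
          rw [hme, List.pairwise_append] at hs
          exact absurd (T.lt_of_pos e i he hi') (not_lt.2 (hs.2.2 i hm e (by simp)))
        · rw [List.mem_singleton.1 hm] at hi'
          exact he hi'
      rw [Finset.sum_eq_single ⟨e, he⟩]
      · rw [LinearMap.comp_apply, T.strip_word, if_pos (by rw [hme]; simp), hme]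
        simp [word_append, word_cons]
      · intro e' _ hne
        rw [LinearMap.comp_apply, T.strip_word, if_neg, map_zero]
        intro h
        rw [hme, List.getLast?_append] at h
        exact hne (Subtype.ext (by simpa using h.symm))
      · simp
  have := LinearMap.congr_fun h u
  simpa using this

open Classical in
theorem sub_hatProj_zero [Fintype I] (hn : 2 ≤ n) (u : UHat κ t n) :
    u - T.hatProj κ hn 0 u = ∑ e : {e : I // 0 < T.wt e},
      extend (T.jContinuous_strip (κ := κ) e.2) u * toHat κ t n (Env.ι (T.b e.1)) := by
  have h : (fun u : UHat κ t n => u - T.hatProj κ hn 0 u) = fun u => ∑ e : {e : I // 0 < T.wt e},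
      extend (T.jContinuous_strip (κ := κ) e.2) u * toHat κ t n (Env.ι (T.b e.1)) := by
    refine denseRange_toHat.equalizer ?_ ?_ ?_
    · exact continuous_id.sub (continuous_extend _)
    · exact continuous_finsetSum _ fun e _ => (continuous_extend _).mul continuous_const
    · funext a
      have := congrArg (toHat κ t n) (T.sub_proj_zero a)
      rw [map_sub, map_sum] at this
      simp only [Function.comp_apply, T.hatProj_toHat, this, extend_toHat, map_mul]
  exact congrFun h u

/-- As `n⁺` has finite dimension, the infinite tail of the expansion lies in the algebraic left
ideal `Û n⁺`; no closure is needed. -/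
theorem sub_comp_mem [Fintype I] (hn : 2 ≤ n) (u : UHat κ t n) :
    u - toHat κ t n (T.comp hn u 0)
      ∈ Ideal.span (toHat κ t n '' (Env.ι '' (nPlus t n : Set (Alg t n)))) := by
  rw [T.toHat_comp, T.sub_hatProj_zero]
  refine Ideal.sum_mem _ fun e _ => Ideal.mul_mem_left _ _ (Ideal.subset_span ⟨_, ⟨T.b e.1, ?_, rfl⟩, rfl⟩)
  change _ ∈ nPlus t n
  rw [T.nPlus_eq]
  exact Submodule.subset_span ⟨e.1, e.2, rfl⟩

theorem hatProj_zero_of_mem (hn : 2 ≤ n) {u : UHat κ t n}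
    (hu : u ∈ Ideal.span (toHat κ t n '' (Env.ι '' (nPlus t n : Set (Alg t n))))) :
    T.hatProj κ hn 0 u = 0 := by
  have key : ∀ x ∈ nPlus t n, ∀ a : U t n, T.proj 0 (a * Env.ι x) = 0 := by
    intro x hx a
    rw [T.nPlus_eq] at hx
    induction hx using Submodule.span_induction with
    | mem x hx =>
      obtain ⟨e, he, rfl⟩ := hx
      have h1 : Env.ι (T.b e) ∈ UNPlus t n (T.wt e) := by
        rw [T.UNPlus_eq]
        have := word_mem_wordsOf (b := T.b) (l := [e])
          (W := fun l => (∀ i ∈ l, 0 < T.wt i) ∧ (l.map T.wt).sum = T.wt e)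
          ⟨by simpa using he, by simp⟩
        rwa [word_cons, word_nil, mul_one] at this
      have h2 := T.mul_UNPlus_mem a h1
      rw [T.mem_wordsOf_good (p := fun l => T.wt e ≤ T.posWt l)] at h2
      refine T.proj_eq_zero (κ := .order) (ξ := T.wt e) ?_ (T.mem_J_iff.2 h2)
      exact fun h => absurd he (not_lt_of_ge h)
    | zero => simp
    | add _ _ _ _ h1 h2 => rw [map_add, mul_add, map_add, h1, h2, add_zero]
    | smul c _ _ h => rw [map_smul, mul_smul_comm, map_smul, h, smul_zero]
  have key' : ∀ x ∈ nPlus t n, ∀ v : UHat κ t n,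
      T.hatProj κ hn 0 (v * toHat κ t n (Env.ι x)) = 0 := by
    intro x hx v
    have h : (fun v : UHat κ t n => T.hatProj κ hn 0 (v * toHat κ t n (Env.ι x))) = fun _ => 0 := by
      refine denseRange_toHat.equalizer ?_ continuous_const ?_
      · exact (continuous_extend _).comp (continuous_id.mul continuous_const)
      · funext a
        simp only [Function.comp_apply]
        rw [← map_mul, T.hatProj_toHat, key x hx, map_zero]
    exact congrFun h v
  unfold Ideal.span at hu
  have : ∀ v : UHat κ t n, T.hatProj κ hn 0 (v * u) = 0 := by
    induction hu using Submodule.span_induction with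
    | mem u hu =>
      obtain ⟨_, ⟨x, hx, rfl⟩, rfl⟩ := hu
      exact key' x hx
    | zero => simp
    | add _ _ _ _ h1 h2 => intro v; rw [mul_add, map_add, h1, h2, add_zero]
    | smul c _ _ h => intro v; rw [smul_eq_mul, ← mul_assoc]; exact h _
  simpa using this 1

theorem mem_hcKernel {u : UHat κ t n} : u ∈ hcKernel κ t n ↔ ∃ a ∈ nMinusUBMinus t n,
    u - toHat κ t n a ∈ Ideal.span (toHat κ t n '' (Env.ι '' (nPlus t n : Set (Alg t n)))) := by
  rw [hcKernel, AddSubgroup.mem_sup]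
  constructor
  · rintro ⟨_, ⟨a, ha, rfl⟩, y, hy, rfl⟩
    refine ⟨a, ha, ?_⟩
    have : toHat κ t n a + y - toHat κ t n a = y := by abel
    exact this.symm ▸ hy
  · rintro ⟨a, ha, h⟩
    exact ⟨toHat κ t n a, ⟨a, ha, rfl⟩, _, h, by abel⟩

theorem exists_isHC [Fintype I] (T : TriBasis t n I) (hn : 2 ≤ n) (u : UHat κ t n) :
    ∃ a, IsHC u a := by
  obtain ⟨a, ha, m, hm, h⟩ := Submodule.mem_sup.1 (T.UBMinus_le (T.comp_zero_mem_UBMinus hn u))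
  refine ⟨a, ha, mem_hcKernel.2 ⟨m, hm, ?_⟩⟩
  have := T.sub_comp_mem hn u
  rwa [← h, map_add, ← sub_sub] at this

/-- The projection to `J'(0) = U(b⁻)` kills `Û n⁺`, so the difference lies in `U(h) ∩ n⁻ U(b⁻)`,
which is zero. -/
theorem isHC_unique (T : TriBasis t n I) (hn : 2 ≤ n) {u : UHat κ t n} {a a' : U t n}
    (h : IsHC u a) (h' : IsHC u a') : a = a' := by
  have h1 : toHat κ t n (a' - a) ∈ hcKernel κ t n := by
    have := sub_mem h.2 h'.2
    rwa [sub_sub_sub_cancel_left, ← map_sub] at this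
  obtain ⟨m, hm, h2⟩ := mem_hcKernel.1 h1
  have h3 := T.hatProj_zero_of_mem hn h2
  have hc : UCartan t n ≤ UBMinus t n :=
    Algebra.adjoin_mono (Set.image_mono fun x hx => Submodule.mem_sup_right hx)
  have h4 : a' - a ∈ UCartan t n := sub_mem h'.1 h.1
  rw [map_sub, T.hatProj_toHat, T.hatProj_toHat, T.proj_zero_of_mem_UBMinus (hc h4),
    T.proj_zero_of_mem_UBMinus (nMinusUBMinus_le_UBMinus hm), sub_eq_zero] at h3
  have h5 := T.toHat_injective (κ := κ) hn h3
  have h6 := T.eq_zero_of_mem_UCartan h4 (h5 ▸ hm)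
  exact (sub_eq_zero.1 h6).symm

theorem HC_eq (T : TriBasis t n I) (hn : 2 ≤ n) {u : UHat κ t n} {a : U t n} (h : IsHC u a) :
    HC u = a := by
  have h' : ∃ a, IsHC u a := ⟨a, h⟩
  rw [HC, dif_pos h']
  exact T.isHC_unique hn h'.choose_spec h

end TriBasis

end QType

namespace QType

/-! ### Degrees of central elements -/

theorem filtDeg_le {A A' : Type*} [Zero A] [Zero A'] {F : ℕ → Set A} {G : ℕ → Set A'} {x : A}
    {y : A'} (h0 : y = 0 → x = 0) (h : ∀ k, y ∈ G k → x ∈ F k) : filtDeg F x ≤ filtDeg G y := by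
  unfold filtDeg
  split_ifs with hx hy hy
  · exact le_rfl
  · exact bot_le
  · exact absurd (h0 hy) hx
  · exact WithBot.coe_le_coe.2 (le_iInf₂ fun k hk => iInf₂_le k (h k hk))

theorem sgn_comm (i j : ZMod 2) : sgn i j = sgn j i := by
  simp only [sgn, and_comm]

theorem sgn_mul_self (i j : ZMod 2) : sgn i j * sgn i j = 1 := by
  unfold sgn
  split_ifs <;> norm_num

theorem sgn_zero_left (j : ZMod 2) : sgn 0 j = 1 := by simp [sgn]

theorem ι_mem_part {L : Type*} [AddCommGroup L] [Module ℂ L] [LieSuperalgebra L] {i : ZMod 2}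
    {x : L} (hx : x ∈ LieSuperalgebra.part i) : Env.ι x ∈ Env.part (L := L) i :=
  Submodule.subset_span ⟨[(i, x)], by simpa using hx, by simp, by simp⟩

/-- `c` is an element of parity `p` that supercommutes with all homogeneous elements. -/
structure SuperCentral {κ : Comparison} {t : Kind} {n : ℕ} (p : ZMod 2) (c : UHat κ t n) :
    Prop where
  mem : c ∈ hatPart κ t n p
  comm : ∀ j, ∀ y ∈ hatPart κ t n j,
    c * y = toHat κ t n (algebraMap ℂ (U t n) (sgn p j)) * (y * c)

theorem SuperCentral.comm_ι {κ : Comparison} {t : Kind} {n : ℕ} {p j : ZMod 2} {c : UHat κ t n}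
    (hc : SuperCentral p c) {x : Alg t n} (hx : x ∈ LieSuperalgebra.part (L := Alg t n) j) :
    c * toHat κ t n (Env.ι x)
      = toHat κ t n (algebraMap ℂ (U t n) (sgn p j)) * (toHat κ t n (Env.ι x) * c) :=
  hc.comm j _ (subset_closure ⟨_, ι_mem_part hx, rfl⟩)

/-! ### Consequences of supercommuting with the grading element and with `n⁻`. -/

namespace TriBasis

variable {κ : Comparison} {t : Kind} {n : ℕ} {I : Type} [LinearOrder I] (T : TriBasis t n I)

theorem ι_mul_word {h : Alg t n} (hh : h ∈ LieSuperalgebra.part (L := Alg t n) 0)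
    (hb : ∀ i, LieSuperalgebra.br h (T.b i) = (height (T.wt i) : ℂ) • T.b i) (l : List I) :
    Env.ι h * word T.b l - word T.b l * Env.ι h = (height (l.map T.wt).sum : ℂ) • word T.b l := by
  induction l with
  | nil => simp [word_nil, height_zero]
  | cons i l ih =>
    rw [sub_eq_iff_eq_add] at ih
    rw [word_cons, ← mul_assoc, Env.ι_mul_ι hh (T.homog i), sgn_zero_left, one_smul, hb, map_smul,
      add_mul, mul_assoc, ih, mul_add, List.map_cons, List.sum_cons, height_add, Int.cast_add,
      add_smul, mul_smul_comm, smul_mul_assoc, mul_assoc]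
    abel

/-- The commutator with `h` multiplies each word by its total height. So the words in `u(0)` have
height zero, and a word of non-positive letters with this property has all its letters in the Cartan
subalgebra. -/
theorem comp_zero_mem_UCartan (hn : 2 ≤ n) {h : Alg t n}
    (hh : h ∈ LieSuperalgebra.part (L := Alg t n) 0)
    (hh' : h ∈ induced t (supported fun p q => root p q = 0))
    (hb : ∀ i, LieSuperalgebra.br h (T.b i) = (height (T.wt i) : ℂ) • T.b i) {u : UHat κ t n}
    (hu : u * toHat κ t n (Env.ι h) = toHat κ t n (Env.ι h) * u) :
    T.comp hn u 0 ∈ UCartan t n := by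
  obtain ⟨a, ha⟩ := exists_approx u (0 + 1)
  have hJ : Env.ι h * a - a * Env.ι h ∈ J κ t n (0 + 1) := by
    rw [← toHat_mem_hatJ]
    have h1 := mul_ι_mem_hatJ hh' ha
    rw [add_zero] at h1
    have h2 := sub_mem h1 (mul_mem_hatJ (toHat κ t n (Env.ι h)) ha)
    rw [sub_mul, mul_sub, hu] at h2
    rw [map_sub, map_mul, map_mul]
    convert h2 using 1
    abel
  have hrepr : ∀ l, T.B.repr (Env.ι h * a - a * Env.ι h) l
      = (height (l.1.map T.wt).sum : ℂ) * T.B.repr a l := by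
    intro l
    have : T.B.coord l ∘ₗ (LinearMap.mulLeft ℂ (Env.ι h) - LinearMap.mulRight ℂ (Env.ι h))
        = (height (l.1.map T.wt).sum : ℂ) • T.B.coord l := by
      refine T.B.ext fun m => ?_
      rw [T.B_apply, LinearMap.comp_apply, LinearMap.sub_apply, LinearMap.mulLeft_apply,
        LinearMap.mulRight_apply, T.ι_mul_word hh hb, map_smul, LinearMap.smul_apply,
        Module.Basis.coord_apply, T.repr_B]
      split_ifs with hlm
      · rw [hlm]
      · simp
    exact LinearMap.congr_fun this a
  rw [T.comp_of_approx hn (not_le_add_one hn 0) ha, T.mem_UCartan_iff]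
  intro l hl
  rw [T.repr_proj] at hl
  split_ifs at hl with hl0
  · have hnp := T.nonpos_of_posWt hl0
    refine (T.height_sum_nonpos hnp).2 ?_
    by_contra hne
    have := T.mem_J_iff.1 hJ l (by
      rw [hrepr]
      exact mul_ne_zero (Int.cast_ne_zero.2 hne) hl)
    rw [hl0] at this
    exact not_le_add_one hn 0 this
  · exact absurd rfl hl

theorem comp_mem_part (hn : 2 ≤ n) {p : ZMod 2} {c : UHat κ t n} (hc : c ∈ hatPart κ t n p)
    (ν : RootLattice n) : T.comp hn c ν ∈ Env.part (L := Alg t n) p := by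
  obtain ⟨a, ha, h⟩ := mem_closure_iff_approx.1 hc (ν + 1)
  rw [T.comp_of_approx hn (not_le_add_one hn ν) h, T.mem_part_iff]
  intro l hl
  rw [T.repr_proj] at hl
  refine T.mem_part_iff.1 ha l fun h0 => hl ?_
  rw [h0, ite_self]

theorem commutator_mem_J (T : TriBasis t n I) {p : ZMod 2} {c : UHat κ t n} (hc : SuperCentral p c)
    {ξ : RootLattice n} {a : U t n} (ha : c - toHat κ t n a ∈ hatJ κ t n ξ) {f : I}
    (hf : T.wt f < 0) :
    Env.ι (T.b f) * a - sgn (T.par f) p • (a * Env.ι (T.b f)) ∈ J κ t n (ξ + T.wt f) := by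
  rw [← toHat_mem_hatJ]
  have h1 := mul_mem_hatJ (toHat κ t n (algebraMap ℂ (U t n) (sgn (T.par f) p)))
    (mul_ι_mem_hatJ (T.mem_wt f) ha)
  have hle : ξ + T.wt f ≤ ξ := add_le_of_nonpos_right hf.le
  have h2 := hatJ_anti (Comparison.le_of_le hle)
    (mul_mem_hatJ (toHat κ t n (Env.ι (T.b f))) ha)
  have h3 := sub_mem h1 h2
  rw [sub_mul, mul_sub, mul_sub, hc.comm_ι (T.homog f), ← mul_assoc, ← map_mul, ← map_mul,
    sgn_comm p, sgn_mul_self, map_one, map_one, one_mul] at h3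
  rw [Algebra.smul_def, map_sub, map_mul, map_mul, map_mul]
  convert h3 using 1
  abel

/-- The length of the words in an element that supercommutes with everything is bounded by that
of the words in its component of weight zero. -/
theorem comp_mem_wordSpan (hn : 2 ≤ n) {p : ZMod 2} {c : UHat κ t n} (hc : SuperCentral p c)
    {K : ℕ} (h0 : T.comp hn c 0 ∈ wordSpan T.b (fun _ => True) K) {ν : RootLattice n}
    (hν : 0 ≤ ν) : T.comp hn c ν ∈ wordSpan T.b (fun _ => True) K := by
  generalize hN : (height ν).toNat = N
  induction N using Nat.strong_induction_on generalizing ν with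
  | _ N ih =>
  by_cases hν0 : ν = 0
  · rwa [hν0]
  have hlt : 0 < ν := lt_of_le_of_ne hν (Ne.symm hν0)
  have hpos : 0 < height ν := by simpa [height_zero] using height_lt hlt
  -- This approximation is homogeneous of parity `p` and has the same components as `c` in all
  -- weights `μ ≤ ν`.
  obtain ⟨a, ha, happ⟩ := mem_closure_iff_approx.1 hc.mem (ν + 1)
  have hcomp : ∀ μ ≤ ν, T.comp hn c μ = T.proj μ a := fun μ hμ =>
    T.comp_of_approx hn (fun h => not_le_add_one hn ν
      (Comparison.le_trans h (Comparison.le_of_le hμ))) happ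
  have key := T.length_lt ha hν0 (K := K) (fun l hl hlν => ?_) fun f hf m hm => ?_
  · rw [hcomp ν le_rfl, T.mem_wordSpan_iff]
    intro l hl
    rw [T.repr_proj] at hl
    split_ifs at hl with h
    · exact key l hl h
    · exact absurd rfl hl
  · have h1 := ih _ (by have := height_lt hlν; omega) (T.posWt_nonneg l.1) rfl
    rw [hcomp _ hlν.le, T.mem_wordSpan_iff] at h1
    exact h1 l (by rwa [T.repr_proj, if_pos rfl])
  -- The commutator of `b f` with `a` lies in `J(ν + 1 + wt f)`, so it has no words of `n⁺`-weight
  -- `ν + wt f`.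
  · by_contra hne
    have := T.mem_J_iff.1 (T.commutator_mem_J hc happ hf) m hne
    rw [hm, add_right_comm] at this
    exact not_le_add_one hn _ this

theorem mem_centre {z : UHat κ t n} (hz : z ∈ centre κ t n) :
    ∃ c : ZMod 2 → UHat κ t n, z = c 0 + c 1 ∧ ∀ p, SuperCentral p (c p) := by
  obtain ⟨c, hc, hzc, h⟩ := hz
  exact ⟨c, hzc, fun p => ⟨hc p, h p⟩⟩

/-- Every PBW word has a parity, so the even and odd parts of `z(0)` have disjoint supports and a
length bound for `z(0)` is inherited by both. -/
theorem comp_mem_wordSpan_of_mem_centre (hn : 2 ≤ n) {z : UHat κ t n} (hz : z ∈ centre κ t n)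
    {K : ℕ} (h0 : T.comp hn z 0 ∈ wordSpan T.b (fun _ => True) K) {ν : RootLattice n}
    (hν : 0 ≤ ν) : T.comp hn z ν ∈ wordSpan T.b (fun _ => True) K := by
  obtain ⟨c, rfl, hc⟩ := mem_centre hz
  rw [T.comp_add, T.mem_wordSpan_iff] at h0
  have hdis : ∀ l, T.B.repr (T.comp hn (c 0) 0) l ≠ 0 → T.B.repr (T.comp hn (c 1) 0) l ≠ 0 →
      False := fun l h h' => by
    have := T.mem_part_iff.1 (T.comp_mem_part hn (hc 0).mem 0) l h
    rw [T.mem_part_iff.1 (T.comp_mem_part hn (hc 1).mem 0) l h'] at this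
    exact one_ne_zero this
  rw [T.comp_add]
  refine add_mem (T.comp_mem_wordSpan hn (hc 0) ?_ hν) (T.comp_mem_wordSpan hn (hc 1) ?_ hν)
  · refine T.mem_wordSpan_iff.2 fun l hl => h0 l ?_
    rw [map_add, Finsupp.add_apply, not_not.1 fun h => hdis l hl h, add_zero]
    exact hl
  · refine T.mem_wordSpan_iff.2 fun l hl => h0 l ?_
    rw [map_add, Finsupp.add_apply, not_not.1 fun h => hdis l h hl, zero_add]
    exact hl

theorem isHC_comp_zero [Fintype I] (hn : 2 ≤ n) {z : UHat κ t n} (hz : z ∈ centre κ t n) :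
    IsHC z (T.comp hn z 0) := by
  refine ⟨?_, mem_hcKernel.2 ⟨0, zero_mem _, ?_⟩⟩
  · obtain ⟨h, hh, hh', hb⟩ := T.exists_grading
    refine T.comp_zero_mem_UCartan hn hh hh' hb ?_
    obtain ⟨c, rfl, hc⟩ := mem_centre hz
    rw [add_mul, (hc 0).comm_ι hh, (hc 1).comm_ι hh, sgn_00, sgn_10, map_one, map_one, one_mul,
      one_mul, mul_add]
  · rw [map_zero, sub_zero]
    exact T.sub_comp_mem hn z

/-- This is the length bound with `K = 0`, which no word satisfies. -/
theorem comp_eq_zero (hn : 2 ≤ n) {z : UHat κ t n} (hz : z ∈ centre κ t n)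
    (h0 : T.comp hn z 0 = 0) {ν : RootLattice n} (hν : 0 ≤ ν) : T.comp hn z ν = 0 := by
  have := T.comp_mem_wordSpan_of_mem_centre hn hz (K := 0) (h0 ▸ zero_mem _) hν
  simpa [wordSpan] using this

theorem comp_mem_filt (hn : 2 ≤ n) {z : UHat κ t n} (hz : z ∈ centre κ t n) {k : ℕ}
    (h0 : T.comp hn z 0 ∈ Env.filt (L := Alg t n) k) {ν : RootLattice n} (hν : 0 ≤ ν) :
    T.comp hn z ν ∈ Env.filt (L := Alg t n) k := by
  rw [← wordSpan_one_le_filt (b := T.b)] at h0 ⊢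
  exact T.comp_mem_wordSpan_of_mem_centre hn hz h0 hν

theorem degU_comp_le (hn : 2 ≤ n) {z : UHat κ t n} (hz : z ∈ centre κ t n) {ν : RootLattice n}
    (hν : 0 ≤ ν) : degU t n (T.comp hn z ν) ≤ degU t n (T.comp hn z 0) :=
  filtDeg_le (fun h => T.comp_eq_zero hn hz h hν) fun _ h => T.comp_mem_filt hn hz h hν

theorem degHat_eq (hn : 2 ≤ n) {z : UHat κ t n} (hz : z ∈ centre κ t n) :
    degHat κ t n z = degU t n (T.comp hn z 0) := by
  refine le_antisymm (filtDeg_le (fun h => ?_) fun k h => ?_) (filtDeg_le (fun h => ?_) fun k h => ?_)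
  · exact T.eq_zero_of_comp hn fun ν hν => T.comp_eq_zero hn hz h hν
  · exact (T.mem_filtHat_iff hn).2 fun ν hν => T.comp_mem_filt hn hz h hν
  · refine T.toHat_injective (κ := κ) hn ?_
    rw [T.toHat_comp, h, map_zero, map_zero]
  · exact (T.mem_filtHat_iff hn).1 h 0 le_rfl

end TriBasis

end QType

theorem mainTheorem4 (κ : QType.Comparison) (t : QType.Kind) (n : ℕ) (hn : t.minRank ≤ n) :
    (∀ u : QType.UHat κ t n,
      (∃! a : QType.U t n, QType.IsHC u a) ∧
      (∃! c : {ν : QType.RootLattice n // 0 ≤ ν} → QType.U t n, QType.IsExpansion u c)) ∧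
    ∀ z ∈ QType.centre κ t n,
      QType.degHat κ t n z = QType.degU t n (QType.HC z) ∧
      ∀ c : {ν : QType.RootLattice n // 0 ≤ ν} → QType.U t n, QType.IsExpansion z c →
        ∀ ν, QType.degU t n (c ν) ≤ QType.degU t n (c 0) := by
  obtain ⟨T⟩ := QType.exists_triBasis hn
  have hn2 : 2 ≤ n := by cases t <;> simp only [QType.Kind.minRank] at hn <;> omega
  refine ⟨fun u => ⟨?_, ?_⟩, fun z hz => ⟨?_, ?_⟩⟩
  · obtain ⟨a, ha⟩ := T.exists_isHC hn2 u
    exact ⟨a, ha, fun _ ha' => T.isHC_unique hn2 ha' ha⟩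
  · exact ⟨_, T.isExpansion_comp hn2 u, fun _ hc => T.eq_comp_of_isExpansion hn2 hc⟩
  · rw [T.HC_eq hn2 (T.isHC_comp_zero hn2 hz)]
    exact T.degHat_eq hn2 hz
  · intro c hc ν
    rw [T.eq_comp_of_isExpansion hn2 hc]
    exact T.degU_comp_le hn2 hz ν.2
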